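/- Let $S_1,S_2\ge 0$ and consider the Gaussian multiple-access channel $Z=X+Y+N$ with real inputs $X,Y$ and $N\sim\mathcal N(0,1)$ independent of $(X,Y)$; write $W_{xy}=\mathcal N(x+y,1)$. For a joint law $P_{XY}$, the wringing dependence is $$\Delta(X;Y)=\inf_{Q_X,Q_Y}\ \sup_{\mathcal A,\mathcal B}\ \inf\{\delta\ge 0:\ P_{XY}(\mathcal A\times\mathcal B)^{1+\delta}\le Q_X(\mathcal A)Q_Y(\mathcal B)\},$$ where $Q_X,Q_Y$ range over probability measures, $\mathcal A,\mathcal B$ over measurable sets, and $\inf\emptyset=\infty$. For $\alpha_1,\alpha_2\ge 0$ and $\delta\ge 0$ let $$C_{\alpha_1,\alpha_2}(\delta)=\sup\big[\min\{\alpha_1,\alpha_2\}\,I(X,Y;Z|U)+|\alpha_1-\alpha_2|^+\,I(X;Z|Y,U)+|\alpha_2-\alpha_1|^+\,I(Y;Z|X,U)\big],$$ the supremum being over all laws $P_{UXY}$ ($U$ with an arbitrary alphabet) such that $\mathbb E[X^2]\le S_1$, $\mathbb E[Y^2]\le S_2$ and $\Delta(X;Y|U=u)\le\delta$ for all $u$.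 Here $|x|^+=\max\{0,x\}$ and logarithms are natural. Let $C'_{\alpha_1,\alpha_2}(0)=\limsup_{\delta\downarrow 0}\big(C_{\alpha_1,\alpha_2}(\delta)-C_{\alpha_1,\alpha_2}(0)\big)/\delta$ be the (upper) right derivative at $0$. With $V(P\|Q)=\mathrm{Var}_P(\log\frac{dP}{dQ})$, let $$V_{\max}=\sup_{P_{UXY}:\ \mathbb E[X^2]\le S_1,\ \mathbb E[Y^2]\le S_2}\max\big\{\mathbb E\,V(W_{XY}\|P_{Z|U}),\ \mathbb E\,V(W_{XY}\|P_{Z|Y,U}),\ \mathbb E\,V(W_{XY}\|P_{Z|X,U})\big\},$$ with the output distributions induced by $P_{UXY}$ and no independence constraint. A code of blocklength $n$ with message counts $M_1,M_2\ge1$ consists of two stochastic encoders, sending message $i_1\in[M_1]$ to a random $X^n\in\mathbb R^n$ with $\sum_t X_t^2\le nS_1$ a.s. and message $i_2\in[M_2]$ to a random $Y^n\in\mathbb R^n$ with $\sum_t Y_t^2\le nS_2$ a.s., and a stochastic decoder that maps the output $Z^n$ of the memoryless channel to an estimate of $(i_1,i_2)$. Let $\mathcal R(n,\epsilon)$ be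 the set of pairs $\big(\frac{\log M_1}{n},\frac{\log M_2}{n}\big)$ for which there is such a code whose error probability, averaged over independent uniform messages, is at most $\epsilon$. Let the capacity region $\mathcal C$ be the set of pairs $(R_1,R_2)$ with $R_1,R_2\ge 0$ such that for every $\epsilon>0$ and all sufficiently large $n$ there is $(R_1',R_2')\in\mathcal R(n,\epsilon)$ with $R_1\le R_1'$ and $R_2\le R_2'$. Then: 1. $C_{\alpha_1,\alpha_2}(0)$ is finite and $C'_{\alpha_1,\alpha_2}(0)$ is bounded by a finite constant, uniformly over all $\alpha_1,\alpha_2\ge0$ with $\max\{\alpha_1,\alpha_2\}=1$; 2. $V_{\max}<\infty$; 3. for every $\epsilon\in(0,1)$, $\mathcal R(n,\epsilon)\subseteq\mathcal C+O(1/\sqrt n)$; that is, there is a constant $K$ (depending on $\epsilon,S_1,S_2$) such that, for all sufficiently large $n$, every $r\in\mathcal R(n,\epsilon)$ has a point $c\in\mathcal C$ with $|r_1-c_1|\le K/\sqrt n$ and $|r_2-c_2|\le K/\sqrt n$. -/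

import Mathlib

open MeasureTheory ProbabilityTheory Filter Topology
open scoped ENNReal NNReal

noncomputable section

/-- A two-user multiple-access channel with cost constraints: the transition law
`W (x, y)` of the output given the inputs, the cost functions and the cost bounds. -/
structure MAC (𝒳 𝒴 𝒵 : Type) [MeasurableSpace 𝒳] [MeasurableSpace 𝒴] [MeasurableSpace 𝒵] where
  W : Kernel (𝒳 × 𝒴) 𝒵
  markov : IsMarkovKernel W
  b₁ : 𝒳 → ℝ
  b₂ : 𝒴 → ℝ
  B₁ : ℝ
  B₂ : ℝ

/-- `Z = X + Y + N` with `N` standard normal, as a kernel. -/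
def gaussianMACKernel : Kernel (ℝ × ℝ) ℝ where
  toFun p := gaussianReal (p.1 + p.2) 1
  measurable' := by
    have h : (fun p : ℝ × ℝ => gaussianReal (p.1 + p.2) 1)
        = fun p : ℝ × ℝ => (gaussianReal 0 1).map (fun z => z + (p.1 + p.2)) := by
      funext p
      rw [gaussianReal_map_add_const, zero_add]
    rw [h]
    refine Measure.measurable_of_measurable_coe _ fun s hs => ?_
    have h2 : (fun p : ℝ × ℝ => (gaussianReal 0 1).map (fun z => z + (p.1 + p.2)) s)
        = fun p : ℝ × ℝ => gaussianReal 0 1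
            (Prod.mk p ⁻¹' ((fun q : (ℝ × ℝ) × ℝ => q.2 + (q.1.1 + q.1.2)) ⁻¹' s)) := by
      funext p
      rw [Measure.map_apply (by fun_prop) hs]
      rfl
    rw [h2]
    exact measurable_measure_prodMk_left ((by fun_prop : Measurable
      (fun q : (ℝ × ℝ) × ℝ => q.2 + (q.1.1 + q.1.2))) hs)

/-- The Gaussian MAC with power constraints `S₁`, `S₂`. -/
def gaussianMAC (S₁ S₂ : ℝ) : MAC ℝ ℝ ℝ where
  W := gaussianMACKernel
  markov := ⟨fun p => (inferInstance : IsProbabilityMeasure (gaussianReal (p.1 + p.2) 1))⟩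
  b₁ := fun x => x ^ 2
  b₂ := fun y => y ^ 2
  B₁ := S₁
  B₂ := S₂

/-- The wringing dependence `Δ(X;Y)` of a joint law `μ` of `(X, Y)`: the infimum over
probability measures `Q_X, Q_Y` of the supremum over events `A, B` of
`inf {δ ≥ 0 : μ(A × B)^(1+δ) ≤ Q_X(A) Q_Y(B)}` (with `inf ∅ = ∞`). -/
def wringingDependence {𝒳 𝒴 : Type} [MeasurableSpace 𝒳] [MeasurableSpace 𝒴]
    (μ : Measure (𝒳 × 𝒴)) : ℝ≥0∞ :=
  ⨅ (QX : ProbabilityMeasure 𝒳) (QY : ProbabilityMeasure 𝒴),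
    ⨆ (A : Set 𝒳) (_ : MeasurableSet A) (B : Set 𝒴) (_ : MeasurableSet B),
      ⨅ (δ : ℝ≥0) (_ : μ (A ×ˢ B) ^ (1 + (δ : ℝ)) ≤
        (QX : Measure 𝒳) A * (QY : Measure 𝒴) B), (δ : ℝ≥0∞)

/-- The divergence variance `V(P‖Q) = Var_P (log dP/dQ)`, with value `∞` unless `P ≪ Q`. -/
def divergenceVariance {𝒵 : Type} [MeasurableSpace 𝒵] (P Q : Measure 𝒵) : ℝ≥0∞ :=
  ⨅ _ : P ≪ Q, evariance (llr P Q) P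

/-- A law `P_{UXY}`, given by the law `PU` of `U` on an arbitrary alphabet and the conditional
law `PXY` of `(X, Y)` given `U`. -/
structure InputLaw (𝒳 𝒴 : Type) [MeasurableSpace 𝒳] [MeasurableSpace 𝒴] where
  𝒰 : Type
  mU : MeasurableSpace 𝒰
  PU : Measure 𝒰
  prob : IsProbabilityMeasure PU
  PXY : Kernel 𝒰 (𝒳 × 𝒴)
  markov : IsMarkovKernel PXY

attribute [instance] MAC.markov InputLaw.mU InputLaw.prob InputLaw.markov

namespace MAC

variable {𝒳 𝒴 𝒵 : Type} [MeasurableSpace 𝒳] [MeasurableSpace 𝒴] [MeasurableSpace 𝒵]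

/-- `E[b₁(X)] ≤ B₁` and `E[b₂(Y)] ≤ B₂`, the expectations being required to exist. -/
def MeetsCost (m : MAC 𝒳 𝒴 𝒵) (P : InputLaw 𝒳 𝒴) : Prop :=
  (Integrable (fun p : 𝒳 × 𝒴 => m.b₁ p.1) (P.PU.bind P.PXY) ∧
    ∫ p, m.b₁ p.1 ∂(P.PU.bind P.PXY) ≤ m.B₁) ∧
  (Integrable (fun p : 𝒳 × 𝒴 => m.b₂ p.2) (P.PU.bind P.PXY) ∧
    ∫ p, m.b₂ p.2 ∂(P.PU.bind P.PXY) ≤ m.B₂)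

section Induced

/-! Output laws induced by a joint law `μ` of the inputs. -/

/-- `P_Z`. -/
def outZ (m : MAC 𝒳 𝒴 𝒵) (μ : Measure (𝒳 × 𝒴)) : Measure 𝒵 := μ.bind m.W

/-- `P_{Z|X=x}`. -/
def outZGivenX [StandardBorelSpace 𝒴] [Nonempty 𝒴] (m : MAC 𝒳 𝒴 𝒵)
    (μ : Measure (𝒳 × 𝒴)) [IsFiniteMeasure μ] (x : 𝒳) : Measure 𝒵 :=
  (μ.condKernel x).bind fun y => m.W (x, y)

/-- `P_{Z|Y=y}`. -/
def outZGivenY [StandardBorelSpace 𝒳] [Nonempty 𝒳] (m : MAC 𝒳 𝒴 𝒵)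
    (μ : Measure (𝒳 × 𝒴)) [IsFiniteMeasure μ] (y : 𝒴) : Measure 𝒵 :=
  ((μ.map Prod.swap).condKernel y).bind fun x => m.W (x, y)

variable [StandardBorelSpace 𝒳] [Nonempty 𝒳] [StandardBorelSpace 𝒴] [Nonempty 𝒴]

open InformationTheory in
/-- `I(X,Y;Z|U) = D(W ‖ P_{Z|U} | P_{UXY})`. -/
def infoXY (m : MAC 𝒳 𝒴 𝒵) (P : InputLaw 𝒳 𝒴) : ℝ≥0∞ :=
  ∫⁻ u, ∫⁻ p, klDiv (m.W p) (m.outZ (P.PXY u)) ∂(P.PXY u) ∂P.PU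

open InformationTheory in
/-- `I(X;Z|Y,U) = D(W ‖ P_{Z|YU} | P_{UXY})`. -/
def infoX (m : MAC 𝒳 𝒴 𝒵) (P : InputLaw 𝒳 𝒴) : ℝ≥0∞ :=
  ∫⁻ u, ∫⁻ p, klDiv (m.W p) (m.outZGivenY (P.PXY u) p.2) ∂(P.PXY u) ∂P.PU

open InformationTheory in
/-- `I(Y;Z|X,U) = D(W ‖ P_{Z|XU} | P_{UXY})`. -/
def infoY (m : MAC 𝒳 𝒴 𝒵) (P : InputLaw 𝒳 𝒴) : ℝ≥0∞ :=
  ∫⁻ u, ∫⁻ p, klDiv (m.W p) (m.outZGivenX (P.PXY u) p.1) ∂(P.PXY u) ∂P.PU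

/-- `C_{α₁,α₂}(δ)`. Note that `ENNReal.ofReal` is the positive part. -/
def weightedCapacity (m : MAC 𝒳 𝒴 𝒵) (α₁ α₂ : ℝ) (δ : ℝ≥0) : ℝ≥0∞ :=
  ⨆ (P : InputLaw 𝒳 𝒴) (_ : m.MeetsCost P)
    (_ : ∀ u, wringingDependence (P.PXY u) ≤ δ),
    ENNReal.ofReal (min α₁ α₂) * m.infoXY P
      + ENNReal.ofReal (α₁ - α₂) * m.infoX P
      + ENNReal.ofReal (α₂ - α₁) * m.infoY P

/-- `C'_{α₁,α₂}(0)`: the upper right derivative at `0` of the non-decreasing function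
`δ ↦ C_{α₁,α₂}(δ)` on `[0, ∞)`. -/
def weightedCapacityDeriv (m : MAC 𝒳 𝒴 𝒵) (α₁ α₂ : ℝ) : ℝ≥0∞ :=
  limsup (fun δ : ℝ≥0 =>
    (m.weightedCapacity α₁ α₂ δ - m.weightedCapacity α₁ α₂ 0) / (δ : ℝ≥0∞)) (𝓝[>] 0)

/-- `V_max`. -/
def Vmax (m : MAC 𝒳 𝒴 𝒵) : ℝ≥0∞ :=
  ⨆ (P : InputLaw 𝒳 𝒴) (_ : m.MeetsCost P),
    max (∫⁻ u, ∫⁻ p, divergenceVariance (m.W p) (m.outZ (P.PXY u)) ∂(P.PXY u) ∂P.PU)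
      (max
        (∫⁻ u, ∫⁻ p, divergenceVariance (m.W p) (m.outZGivenY (P.PXY u) p.2)
          ∂(P.PXY u) ∂P.PU)
        (∫⁻ u, ∫⁻ p, divergenceVariance (m.W p) (m.outZGivenX (P.PXY u) p.1)
          ∂(P.PXY u) ∂P.PU))

end Induced

/-- A (stochastic) code of blocklength `n` with message sets `Fin M₁`, `Fin M₂`, whose
codewords satisfy the cost constraints almost surely. -/
structure Code (m : MAC 𝒳 𝒴 𝒵) (n M₁ M₂ : ℕ) where
  enc₁ : Kernel (Fin M₁) (Fin n → 𝒳)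
  enc₂ : Kernel (Fin M₂) (Fin n → 𝒴)
  dec : Kernel (Fin n → 𝒵) (Fin M₁ × Fin M₂)
  enc₁_markov : IsMarkovKernel enc₁
  enc₂_markov : IsMarkovKernel enc₂
  dec_markov : IsMarkovKernel dec
  cost₁ : ∀ i, ∀ᵐ x ∂(enc₁ i), (1 / (n : ℝ)) * ∑ t, m.b₁ (x t) ≤ m.B₁
  cost₂ : ∀ i, ∀ᵐ y ∂(enc₂ i), (1 / (n : ℝ)) * ∑ t, m.b₂ (y t) ≤ m.B₂

/-- The average probability of error over uniform independent messages, when the code is used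
on the `n`-length memoryless product channel. -/
def Code.errorProb {m : MAC 𝒳 𝒴 𝒵} {n M₁ M₂ : ℕ} (c : m.Code n M₁ M₂) : ℝ≥0∞ :=
  (∑ i₁ : Fin M₁, ∑ i₂ : Fin M₂,
    ∫⁻ x, ∫⁻ y, ∫⁻ z, c.dec z {(i₁, i₂)}ᶜ
      ∂(Measure.pi fun t => m.W (x t, y t)) ∂(c.enc₂ i₂) ∂(c.enc₁ i₁)) / ((M₁ * M₂ : ℕ) : ℝ≥0∞)

/-- `R(n, ε)`: the rate pairs of codes of blocklength `n` with average error at most `ε`. -/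
def rateRegion (m : MAC 𝒳 𝒴 𝒵) (n : ℕ) (ε : ℝ) : Set (ℝ × ℝ) :=
  {r | ∃ M₁ M₂ : ℕ, 0 < M₁ ∧ 0 < M₂ ∧
    (∃ c : m.Code n M₁ M₂, c.errorProb ≤ ENNReal.ofReal ε) ∧
    r = (Real.log M₁ / n, Real.log M₂ / n)}

/-- The (operational) capacity region: the non-negative rate pairs which, for every `ε > 0` and
all large `n`, are dominated by a pair in `R(n, ε)`. -/
def capacityRegion (m : MAC 𝒳 𝒴 𝒵) : Set (ℝ × ℝ) :=
  {r | 0 ≤ r ∧ ∀ ε : ℝ, 0 < ε → ∀ᶠ n : ℕ in atTop, ∃ r' ∈ m.rateRegion n ε, r ≤ r'}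

end MAC

end

/-! Information over the Gaussian channel is at most the cross entropy of the output with any trial
density (`lintegral_klDiv_gaussianMix_le`). For a normal trial law this cross entropy sees only
second moments, so dependence between the inputs enters only through their covariance.

Claim 1. The conditional informations I(X;Z|Y,U) and I(Y;Z|X,U) need no independence: a normal trial
law centred at the other input bounds them by an affine function of the power, the tangent to the
capacity at S, and affine bounds survive averaging. For I(X,Y;Z|U) the covariance must be O(δ).
Wringing compares P(A×B) with P(A)P(B) up to 20δ times the power 7/8 of either marginal probability.
Integrating over level sets gives `Wrung.abs_cov_le`: the covariance is O(δ) times one plus moments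
of order 5/2 truncated at T, plus O(1/√T). Taking T of order 1/δ² makes the last term O(δ), but
bounded second moments do not bound those truncated moments uniformly in T. Inputs with such heavy
tails give an output far from normal, which lowers the information. The trial density is therefore
multiplied by exp(d·`penalty`) with d of order δ. Its normalization costs O(δ), and the expected
penalty of the output dominates the truncated moments, so the gain cancels them
(`Wrung.lintegral_klDiv_le_of_variance_le`, `exists_wrung_lintegral_klDiv_le`). Independent normal
inputs give the matching lower bound at δ = 0.

Claim 2. The negative log density of a normal mixture grows quadratically, but its increment from s
to z is at most a quadratic in z - s plus |z - s| times the mean distance from s to the centres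
(`mixPotential_le_add`). The divergence variance is thus controlled by second moments, which the
power constraints bound (`divergenceVariance_gaussianMix_le`).

Claim 3 is proved directly and does not pass through claims 1 and 2. Both halves concern the
pentagon R₁ < ½log(1+S₁), R₂ < ½log(1+S₂), R₁+R₂ < ½log(1+S₁+S₂). Converse: if M centres lie within
squared distance nS + O(√n) of one point and are distinguished with probability bounded below, a
change of measure to a normal law of variance 1+S gives log M ≤ ½n log(1+S) + O(√n)
(`exists_log_card_le`). Freezing one message yields the single-rate bounds. For the sum rate, a
dense set of good message pairs contains a subset, smaller only by a factor exp(-O(√n)), whose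
uniform law is wrung with δ = 1/√n (`exists_wrung_subset`). Projections on random signs reduce the
mean inner product of the codewords to scalar covariances (`Wrung.inner_cov_le`), so the sums of
codewords lie on average within n(S₁+S₂) + O(√n) of their mean. Achievability: normal random
codebooks and a typicality decoder place the open pentagon in the capacity region, and a zero rate
lifts its constraints (`mem_capacityRegion`). Lowering a rate pair by O(1/√n) in each coordinate and
clipping at zero lands there. -/

noncomputable section

/-! ### Rectangle estimates for nearly independent pairs. -/

section Wringing

/-- The rectangle inequality which the wringing dependence quantifies. -/
def Wrung {𝒳 𝒴 : Type} [MeasurableSpace 𝒳] [MeasurableSpace 𝒴] (δ : ℝ)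
    (μ : Measure (𝒳 × 𝒴)) : Prop :=
  ∃ (QX : Measure 𝒳) (QY : Measure 𝒴), IsProbabilityMeasure QX ∧ IsProbabilityMeasure QY ∧
    ∀ A B, MeasurableSet A → MeasurableSet B →
      μ.real (A ×ˢ B) ^ (1 + δ) ≤ QX.real A * QY.real B

variable {𝒳 𝒴 : Type} [MeasurableSpace 𝒳] [MeasurableSpace 𝒴]

/-- The strict inequality supplies a pair of reference measures without requiring the infimum to be
attained. Raising the exponent only shrinks the left side, as it is a power of a probability. -/
lemma wrung_of_wringingDependence_lt {μ : Measure (𝒳 × 𝒴)} [IsProbabilityMeasure μ] {δ : ℝ≥0}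
    (h : wringingDependence μ < δ) : Wrung δ μ := by
  unfold wringingDependence at h
  simp only [iInf_lt_iff] at h
  obtain ⟨QX, QY, h⟩ := h
  refine ⟨QX, QY, inferInstance, inferInstance, fun A B hA hB => ?_⟩
  have h1 := lt_of_le_of_lt (le_iSup₂_of_le A hA (le_iSup₂_of_le B hB le_rfl)) h
  simp only [iInf_lt_iff] at h1
  obtain ⟨δ', h2, h3⟩ := h1
  have h3' : δ' < δ := by exact_mod_cast h3
  have hle : μ.real (A ×ˢ B) ^ (1 + (δ' : ℝ)) ≤ QX.toMeasure.real A * QY.toMeasure.real B := by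
    have := ENNReal.toReal_mono (ENNReal.mul_ne_top (measure_ne_top _ _) (measure_ne_top _ _)) h2
    rwa [← ENNReal.toReal_rpow, ENNReal.toReal_mul] at this
  refine le_trans ?_ hle
  rcases eq_or_lt_of_le (measureReal_nonneg (μ := μ) (s := A ×ˢ B)) with h0 | h0
  · rw [← h0, Real.zero_rpow (by positivity), Real.zero_rpow (by positivity)]
  · exact Real.rpow_le_rpow_of_exponent_ge h0 measureReal_le_one (by
      have : (δ' : ℝ) < δ := by exact_mod_cast h3'
      linarith)

/-- With e = 1/(1+δ), the difference x^e - x is at most x^e (1-e)(-log x), and 1-e ≤ δ. Giving up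
x^(1/16) absorbs the logarithm: e ≥ 15/16 leaves the exponent 15/16 - 1/16 = 7/8. -/
lemma rpow_inv_sub_self_le {x δ : ℝ} (hx : 0 ≤ x) (hx1 : x ≤ 1) (hδ : 0 ≤ δ) (hδ1 : δ ≤ 1 / 15) :
    (1 + δ) ^ 2 * x ^ (1 / (1 + δ)) - x ≤ 20 * δ * x ^ (7 / 8 : ℝ) := by
  rcases eq_or_lt_of_le hx with rfl | hx
  · rw [Real.zero_rpow (by positivity), Real.zero_rpow (by norm_num)]; simp
  have he : (15 / 16 : ℝ) ≤ 1 / (1 + δ) := by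
    rw [div_le_div_iff₀ (by norm_num) (by positivity)]; linarith
  have he1 : 1 - 1 / (1 + δ) ≤ δ := by
    have : 1 - 1 / (1 + δ) = δ / (1 + δ) := by field_simp; ring
    rw [this]; exact div_le_self hδ (by linarith)
  have he0 : 0 ≤ 1 - 1 / (1 + δ) := by
    have : 1 - 1 / (1 + δ) = δ / (1 + δ) := by field_simp; ring
    rw [this]; positivity
  set e := 1 / (1 + δ) with hedef
  have h1 : x ^ e ≤ x ^ (15 / 16 : ℝ) := Real.rpow_le_rpow_of_exponent_ge hx hx1 he
  have h2 : x ^ (15 / 16 : ℝ) ≤ x ^ (7 / 8 : ℝ) :=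
    Real.rpow_le_rpow_of_exponent_ge hx hx1 (by norm_num)
  have h3 : 1 + (1 - e) * Real.log x ≤ x ^ (1 - e) := by
    rw [Real.rpow_def_of_pos hx]
    have := Real.add_one_le_exp (Real.log x * (1 - e))
    linarith
  have h4 : x = x ^ e * x ^ (1 - e) := by
    rw [← Real.rpow_add hx]; simp
  have hlog : - Real.log x ≤ 16 * x ^ (-(1 / 16) : ℝ) := by
    have := Real.log_le_sub_one_of_pos (Real.rpow_pos_of_pos hx (-(1 / 16) : ℝ))
    rw [Real.log_rpow hx] at this
    linarith
  have hpe : 0 ≤ x ^ e := (Real.rpow_pos_of_pos hx e).le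
  have hlog0 : 0 ≤ - Real.log x := by
    have := Real.log_nonpos hx.le hx1; linarith
  have h5 : x ^ e - x ≤ 16 * δ * x ^ (7 / 8 : ℝ) := by
    calc x ^ e - x = x ^ e * (1 - x ^ (1 - e)) := by nth_rw 2 [h4]; ring
      _ ≤ x ^ e * ((1 - e) * (- Real.log x)) := by
          apply mul_le_mul_of_nonneg_left _ hpe; linarith
      _ ≤ x ^ (15 / 16 : ℝ) * (δ * (16 * x ^ (-(1 / 16) : ℝ))) := by
          apply mul_le_mul h1 _ (mul_nonneg he0 hlog0) (Real.rpow_pos_of_pos hx _).le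
          exact mul_le_mul he1 hlog hlog0 hδ
      _ = 16 * δ * (x ^ (15 / 16 : ℝ) * x ^ (-(1 / 16) : ℝ)) := by ring
      _ = 16 * δ * x ^ (7 / 8 : ℝ) := by rw [← Real.rpow_add hx]; norm_num
  have h6 : (2 * δ + δ ^ 2) * x ^ e ≤ 3 * δ * x ^ (7 / 8 : ℝ) := by
    apply mul_le_mul _ (h1.trans h2) hpe (by positivity)
    nlinarith
  have : 0 ≤ δ * x ^ (7 / 8 : ℝ) := mul_nonneg hδ (Real.rpow_pos_of_pos hx _).le
  nlinarith

variable {δ : ℝ} {μ : Measure (𝒳 × 𝒴)} [IsProbabilityMeasure μ] {A : Set 𝒳} {B : Set 𝒴}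

lemma Wrung.swap (h : Wrung δ μ) : Wrung δ (μ.map Prod.swap) := by
  obtain ⟨QX, QY, h1, h2, h⟩ := h
  refine ⟨QY, QX, h2, h1, fun A B hA hB => ?_⟩
  rw [map_measureReal_apply measurable_swap (hA.prod hB), Set.preimage_swap_prod, mul_comm]
  exact h B A hB hA

/-- Upper bound for the probability of a rectangle by those of its sides. -/
lemma Wrung.real_prod_le (h : Wrung δ μ) (hδ : 0 ≤ δ) (hA : MeasurableSet A)
    (hB : MeasurableSet B) :
    μ.real (A ×ˢ B) ≤
      (1 + δ) ^ 2 * (μ.real (A ×ˢ Set.univ) * μ.real (Set.univ ×ˢ B)) ^ (1 / (1 + δ)) := by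
  obtain ⟨QX, QY, h1, h2, h⟩ := h
  -- The inequality on the complement of A gives (1 - p)^(1+δ) ≤ 1 - Q_X(A), and Bernoulli's
  -- inequality bounds the left side below by 1 - (1+δ)p. So the reference measures are dominated by
  -- the marginals.
  have hp : QX.real A ≤ (1 + δ) * μ.real (A ×ˢ Set.univ) := by
    have e1 := h Aᶜ Set.univ hA.compl .univ
    have e2 : μ.real (Aᶜ ×ˢ (Set.univ : Set 𝒴)) = 1 - μ.real (A ×ˢ (Set.univ : Set 𝒴)) := by
      rw [← probReal_compl_eq_one_sub (hA.prod .univ)]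
      congr 1; ext; simp
    rw [e2, probReal_compl_eq_one_sub hA, probReal_univ, mul_one] at e1
    have := one_add_mul_self_le_rpow_one_add (s := -μ.real (A ×ˢ (Set.univ : Set 𝒴)))
      (by have := measureReal_le_one (μ := μ) (s := A ×ˢ (Set.univ : Set 𝒴)); linarith)
      (p := 1 + δ) (by linarith)
    rw [← sub_eq_add_neg] at this
    linarith
  have hq : QY.real B ≤ (1 + δ) * μ.real (Set.univ ×ˢ B) := by
    have e1 := h Set.univ Bᶜ .univ hB.compl
    have e2 : μ.real ((Set.univ : Set 𝒳) ×ˢ Bᶜ) = 1 - μ.real ((Set.univ : Set 𝒳) ×ˢ B) := by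
      rw [← probReal_compl_eq_one_sub (MeasurableSet.univ.prod hB)]
      congr 1; ext; simp
    rw [e2, probReal_compl_eq_one_sub hB, probReal_univ, one_mul] at e1
    have := one_add_mul_self_le_rpow_one_add (s := -μ.real ((Set.univ : Set 𝒳) ×ˢ B))
      (by have := measureReal_le_one (μ := μ) (s := (Set.univ : Set 𝒳) ×ˢ B); linarith)
      (p := 1 + δ) (by linarith)
    rw [← sub_eq_add_neg] at this
    linarith
  set p := μ.real (A ×ˢ (Set.univ : Set 𝒴))
  set q := μ.real ((Set.univ : Set 𝒳) ×ˢ B)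
  have hp0 : 0 ≤ p := measureReal_nonneg
  have hq0 : 0 ≤ q := measureReal_nonneg
  have hr0 : 0 ≤ μ.real (A ×ˢ B) := measureReal_nonneg
  have h3 : μ.real (A ×ˢ B) ^ (1 + δ) ≤ (1 + δ) ^ 2 * (p * q) := by
    calc _ ≤ QX.real A * QY.real B := h A B hA hB
      _ ≤ ((1 + δ) * p) * ((1 + δ) * q) := by gcongr
      _ = _ := by ring
  calc μ.real (A ×ˢ B) = (μ.real (A ×ˢ B) ^ (1 + δ)) ^ (1 / (1 + δ)) := by
        rw [← Real.rpow_mul hr0, mul_one_div_cancel (by positivity), Real.rpow_one]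
    _ ≤ ((1 + δ) ^ 2 * (p * q)) ^ (1 / (1 + δ)) := by
        apply Real.rpow_le_rpow (by positivity) h3 (by positivity)
    _ = ((1 + δ) ^ 2) ^ (1 / (1 + δ)) * (p * q) ^ (1 / (1 + δ)) := by
        rw [Real.mul_rpow (by positivity) (by positivity)]
    _ ≤ _ := by
        gcongr
        calc ((1 + δ) ^ 2) ^ (1 / (1 + δ)) ≤ ((1 + δ) ^ 2) ^ (1 : ℝ) := by
              apply Real.rpow_le_rpow_of_exponent_le (by nlinarith)
              rw [div_le_one (by positivity)]; linarith
          _ = _ := Real.rpow_one _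

/-- This form has no factor δ but decays in both probabilities. It serves far tails: after
Chebyshev's inequality the exponent 3/4 leaves t^(-3/2), which is integrable at infinity. -/
lemma Wrung.real_prod_le_rpow (h : Wrung δ μ) (hδ : 0 ≤ δ) (hδ1 : δ ≤ 1 / 15)
    (hA : MeasurableSet A) (hB : MeasurableSet B) :
    μ.real (A ×ˢ B) ≤
      4 * (μ.real (A ×ˢ Set.univ) * μ.real (Set.univ ×ˢ B)) ^ (3 / 4 : ℝ) := by
  refine (h.real_prod_le hδ hA hB).trans ?_
  set p := μ.real (A ×ˢ (Set.univ : Set 𝒴))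
  set q := μ.real ((Set.univ : Set 𝒳) ×ˢ B)
  have hp0 : 0 ≤ p := measureReal_nonneg
  have hq0 : 0 ≤ q := measureReal_nonneg
  have hpq : p * q ≤ 1 := mul_le_one₀ measureReal_le_one hq0 measureReal_le_one
  have : (p * q) ^ (1 / (1 + δ)) ≤ (p * q) ^ (3 / 4 : ℝ) := by
    apply Real.rpow_le_rpow_of_exponent_ge' (by positivity) hpq (by norm_num)
    rw [div_le_div_iff₀ (by norm_num) (by positivity)]; linarith
  apply mul_le_mul _ this (by positivity) (by norm_num)
  nlinarith

lemma Wrung.real_prod_le_mul_add (h : Wrung δ μ) (hδ : 0 ≤ δ) (hδ1 : δ ≤ 1 / 15)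
    (hA : MeasurableSet A) (hB : MeasurableSet B) :
    μ.real (A ×ˢ B) ≤ μ.real (A ×ˢ Set.univ) * μ.real (Set.univ ×ˢ B) +
      20 * δ * (μ.real (A ×ˢ Set.univ) * μ.real (Set.univ ×ˢ B)) ^ (7 / 8 : ℝ) := by
  have h1 := h.real_prod_le hδ hA hB
  have h2 := rpow_inv_sub_self_le (x := μ.real (A ×ˢ Set.univ) * μ.real (Set.univ ×ˢ B))
    (by positivity) (mul_le_one₀ measureReal_le_one measureReal_nonneg measureReal_le_one) hδ hδ1
  linarith

lemma Wrung.real_prod_le_add_right (h : Wrung δ μ) (hδ : 0 ≤ δ) (hδ1 : δ ≤ 1 / 15)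
    (hA : MeasurableSet A) (hB : MeasurableSet B) :
    μ.real (A ×ˢ B) ≤ μ.real (A ×ˢ Set.univ) * μ.real (Set.univ ×ˢ B) +
      20 * δ * μ.real (Set.univ ×ˢ B) ^ (7 / 8 : ℝ) := by
  refine (h.real_prod_le_mul_add hδ hδ1 hA hB).trans ?_
  gcongr
  exact mul_le_of_le_one_left measureReal_nonneg measureReal_le_one

/-- Applying the upper bound to Aᶜ and subtracting from the marginal of B turns it into a lower
bound. The error term must depend on B alone for this, which is why the one-sided form is used. -/
lemma Wrung.mul_le_real_prod_add_right (h : Wrung δ μ) (hδ : 0 ≤ δ) (hδ1 : δ ≤ 1 / 15)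
    (hA : MeasurableSet A) (hB : MeasurableSet B) :
    μ.real (A ×ˢ Set.univ) * μ.real (Set.univ ×ˢ B) ≤ μ.real (A ×ˢ B) +
      20 * δ * μ.real (Set.univ ×ˢ B) ^ (7 / 8 : ℝ) := by
  have h1 := h.real_prod_le_add_right hδ hδ1 hA.compl hB
  have e2 : μ.real (Aᶜ ×ˢ (Set.univ : Set 𝒴)) = 1 - μ.real (A ×ˢ (Set.univ : Set 𝒴)) := by
    rw [← probReal_compl_eq_one_sub (hA.prod .univ)]
    congr 1; ext; simp
  have e3 : μ.real (Set.univ ×ˢ B) = μ.real (A ×ˢ B) + μ.real (Aᶜ ×ˢ B) := by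
    rw [← measureReal_union _ (hA.compl.prod hB)]
    · rw [← Set.union_prod, Set.union_compl_self]
    · exact Set.disjoint_left.2 fun x hx hx' => hx'.1 hx.1
  rw [e2] at h1
  nlinarith

lemma real_swap_prod (hA : MeasurableSet A) (hB : MeasurableSet B) :
    (μ.map Prod.swap).real (B ×ˢ A) = μ.real (A ×ˢ B) := by
  rw [map_measureReal_apply measurable_swap (hB.prod hA), Set.preimage_swap_prod]

lemma Wrung.real_prod_le_add_left (h : Wrung δ μ) (hδ : 0 ≤ δ) (hδ1 : δ ≤ 1 / 15)
    (hA : MeasurableSet A) (hB : MeasurableSet B) :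
    μ.real (A ×ˢ B) ≤ μ.real (A ×ˢ Set.univ) * μ.real (Set.univ ×ˢ B) +
      20 * δ * μ.real (A ×ˢ Set.univ) ^ (7 / 8 : ℝ) := by
  have : IsProbabilityMeasure (μ.map Prod.swap) :=
    Measure.isProbabilityMeasure_map measurable_swap.aemeasurable
  have := h.swap.real_prod_le_add_right hδ hδ1 hB hA
  rw [real_swap_prod hA hB, real_swap_prod hA .univ, real_swap_prod .univ hB] at this
  linarith

lemma Wrung.mul_le_real_prod_add_left (h : Wrung δ μ) (hδ : 0 ≤ δ) (hδ1 : δ ≤ 1 / 15)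
    (hA : MeasurableSet A) (hB : MeasurableSet B) :
    μ.real (A ×ˢ Set.univ) * μ.real (Set.univ ×ˢ B) ≤ μ.real (A ×ˢ B) +
      20 * δ * μ.real (A ×ˢ Set.univ) ^ (7 / 8 : ℝ) := by
  have : IsProbabilityMeasure (μ.map Prod.swap) :=
    Measure.isProbabilityMeasure_map measurable_swap.aemeasurable
  have := h.swap.mul_le_real_prod_add_right hδ hδ1 hB hA
  rw [real_swap_prod hA hB, real_swap_prod hA .univ, real_swap_prod .univ hB] at this
  linarith

end Wringing

end

noncomputable section

/-! ### Integrals over pairs of level sets. -/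

section Levels

/-- Layer-cake formula used twice, once for f under the measure with density g and once for g on a
level set of f. -/
lemma lintegral_ofReal_mul_eq_lintegral_levels {Ω : Type*} [MeasurableSpace Ω] (μ : Measure Ω)
    {f g : Ω → ℝ} (hf : Measurable f) (hg : Measurable g) (hf0 : 0 ≤ f) (hg0 : 0 ≤ g) :
    ∫⁻ ω, ENNReal.ofReal (f ω) * ENNReal.ofReal (g ω) ∂μ =
      ∫⁻ s in Set.Ioi 0, ∫⁻ t in Set.Ioi 0, μ {ω | s < f ω ∧ t < g ω} := by
  have h1 : ∫⁻ ω, ENNReal.ofReal (f ω) * ENNReal.ofReal (g ω) ∂μ =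
      ∫⁻ ω, ENNReal.ofReal (f ω) ∂(μ.withDensity fun ω => ENNReal.ofReal (g ω)) := by
    rw [lintegral_withDensity_eq_lintegral_mul _ hg.ennreal_ofReal hf.ennreal_ofReal]
    simp only [Pi.mul_apply, mul_comm]
  rw [h1, lintegral_eq_lintegral_meas_lt _ (Eventually.of_forall hf0) hf.aemeasurable]
  refine lintegral_congr fun s => ?_
  rw [withDensity_apply _ (measurableSet_lt measurable_const hf),
    lintegral_eq_lintegral_meas_lt _ (Eventually.of_forall hg0) hg.aemeasurable]
  refine lintegral_congr fun t => ?_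
  rw [Measure.restrict_apply (measurableSet_lt measurable_const hg)]
  congr 1; ext ω; simp [and_comm]

lemma lintegral_Ioi_ofReal_rpow {a c : ℝ} (ha : a < -1) (hc : 0 < c) :
    ∫⁻ t in Set.Ioi c, ENNReal.ofReal (t ^ a) = ENNReal.ofReal (-c ^ (a + 1) / (a + 1)) := by
  rw [← ofReal_integral_eq_lintegral_ofReal (integrableOn_Ioi_rpow_of_lt ha hc),
    integral_Ioi_rpow_of_lt ha hc]
  filter_upwards [ae_restrict_mem measurableSet_Ioi] with t ht
  exact Real.rpow_nonneg (hc.le.trans (le_of_lt ht)) _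

/-- The contribution of moderate levels is controlled by a truncated moment of order `5/2`. -/
lemma lintegral_mul_rpow_le {q : ℝ → ℝ} (hq : Measurable q) (hq0 : ∀ t, 0 ≤ q t)
    (hq1 : ∀ t, q t ≤ 1) (T : ℝ) :
    ∫⁻ t in Set.Ioo 0 T, ENNReal.ofReal (t * q t ^ (7 / 8 : ℝ)) ≤
      2 + ∫⁻ t in Set.Ioo 0 T, ENNReal.ofReal (t ^ (3 / 2 : ℝ) * q t) := by
  have hpt : ∀ t ∈ Set.Ioo 0 T, ENNReal.ofReal (t * q t ^ (7 / 8 : ℝ)) ≤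
      ((Set.Ioc (0 : ℝ) 1).indicator 1 t +
        (Set.Ioi (1 : ℝ)).indicator (fun t => ENNReal.ofReal (t ^ (-(5 / 2) : ℝ))) t) +
      ENNReal.ofReal (t ^ (3 / 2 : ℝ) * q t) := by
    intro t ht
    have ht0 : 0 < t := ht.1
    rcases le_or_gt t 1 with h1 | h1
    · refine le_add_right ?_
      rw [Set.indicator_of_mem (show t ∈ Set.Ioc (0 : ℝ) 1 from ⟨ht0, h1⟩)]
      refine le_add_right ?_
      simp only [Pi.one_apply, ENNReal.ofReal_le_one]
      have : q t ^ (7 / 8 : ℝ) ≤ 1 := Real.rpow_le_one (hq0 t) (hq1 t) (by norm_num)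
      exact mul_le_one₀ h1 (Real.rpow_nonneg (hq0 t) _) this
    · rw [Set.indicator_of_mem (show t ∈ Set.Ioi (1 : ℝ) from h1), add_assoc]
      refine le_add_left ?_
      rw [← ENNReal.ofReal_add (by positivity) (mul_nonneg (by positivity) (hq0 t))]
      apply ENNReal.ofReal_le_ofReal
      -- The factorization t q^(7/8) = (t^(3/2) q)^(7/8) (t^(-5/2))^(1/8) trades the power of q for
      -- an integrable remainder; t^(-5/2) has integral 2/3 over (1,∞).
      have hy := Real.geom_mean_le_arith_mean2_weighted (w₁ := 7 / 8) (w₂ := 1 / 8)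
        (p₁ := t ^ (3 / 2 : ℝ) * q t) (p₂ := t ^ (-(5 / 2) : ℝ)) (by norm_num) (by norm_num)
        (mul_nonneg (by positivity) (hq0 t)) (by positivity) (by norm_num)
      have e : t * q t ^ (7 / 8 : ℝ) = (t ^ (3 / 2 : ℝ) * q t) ^ (7 / 8 : ℝ) *
          (t ^ (-(5 / 2) : ℝ)) ^ (1 / 8 : ℝ) := by
        rw [Real.mul_rpow (by positivity) (hq0 t), ← Real.rpow_mul ht0.le, ← Real.rpow_mul ht0.le,
          mul_right_comm, ← Real.rpow_add ht0]
        norm_num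
      rw [e]
      refine hy.trans ?_
      have h2 : 0 ≤ t ^ (3 / 2 : ℝ) * q t := mul_nonneg (by positivity) (hq0 t)
      have h3 : 0 ≤ t ^ (-(5 / 2) : ℝ) := by positivity
      linarith
  calc _ ≤ ∫⁻ t in Set.Ioo 0 T, (((Set.Ioc (0 : ℝ) 1).indicator 1 t +
        (Set.Ioi (1 : ℝ)).indicator (fun t => ENNReal.ofReal (t ^ (-(5 / 2) : ℝ))) t) +
      ENNReal.ofReal (t ^ (3 / 2 : ℝ) * q t)) := setLIntegral_mono' measurableSet_Ioo hpt
    _ = (∫⁻ t in Set.Ioo 0 T, ((Set.Ioc (0 : ℝ) 1).indicator 1 t +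
        (Set.Ioi (1 : ℝ)).indicator (fun t => ENNReal.ofReal (t ^ (-(5 / 2) : ℝ))) t)) +
        ∫⁻ t in Set.Ioo 0 T, ENNReal.ofReal (t ^ (3 / 2 : ℝ) * q t) :=
        lintegral_add_right _ (by fun_prop)
    _ ≤ _ := by
      gcongr
      calc _ ≤ ∫⁻ t, ((Set.Ioc (0 : ℝ) 1).indicator 1 t +
        (Set.Ioi (1 : ℝ)).indicator (fun t => ENNReal.ofReal (t ^ (-(5 / 2) : ℝ))) t) :=
            setLIntegral_le_lintegral _ _
        _ = 1 + ENNReal.ofReal (2 / 3) := by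
            rw [lintegral_add_left (measurable_one.indicator measurableSet_Ioc),
              lintegral_indicator_one measurableSet_Ioc, lintegral_indicator measurableSet_Ioi,
              lintegral_Ioi_ofReal_rpow (by norm_num) one_pos]
            norm_num
        _ ≤ 2 := by
            refine (add_le_add le_rfl (ENNReal.ofReal_le_one.2
              (by norm_num : (2 / 3 : ℝ) ≤ 1))).trans (le_of_eq one_add_one_eq_two)

lemma rpow_three_quarters_le {q V t : ℝ} (hq0 : 0 ≤ q) (hV : 1 ≤ V) (ht : 0 < t)
    (hqV : q ≤ V / t ^ 2) : q ^ (3 / 4 : ℝ) ≤ V * t ^ (-(3 / 2) : ℝ) := by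
  calc q ^ (3 / 4 : ℝ) ≤ (V / t ^ 2) ^ (3 / 4 : ℝ) := Real.rpow_le_rpow hq0 hqV (by norm_num)
    _ = V ^ (3 / 4 : ℝ) * t ^ (-(3 / 2) : ℝ) := by
        rw [Real.div_rpow (by linarith) (by positivity), div_eq_mul_inv, ← Real.rpow_natCast t 2,
          ← Real.rpow_mul ht.le, ← Real.rpow_neg ht.le]
        norm_num
    _ ≤ _ := by
        gcongr
        calc V ^ (3 / 4 : ℝ) ≤ V ^ (1 : ℝ) := Real.rpow_le_rpow_of_exponent_le hV (by norm_num)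
          _ = V := Real.rpow_one V

lemma lintegral_Ioi_rpow_three_quarters_le {q : ℝ → ℝ} {V T : ℝ}
    (hq0 : ∀ t, 0 ≤ q t) (hV : 1 ≤ V) (hT : 0 < T) (hqV : ∀ t, 0 < t → q t ≤ V / t ^ 2) :
    ∫⁻ t in Set.Ioi T, ENNReal.ofReal (q t ^ (3 / 4 : ℝ)) ≤ ENNReal.ofReal (2 * V / √T) := by
  calc _ ≤ ∫⁻ t in Set.Ioi T, ENNReal.ofReal V * ENNReal.ofReal (t ^ (-(3 / 2) : ℝ)) := by
        refine setLIntegral_mono' measurableSet_Ioi fun t ht => ?_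
        have ht0 : 0 < t := hT.trans ht
        rw [← ENNReal.ofReal_mul (by linarith)]
        exact ENNReal.ofReal_le_ofReal (rpow_three_quarters_le (hq0 t) hV ht0 (hqV t ht0))
    _ = ENNReal.ofReal (2 * V / √T) := by
        rw [lintegral_const_mul' _ _ ENNReal.ofReal_ne_top,
          lintegral_Ioi_ofReal_rpow (by norm_num) hT,
          ← ENNReal.ofReal_mul (by linarith)]
        congr 1
        rw [show (-(3 / 2) + 1 : ℝ) = -(1 / 2) by norm_num, Real.rpow_neg hT.le,
          ← Real.sqrt_eq_rpow]
        field_simp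

lemma lintegral_Ioi_zero_rpow_three_quarters_le {q : ℝ → ℝ} {V : ℝ}
    (hq0 : ∀ t, 0 ≤ q t) (hq1 : ∀ t, q t ≤ 1) (hV : 1 ≤ V)
    (hqV : ∀ t, 0 < t → q t ≤ V / t ^ 2) :
    ∫⁻ t in Set.Ioi 0, ENNReal.ofReal (q t ^ (3 / 4 : ℝ)) ≤ ENNReal.ofReal (3 * V) := by
  rw [← Set.Ioc_union_Ioi_eq_Ioi (zero_le_one' ℝ)]
  refine (lintegral_union_le _ _ _).trans ?_
  have h1 : ∫⁻ t in Set.Ioc (0 : ℝ) 1, ENNReal.ofReal (q t ^ (3 / 4 : ℝ)) ≤ 1 := by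
    calc _ ≤ ∫⁻ t in Set.Ioc (0 : ℝ) 1, 1 := by
          refine lintegral_mono fun t => ?_
          exact ENNReal.ofReal_le_one.2 (Real.rpow_le_one (hq0 t) (hq1 t) (by norm_num))
      _ = 1 := by simp
  have h2 := lintegral_Ioi_rpow_three_quarters_le hq0 hV one_pos hqV
  refine (add_le_add h1 h2).trans ?_
  rw [← ENNReal.ofReal_one, ← ENNReal.ofReal_add (by norm_num) (by positivity)]
  apply ENNReal.ofReal_le_ofReal
  simp; linarith

/-- Integrating a difference of level functions which is small in three ways. -/
lemma lintegral_levels_le {p q : ℝ → ℝ} (hp : Measurable p) (hq : Measurable q)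
    (hp0 : ∀ t, 0 ≤ p t) (hp1 : ∀ t, p t ≤ 1) (hq0 : ∀ t, 0 ≤ q t) (hq1 : ∀ t, q t ≤ 1)
    {V T c : ℝ} (hV : 1 ≤ V) (hT : 0 < T) (hc : 0 ≤ c) (hpV : ∀ t, 0 < t → p t ≤ V / t ^ 2)
    (hqV : ∀ t, 0 < t → q t ≤ V / t ^ 2) {R S : ℝ → ℝ → ℝ≥0∞}
    (h1 : ∀ s t, R s t ≤ S s t + ENNReal.ofReal (c * p s ^ (7 / 8 : ℝ)))
    (h2 : ∀ s t, R s t ≤ S s t + ENNReal.ofReal (c * q t ^ (7 / 8 : ℝ)))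
    (h3 : ∀ s t, R s t ≤ S s t + ENNReal.ofReal (4 * (p s * q t) ^ (3 / 4 : ℝ))) :
    ∫⁻ s in Set.Ioi 0, ∫⁻ t in Set.Ioi 0, R s t ≤
      (∫⁻ s in Set.Ioi 0, ∫⁻ t in Set.Ioi 0, S s t) +
      (ENNReal.ofReal c * ((2 + ∫⁻ t in Set.Ioo 0 T, ENNReal.ofReal (t ^ (3 / 2 : ℝ) * p t)) +
        (2 + ∫⁻ t in Set.Ioo 0 T, ENNReal.ofReal (t ^ (3 / 2 : ℝ) * q t))) +
        ENNReal.ofReal (48 * V ^ 2 / √T)) := by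
  -- Below T the error is charged to the larger of the two levels. Integrating out the smaller one
  -- gives a factor s, hence the integrand s p(s)^(7/8) of `lintegral_mul_rpow_le`.
  set D1 : ℝ → ℝ → ℝ≥0∞ := fun s t => (Set.Iio T).indicator (fun s => ENNReal.ofReal c *
    ENNReal.ofReal (p s ^ (7 / 8 : ℝ))) s * (if t ≤ s then 1 else 0) with hD1
  set D2 : ℝ → ℝ → ℝ≥0∞ := fun s t => (Set.Iio T).indicator (fun t => ENNReal.ofReal c *
    ENNReal.ofReal (q t ^ (7 / 8 : ℝ))) t * (if s ≤ t then 1 else 0) with hD2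
  set P : ℝ → ℝ≥0∞ := fun s => ENNReal.ofReal (p s ^ (3 / 4 : ℝ)) with hP
  set Q : ℝ → ℝ≥0∞ := fun s => ENNReal.ofReal (q s ^ (3 / 4 : ℝ)) with hQ
  -- When one level is at least T, the product bound is used: a tail 2V/√T times a full integral 3V,
  -- with factor 4, once for each variable. This is the source of 48 V²/√T.
  set P' : ℝ → ℝ≥0∞ := (Set.Ici T).indicator P with hP'
  set Q' : ℝ → ℝ≥0∞ := (Set.Ici T).indicator Q with hQ'
  have mP : Measurable P := by fun_prop
  have mQ : Measurable Q := by fun_prop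
  have mP' : Measurable P' := mP.indicator measurableSet_Ici
  have mQ' : Measurable Q' := mQ.indicator measurableSet_Ici
  have mi : Measurable (fun z : ℝ × ℝ => if z.2 ≤ z.1 then (1 : ℝ≥0∞) else 0) :=
    Measurable.ite (measurableSet_le measurable_snd measurable_fst) measurable_const measurable_const
  have mi' : Measurable (fun z : ℝ × ℝ => if z.1 ≤ z.2 then (1 : ℝ≥0∞) else 0) :=
    Measurable.ite (measurableSet_le measurable_fst measurable_snd) measurable_const measurable_const
  have mD1 : Measurable (Function.uncurry D1) := by
    refine Measurable.mul ?_ mi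
    exact (Measurable.indicator (by fun_prop) measurableSet_Iio).comp measurable_fst
  have mD2 : Measurable (Function.uncurry D2) := by
    refine Measurable.mul ?_ mi'
    exact (Measurable.indicator (by fun_prop) measurableSet_Iio).comp measurable_snd
  have key : ∀ s ∈ Set.Ioi (0 : ℝ), ∀ t ∈ Set.Ioi (0 : ℝ), R s t ≤
      S s t + ((D1 s t + D2 s t) + (4 * P' s * Q t + 4 * P s * Q' t)) := by
    intro s hs t ht
    have e4 : ENNReal.ofReal (4 * (p s * q t) ^ (3 / 4 : ℝ)) = 4 * P s * Q t := by
      rw [Real.mul_rpow (hp0 s) (hq0 t), ENNReal.ofReal_mul (by norm_num),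
        ENNReal.ofReal_mul (Real.rpow_nonneg (hp0 s) _), mul_assoc]
      norm_num [hP, hQ]
    rcases le_or_gt T s with hsT | hsT
    · refine (h3 s t).trans (add_le_add_right ?_ _)
      refine le_add_left (le_add_right ?_)
      rw [e4, hP', Set.indicator_of_mem (show s ∈ Set.Ici T from hsT)]
    rcases le_or_gt T t with htT | htT
    · refine (h3 s t).trans (add_le_add_right ?_ _)
      refine le_add_left (le_add_left ?_)
      rw [e4, hQ', Set.indicator_of_mem (show t ∈ Set.Ici T from htT)]
    rcases le_total t s with hts | hts
    · refine (h1 s t).trans (add_le_add_right ?_ _)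
      refine le_add_right (le_add_right ?_)
      simp only [hD1]
      rw [Set.indicator_of_mem (show s ∈ Set.Iio T from hsT), if_pos hts, mul_one,
        ENNReal.ofReal_mul hc]
    · refine (h2 s t).trans (add_le_add_right ?_ _)
      refine le_add_right (le_add_left ?_)
      simp only [hD2]
      rw [Set.indicator_of_mem (show t ∈ Set.Iio T from htT), if_pos hts, mul_one,
        ENNReal.ofReal_mul hc]
  have mDD : Measurable (Function.uncurry fun s t =>
      (D1 s t + D2 s t) + (4 * P' s * Q t + 4 * P s * Q' t)) := by
    refine (mD1.add mD2).add (Measurable.add ?_ ?_)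
    · exact ((mP'.comp measurable_fst).const_mul 4).mul (mQ.comp measurable_snd)
    · exact ((mP.comp measurable_fst).const_mul 4).mul (mQ'.comp measurable_snd)
  have tri : ∀ s ∈ Set.Ioi (0 : ℝ), ∫⁻ t in Set.Ioi (0 : ℝ), (if t ≤ s then (1 : ℝ≥0∞) else 0) =
      ENNReal.ofReal s := by
    intro s hs
    have : (fun t : ℝ => if t ≤ s then (1 : ℝ≥0∞) else 0) = (Set.Iic s).indicator 1 := by
      ext t; simp [Set.indicator_apply]
    rw [this, lintegral_indicator_one measurableSet_Iic,
      Measure.restrict_apply measurableSet_Iic, Set.inter_comm, Set.Ioi_inter_Iic]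
    simp
  have gen : ∀ w : ℝ → ℝ, (∀ t, 0 ≤ w t) →
      ∫⁻ s in Set.Ioi (0 : ℝ), (Set.Iio T).indicator (fun s => ENNReal.ofReal c *
        ENNReal.ofReal (w s ^ (7 / 8 : ℝ))) s * ENNReal.ofReal s =
      ENNReal.ofReal c * ∫⁻ t in Set.Ioo 0 T, ENNReal.ofReal (t * w t ^ (7 / 8 : ℝ)) := by
    intro w hw
    rw [← lintegral_const_mul' _ _ ENNReal.ofReal_ne_top, ← Set.Ioi_inter_Iio, Set.inter_comm,
      ← setLIntegral_indicator measurableSet_Iio]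
    refine setLIntegral_congr_fun measurableSet_Ioi fun s hs => ?_
    by_cases hsT : s ∈ Set.Iio T
    · rw [Set.indicator_of_mem hsT, Set.indicator_of_mem hsT,
        ENNReal.ofReal_mul (le_of_lt hs)]
      ring
    · rw [Set.indicator_of_notMem hsT, Set.indicator_of_notMem hsT, zero_mul]
  have iD1 : ∫⁻ s in Set.Ioi 0, ∫⁻ t in Set.Ioi 0, D1 s t ≤ ENNReal.ofReal c *
      (2 + ∫⁻ t in Set.Ioo 0 T, ENNReal.ofReal (t ^ (3 / 2 : ℝ) * p t)) := by
    refine le_trans (le_of_eq ?_) (mul_le_mul_right (lintegral_mul_rpow_le hp hp0 hp1 T) _)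
    rw [← gen p hp0]
    refine setLIntegral_congr_fun measurableSet_Ioi fun s hs => ?_
    simp only [hD1]
    rw [lintegral_const_mul _ (Measurable.ite measurableSet_Iic measurable_const measurable_const)]
    rw [tri s hs]
  have iD2 : ∫⁻ s in Set.Ioi 0, ∫⁻ t in Set.Ioi 0, D2 s t ≤ ENNReal.ofReal c *
      (2 + ∫⁻ t in Set.Ioo 0 T, ENNReal.ofReal (t ^ (3 / 2 : ℝ) * q t)) := by
    refine le_trans (le_of_eq ?_) (mul_le_mul_right (lintegral_mul_rpow_le hq hq0 hq1 T) _)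
    rw [← gen q hq0, lintegral_lintegral_swap mD2.aemeasurable]
    refine setLIntegral_congr_fun measurableSet_Ioi fun s hs => ?_
    simp only [hD2]
    rw [lintegral_const_mul _ (Measurable.ite measurableSet_Iic measurable_const measurable_const)]
    rw [tri s hs]
  have tail : ∀ w : ℝ → ℝ, (∀ t, 0 ≤ w t) → (∀ t, 0 < t → w t ≤ V / t ^ 2) →
      ∫⁻ s in Set.Ioi 0, (Set.Ici T).indicator (fun s => ENNReal.ofReal (w s ^ (3 / 4 : ℝ))) s ≤
        ENNReal.ofReal (2 * V / √T) := by
    intro w hw hwV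
    rw [setLIntegral_indicator measurableSet_Ici, Set.inter_eq_left.2 (show Set.Ici T ⊆ Set.Ioi 0 from fun x hx => hT.trans_le hx),
      setLIntegral_congr Ioi_ae_eq_Ici.symm]
    exact lintegral_Ioi_rpow_three_quarters_le hw hV hT hwV
  have pr : ∀ u v : ℝ → ℝ≥0∞, Measurable u → Measurable v →
      ∫⁻ s in Set.Ioi (0 : ℝ), ∫⁻ t in Set.Ioi (0 : ℝ), 4 * u s * v t =
      4 * (∫⁻ s in Set.Ioi (0 : ℝ), u s) * ∫⁻ t in Set.Ioi (0 : ℝ), v t := by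
    intro u v hu hv
    simp_rw [lintegral_const_mul _ hv]
    rw [lintegral_mul_const _ (hu.const_mul 4), lintegral_const_mul _ hu]
  have i3 : ∫⁻ s in Set.Ioi 0, ∫⁻ t in Set.Ioi 0, (4 * P' s * Q t + 4 * P s * Q' t) ≤
      ENNReal.ofReal (48 * V ^ 2 / √T) := by
    have a : ∀ s, ∫⁻ t in Set.Ioi (0 : ℝ), (4 * P' s * Q t + 4 * P s * Q' t) =
        (∫⁻ t in Set.Ioi (0 : ℝ), 4 * P' s * Q t) + ∫⁻ t in Set.Ioi (0 : ℝ), 4 * P s * Q' t :=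
      fun s => lintegral_add_left (mQ.const_mul _) _
    simp_rw [a]
    rw [lintegral_add_left (by simp_rw [lintegral_const_mul _ mQ]; exact (mP'.const_mul 4).mul_const _),
      pr _ _ mP' mQ, pr _ _ mP mQ']
    have b1 := tail p hp0 hpV
    have b2 := tail q hq0 hqV
    have b3 := lintegral_Ioi_zero_rpow_three_quarters_le hp0 hp1 hV hpV
    have b4 := lintegral_Ioi_zero_rpow_three_quarters_le hq0 hq1 hV hqV
    calc _ ≤ 4 * ENNReal.ofReal (2 * V / √T) * ENNReal.ofReal (3 * V) +
          4 * ENNReal.ofReal (3 * V) * ENNReal.ofReal (2 * V / √T) := by gcongr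
      _ = _ := by
        rw [show (4 : ℝ≥0∞) = ENNReal.ofReal 4 by norm_num, ← ENNReal.ofReal_mul (by norm_num),
          ← ENNReal.ofReal_mul (by positivity), ← ENNReal.ofReal_mul (by norm_num),
          ← ENNReal.ofReal_mul (by positivity), ← ENNReal.ofReal_add (by positivity) (by positivity)]
        congr 1; ring
  calc ∫⁻ s in Set.Ioi 0, ∫⁻ t in Set.Ioi 0, R s t
      ≤ ∫⁻ s in Set.Ioi 0, ∫⁻ t in Set.Ioi 0,
        (S s t + ((D1 s t + D2 s t) + (4 * P' s * Q t + 4 * P s * Q' t))) :=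
        setLIntegral_mono' measurableSet_Ioi fun s hs =>
          setLIntegral_mono' measurableSet_Ioi fun t ht => key s hs t ht
    _ = ∫⁻ s in Set.Ioi 0, ((∫⁻ t in Set.Ioi 0, S s t) +
          ∫⁻ t in Set.Ioi 0, ((D1 s t + D2 s t) + (4 * P' s * Q t + 4 * P s * Q' t))) := by
        refine lintegral_congr fun s => lintegral_add_right _ ?_
        exact mDD.comp measurable_prodMk_left
    _ = (∫⁻ s in Set.Ioi 0, ∫⁻ t in Set.Ioi 0, S s t) +
          ∫⁻ s in Set.Ioi 0, ∫⁻ t in Set.Ioi 0,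
            ((D1 s t + D2 s t) + (4 * P' s * Q t + 4 * P s * Q' t)) :=
        lintegral_add_right _ mDD.lintegral_prod_right
    _ ≤ _ := by
        refine add_le_add_right ?_ _
        have c1 : ∀ s, ∫⁻ t in Set.Ioi 0, ((D1 s t + D2 s t) + (4 * P' s * Q t + 4 * P s * Q' t)) =
          ((∫⁻ t in Set.Ioi 0, D1 s t) + ∫⁻ t in Set.Ioi 0, D2 s t) +
            ∫⁻ t in Set.Ioi 0, (4 * P' s * Q t + 4 * P s * Q' t) := by
          intro s
          have k1 : Measurable (D1 s) := mD1.comp (measurable_prodMk_left (x := s))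
          have k2 : Measurable (D2 s) := mD2.comp (measurable_prodMk_left (x := s))
          rw [lintegral_add_left (f := fun t => D1 s t + D2 s t) (k1.add k2),
            lintegral_add_left k1]
        simp_rw [c1]
        have n1 := mD1.lintegral_prod_right (ν := volume.restrict (Set.Ioi (0 : ℝ)))
        have n2 := mD2.lintegral_prod_right (ν := volume.restrict (Set.Ioi (0 : ℝ)))
        rw [lintegral_add_left (f := fun s => (∫⁻ t in Set.Ioi 0, D1 s t) +
          ∫⁻ t in Set.Ioi 0, D2 s t) (n1.add n2), lintegral_add_left n1, mul_add]
        exact add_le_add (add_le_add iD1 iD2) i3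

end Levels

end

noncomputable section

/-! ### Covariance bounds for square-integrable functions. -/

section Covariance

variable {𝒳 𝒴 : Type} [MeasurableSpace 𝒳] [MeasurableSpace 𝒴]

lemma real_lt_le_div_sq {Ω : Type*} [MeasurableSpace Ω] (μ : Measure Ω) [IsFiniteMeasure μ]
    {f : Ω → ℝ} (hf : Measurable f) {V s : ℝ} (hV : 0 ≤ V) (hs : 0 < s)
    (h : ∫⁻ ω, ENNReal.ofReal (f ω ^ 2) ∂μ ≤ ENNReal.ofReal V) :
    μ.real {ω | s < f ω} ≤ V / s ^ 2 := by
  have h1 := mul_meas_ge_le_lintegral (μ := μ) (f := fun ω => ENNReal.ofReal (f ω ^ 2))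
    (by fun_prop) (ENNReal.ofReal (s ^ 2))
  have h2 : μ {ω | s < f ω} ≤ μ {ω | ENNReal.ofReal (s ^ 2) ≤ ENNReal.ofReal (f ω ^ 2)} := by
    refine measure_mono fun ω hω => ?_
    exact ENNReal.ofReal_le_ofReal (by have : s < f ω := hω; gcongr)
  have h3 : ENNReal.ofReal (s ^ 2) * μ {ω | s < f ω} ≤ ENNReal.ofReal V :=
    (mul_le_mul_right h2 _).trans (h1.trans h)
  have h4 := ENNReal.toReal_mono ENNReal.ofReal_ne_top h3
  rw [ENNReal.toReal_mul, ENNReal.toReal_ofReal (by positivity), ENNReal.toReal_ofReal hV] at h4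
  rw [le_div_iff₀ (by positivity), mul_comm]
  exact h4

/-- Layer-cake formula for the power 5/2 of min(f, T), whose level sets below T are those of f. The
factor 5/2 of that formula is discarded. -/
lemma setLIntegral_rpow_mul_meas_le {Ω : Type*} [MeasurableSpace Ω] (μ : Measure Ω)
    [IsFiniteMeasure μ] {f : Ω → ℝ} (hf : Measurable f) (hf0 : 0 ≤ f) {T : ℝ} (hT : 0 < T) :
    ∫⁻ t in Set.Ioo 0 T, ENNReal.ofReal (t ^ (3 / 2 : ℝ) * μ.real {ω | t < f ω}) ≤
      ∫⁻ ω, ENNReal.ofReal (min (f ω) T ^ (5 / 2 : ℝ)) ∂μ := by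
  rw [lintegral_rpow_eq_lintegral_meas_lt_mul μ
    (Eventually.of_forall fun ω => le_min (hf0 ω) hT.le) (hf.min measurable_const).aemeasurable
    (by norm_num)]
  calc _ ≤ ∫⁻ t in Set.Ioi 0, μ {ω | t < min (f ω) T} * ENNReal.ofReal (t ^ (5 / 2 - 1 : ℝ)) := by
        rw [← Set.Ioi_inter_Iio, Set.inter_comm, ← setLIntegral_indicator measurableSet_Iio]
        refine setLIntegral_mono' measurableSet_Ioi fun t ht => ?_
        by_cases ht' : t ∈ Set.Iio T
        swap
        · rw [Set.indicator_of_notMem ht']; exact zero_le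
        rw [Set.indicator_of_mem ht']
        have hset : {ω | t < min (f ω) T} = {ω | t < f ω} := by
          ext ω; simp only [Set.mem_ofPred_eq, lt_min_iff]
          exact ⟨fun h => h.1, fun h => ⟨h, ht'⟩⟩
        rw [hset, ENNReal.ofReal_mul' measureReal_nonneg, ofReal_measureReal, mul_comm]
        norm_num
    _ ≤ _ := by
        refine le_mul_of_one_le_left' ?_
        exact ENNReal.one_le_ofReal.2 (by norm_num)

/-- For nonnegative functions of the two coordinates, the mixed moment under a wrung law is
close to the product of the moments. -/
theorem Wrung.lintegral_mul_near {δ : ℝ} {μ : Measure (𝒳 × 𝒴)} [IsProbabilityMeasure μ]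
    (h : Wrung δ μ) (hδ : 0 ≤ δ) (hδ1 : δ ≤ 1 / 15) {f : 𝒳 → ℝ} {g : 𝒴 → ℝ}
    (hf : Measurable f) (hg : Measurable g) (hf0 : 0 ≤ f) (hg0 : 0 ≤ g) {V T : ℝ} (hV : 1 ≤ V)
    (hT : 0 < T) (hfV : ∫⁻ z, ENNReal.ofReal (f z.1 ^ 2) ∂μ ≤ ENNReal.ofReal V)
    (hgV : ∫⁻ z, ENNReal.ofReal (g z.2 ^ 2) ∂μ ≤ ENNReal.ofReal V) :
    let b := ENNReal.ofReal (20 * δ) *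
      ((2 + ∫⁻ z, ENNReal.ofReal (min (f z.1) T ^ (5 / 2 : ℝ)) ∂μ) +
        (2 + ∫⁻ z, ENNReal.ofReal (min (g z.2) T ^ (5 / 2 : ℝ)) ∂μ)) +
        ENNReal.ofReal (48 * V ^ 2 / √T)
    ∫⁻ z, ENNReal.ofReal (f z.1) * ENNReal.ofReal (g z.2) ∂μ ≤
      (∫⁻ z, ENNReal.ofReal (f z.1) ∂μ) * (∫⁻ z, ENNReal.ofReal (g z.2) ∂μ) + b ∧
    (∫⁻ z, ENNReal.ofReal (f z.1) ∂μ) * (∫⁻ z, ENNReal.ofReal (g z.2) ∂μ) ≤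
      ∫⁻ z, ENNReal.ofReal (f z.1) * ENNReal.ofReal (g z.2) ∂μ + b := by
  intro b
  have hf' : Measurable fun z : 𝒳 × 𝒴 => f z.1 := hf.comp measurable_fst
  have hg' : Measurable fun z : 𝒳 × 𝒴 => g z.2 := hg.comp measurable_snd
  set p : ℝ → ℝ := fun s => μ.real {z | s < f z.1} with hp
  set q : ℝ → ℝ := fun t => μ.real {z | t < g z.2} with hq
  have ap : Antitone p := fun s t hst =>
    measureReal_mono (fun z hz => lt_of_le_of_lt hst hz)
  have aq : Antitone q := fun s t hst =>
    measureReal_mono (fun z hz => lt_of_le_of_lt hst hz)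
  set r : ℝ → ℝ → ℝ≥0∞ := fun s t => μ {z | s < f z.1 ∧ t < g z.2} with hr
  have er : ∀ s t, r s t = ENNReal.ofReal (μ.real ({x | s < f x} ×ˢ {y | t < g y})) := by
    intro s t
    rw [ofReal_measureReal]; rfl
  have ep : ∀ s, p s = μ.real ({x | s < f x} ×ˢ Set.univ) := by
    intro s; simp only [hp]; congr 1; ext; simp
  have eq : ∀ t, q t = μ.real (Set.univ ×ˢ {y | t < g y}) := by
    intro t; simp only [hq]; congr 1; ext; simp
  have mA : ∀ s, MeasurableSet {x | s < f x} := fun s => measurableSet_lt measurable_const hf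
  have mB : ∀ s, MeasurableSet {x | s < g x} := fun s => measurableSet_lt measurable_const hg
  have p0 : ∀ t, 0 ≤ p t := fun t => measureReal_nonneg
  have q0 : ∀ t, 0 ≤ q t := fun t => measureReal_nonneg
  set S : ℝ → ℝ → ℝ≥0∞ := fun s t => ENNReal.ofReal (p s) * ENNReal.ofReal (q t) with hS
  have eS : ∀ s t, S s t = ENNReal.ofReal (p s * q t) := fun s t =>
    (ENNReal.ofReal_mul (p0 s)).symm
  have e1 : ∫⁻ z, ENNReal.ofReal (f z.1) * ENNReal.ofReal (g z.2) ∂μ =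
      ∫⁻ s in Set.Ioi 0, ∫⁻ t in Set.Ioi 0, r s t :=
    lintegral_ofReal_mul_eq_lintegral_levels μ hf' hg' (fun z => hf0 z.1) (fun z => hg0 z.2)
  have e2 : (∫⁻ z, ENNReal.ofReal (f z.1) ∂μ) * (∫⁻ z, ENNReal.ofReal (g z.2) ∂μ) =
      ∫⁻ s in Set.Ioi 0, ∫⁻ t in Set.Ioi 0, S s t := by
    simp only [hS]
    simp_rw [lintegral_const_mul _ aq.measurable.ennreal_ofReal]
    rw [lintegral_mul_const _ ap.measurable.ennreal_ofReal,
      lintegral_eq_lintegral_meas_lt μ (Eventually.of_forall fun z => hf0 z.1) hf'.aemeasurable,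
      lintegral_eq_lintegral_meas_lt μ (Eventually.of_forall fun z => hg0 z.2) hg'.aemeasurable]
    simp [hp, hq]
  have hb : ENNReal.ofReal (20 * δ) *
      ((2 + ∫⁻ t in Set.Ioo 0 T, ENNReal.ofReal (t ^ (3 / 2 : ℝ) * p t)) +
        (2 + ∫⁻ t in Set.Ioo 0 T, ENNReal.ofReal (t ^ (3 / 2 : ℝ) * q t))) +
        ENNReal.ofReal (48 * V ^ 2 / √T) ≤ b := by
    have k1 := setLIntegral_rpow_mul_meas_le μ hf' (fun z => hf0 z.1) hT
    have k2 := setLIntegral_rpow_mul_meas_le μ hg' (fun z => hg0 z.2) hT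
    exact add_le_add (mul_le_mul_right (add_le_add (add_le_add le_rfl k1)
      (add_le_add le_rfl k2)) _) le_rfl
  have step : ∀ {a c d e : ℝ}, 0 ≤ c → 0 ≤ d → e = c + d → a ≤ e →
      ENNReal.ofReal a ≤ ENNReal.ofReal c + ENNReal.ofReal d := by
    intro a c d e hc hd he hae
    rw [← ENNReal.ofReal_add hc hd]; exact ENNReal.ofReal_le_ofReal (hae.trans he.le)
  have V0 : (0 : ℝ) ≤ V := by linarith
  rw [e1, e2]
  constructor
  · refine (lintegral_levels_le ap.measurable aq.measurable p0 (fun t => measureReal_le_one) q0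
      (fun t => measureReal_le_one) hV hT (c := 20 * δ) (by positivity)
      (fun t ht => real_lt_le_div_sq μ hf' V0 ht hfV)
      (fun t ht => real_lt_le_div_sq μ hg' V0 ht hgV) (S := S) ?_ ?_ ?_).trans
      (add_le_add le_rfl hb)
    · intro s t
      rw [er, eS]
      refine step (mul_nonneg (p0 s) (q0 t)) (by have := p0 s; positivity) rfl ?_
      rw [ep, eq]
      exact h.real_prod_le_add_left hδ hδ1 (mA s) (mB t)
    · intro s t
      rw [er, eS]
      refine step (mul_nonneg (p0 s) (q0 t)) (by have := q0 t; positivity) rfl ?_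
      rw [ep, eq]
      exact h.real_prod_le_add_right hδ hδ1 (mA s) (mB t)
    · intro s t
      rw [er, eS]
      have hpq := mul_nonneg (p0 s) (q0 t)
      refine step hpq (by positivity) rfl ?_
      have := h.real_prod_le_rpow hδ hδ1 (mA s) (mB t)
      rw [← ep, ← eq] at this
      linarith
  · refine (lintegral_levels_le ap.measurable aq.measurable p0 (fun t => measureReal_le_one) q0
      (fun t => measureReal_le_one) hV hT (c := 20 * δ) (by positivity)
      (fun t ht => real_lt_le_div_sq μ hf' V0 ht hfV)
      (fun t ht => real_lt_le_div_sq μ hg' V0 ht hgV) (S := r) ?_ ?_ ?_).trans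
      (add_le_add le_rfl hb)
    · intro s t
      rw [er, eS]
      refine step measureReal_nonneg (by have := p0 s; positivity) rfl ?_
      rw [ep, eq]
      exact h.mul_le_real_prod_add_left hδ hδ1 (mA s) (mB t)
    · intro s t
      rw [er, eS]
      refine step measureReal_nonneg (by have := q0 t; positivity) rfl ?_
      rw [ep, eq]
      exact h.mul_le_real_prod_add_right hδ hδ1 (mA s) (mB t)
    · intro s t
      rw [er, eS]
      have hpq := mul_nonneg (p0 s) (q0 t)
      refine step measureReal_nonneg (by positivity) rfl ?_
      -- For the lower estimate the far-tail bound needs no wringing: the product pq is at most one,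
      -- hence at most its power 3/4.
      have h1 : p s * q t ≤ (p s * q t) ^ (3 / 4 : ℝ) := by
        have := Real.rpow_le_rpow_of_exponent_ge' hpq
          (mul_le_one₀ measureReal_le_one (q0 t) measureReal_le_one)
          (by norm_num : (0 : ℝ) ≤ 3 / 4) (by norm_num : (3 / 4 : ℝ) ≤ 1)
        rwa [Real.rpow_one] at this
      have h2 : 0 ≤ μ.real ({x | s < f x} ×ˢ {y | t < g y}) := measureReal_nonneg
      have h3 : 0 ≤ (p s * q t) ^ (3 / 4 : ℝ) := by positivity
      linarith

/-- Covariance bound for nonnegative square-integrable functions. -/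
lemma Wrung.abs_cov_le_of_nonneg {δ : ℝ} {μ : Measure (𝒳 × 𝒴)} [IsProbabilityMeasure μ]
    (h : Wrung δ μ) (hδ : 0 ≤ δ) (hδ1 : δ ≤ 1 / 15) {f : 𝒳 → ℝ} {g : 𝒴 → ℝ}
    (hf : Measurable f) (hg : Measurable g) (hf0 : 0 ≤ f) (hg0 : 0 ≤ g) {V T : ℝ} (hV : 1 ≤ V)
    (hT : 0 < T) (hf2 : Integrable (fun z => f z.1 ^ 2) μ) (hg2 : Integrable (fun z => g z.2 ^ 2) μ)
    (hfV : ∫ z, f z.1 ^ 2 ∂μ ≤ V) (hgV : ∫ z, g z.2 ^ 2 ∂μ ≤ V) :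
    |∫ z, f z.1 * g z.2 ∂μ - (∫ z, f z.1 ∂μ) * ∫ z, g z.2 ∂μ| ≤
      20 * δ * (4 + ∫ z, min (f z.1) T ^ (5 / 2 : ℝ) ∂μ + ∫ z, min (g z.2) T ^ (5 / 2 : ℝ) ∂μ) +
        48 * V ^ 2 / √T := by
  have hf' : Measurable fun z : 𝒳 × 𝒴 => f z.1 := hf.comp measurable_fst
  have hg' : Measurable fun z : 𝒳 × 𝒴 => g z.2 := hg.comp measurable_snd
  have of2 : ∀ {u : 𝒳 × 𝒴 → ℝ}, Measurable u → Integrable (fun z => u z ^ 2) μ →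
      Integrable u μ := fun hu h2 =>
    ((memLp_two_iff_integrable_sq hu.aestronglyMeasurable).2 h2).integrable (by norm_num)
  have if1 := of2 hf' hf2
  have ig1 := of2 hg' hg2
  have ifg : Integrable (fun z => f z.1 * g z.2) μ :=
    ((memLp_two_iff_integrable_sq hf'.aestronglyMeasurable).2 hf2).integrable_mul
      ((memLp_two_iff_integrable_sq hg'.aestronglyMeasurable).2 hg2)
  have imin : ∀ {u : 𝒳 × 𝒴 → ℝ}, Measurable u → (0 ≤ u) →
      Integrable (fun z => min (u z) T ^ (5 / 2 : ℝ)) μ := by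
    intro u hu hu0
    refine Integrable.of_bound (C := T ^ (5 / 2 : ℝ))
      (Measurable.aestronglyMeasurable (by fun_prop)) (Eventually.of_forall fun z => ?_)
    have : 0 ≤ min (u z) T := le_min (hu0 z) hT.le
    rw [Real.norm_of_nonneg (by positivity)]
    exact Real.rpow_le_rpow this (min_le_right _ _) (by norm_num)
  have jf := imin hf' (fun z => hf0 z.1)
  have jg := imin hg' (fun z => hg0 z.2)
  have nf : 0 ≤ᵐ[μ] fun z => min (f z.1) T ^ (5 / 2 : ℝ) :=
    Eventually.of_forall fun z => Real.rpow_nonneg (le_min (hf0 z.1) hT.le) _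
  have ng : 0 ≤ᵐ[μ] fun z => min (g z.2) T ^ (5 / 2 : ℝ) :=
    Eventually.of_forall fun z => Real.rpow_nonneg (le_min (hg0 z.2) hT.le) _
  have key := h.lintegral_mul_near hδ hδ1 hf hg hf0 hg0 hV hT
    (by rw [← ofReal_integral_eq_lintegral_ofReal hf2 (Eventually.of_forall fun z => sq_nonneg _)]
        exact ENNReal.ofReal_le_ofReal hfV)
    (by rw [← ofReal_integral_eq_lintegral_ofReal hg2 (Eventually.of_forall fun z => sq_nonneg _)]
        exact ENNReal.ofReal_le_ofReal hgV)
  simp only at key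
  rw [← ofReal_integral_eq_lintegral_ofReal if1 (Eventually.of_forall fun z => hf0 z.1),
    ← ofReal_integral_eq_lintegral_ofReal ig1 (Eventually.of_forall fun z => hg0 z.2),
    ← ofReal_integral_eq_lintegral_ofReal jf nf, ← ofReal_integral_eq_lintegral_ofReal jg ng,
    show (fun z : 𝒳 × 𝒴 => ENNReal.ofReal (f z.1) * ENNReal.ofReal (g z.2)) =
      fun z => ENNReal.ofReal (f z.1 * g z.2) from
      funext fun z => (ENNReal.ofReal_mul (hf0 z.1)).symm,
    ← ofReal_integral_eq_lintegral_ofReal ifg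
      (Eventually.of_forall fun z => mul_nonneg (hf0 z.1) (hg0 z.2))] at key
  have a0 : 0 ≤ ∫ z, f z.1 ∂μ := integral_nonneg fun z => hf0 z.1
  have a1 : 0 ≤ ∫ z, g z.2 ∂μ := integral_nonneg fun z => hg0 z.2
  have a2 : 0 ≤ ∫ z, f z.1 * g z.2 ∂μ := integral_nonneg fun z => mul_nonneg (hf0 z.1) (hg0 z.2)
  have a3 := integral_nonneg_of_ae nf
  have a4 := integral_nonneg_of_ae ng
  rw [show (2 : ℝ≥0∞) = ENNReal.ofReal 2 by norm_num, ← ENNReal.ofReal_add (by norm_num) a3,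
    ← ENNReal.ofReal_add (by norm_num) a4, ← ENNReal.ofReal_add (by positivity) (by positivity),
    ← ENNReal.ofReal_mul a0, ← ENNReal.ofReal_mul (by positivity),
    ← ENNReal.ofReal_add (by positivity) (by positivity),
    ← ENNReal.ofReal_add (by positivity) (by positivity),
    ← ENNReal.ofReal_add (by positivity) (by positivity),
    ENNReal.ofReal_le_ofReal_iff (by positivity), ENNReal.ofReal_le_ofReal_iff (by positivity)]
    at key
  rw [abs_le]
  constructor <;> nlinarith [key.1, key.2]

/-- Covariance bound for square-integrable functions of the coordinates of a wrung law. -/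
theorem Wrung.abs_cov_le {δ : ℝ} {μ : Measure (𝒳 × 𝒴)} [IsProbabilityMeasure μ]
    (h : Wrung δ μ) (hδ : 0 ≤ δ) (hδ1 : δ ≤ 1 / 15) {f : 𝒳 → ℝ} {g : 𝒴 → ℝ}
    (hf : Measurable f) (hg : Measurable g) {V T : ℝ} (hV : 1 ≤ V)
    (hT : 0 < T) (hf2 : Integrable (fun z => f z.1 ^ 2) μ) (hg2 : Integrable (fun z => g z.2 ^ 2) μ)
    (hfV : ∫ z, f z.1 ^ 2 ∂μ ≤ V) (hgV : ∫ z, g z.2 ^ 2 ∂μ ≤ V) :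
    |∫ z, f z.1 * g z.2 ∂μ - (∫ z, f z.1 ∂μ) * ∫ z, g z.2 ∂μ| ≤
      80 * δ * (4 + ∫ z, min |f z.1| T ^ (5 / 2 : ℝ) ∂μ + ∫ z, min |g z.2| T ^ (5 / 2 : ℝ) ∂μ) +
        192 * V ^ 2 / √T := by
  have hf' : Measurable fun z : 𝒳 × 𝒴 => f z.1 := hf.comp measurable_fst
  have hg' : Measurable fun z : 𝒳 × 𝒴 => g z.2 := hg.comp measurable_snd
  have imin : ∀ {u : 𝒳 × 𝒴 → ℝ}, Measurable u → (0 ≤ u) →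
      Integrable (fun z => min (u z) T ^ (5 / 2 : ℝ)) μ := by
    intro u hu hu0
    refine Integrable.of_bound (C := T ^ (5 / 2 : ℝ))
      (Measurable.aestronglyMeasurable (by fun_prop)) (Eventually.of_forall fun z => ?_)
    have : 0 ≤ min (u z) T := le_min (hu0 z) hT.le
    rw [Real.norm_of_nonneg (by positivity)]
    exact Real.rpow_le_rpow this (min_le_right _ _) (by norm_num)
  -- Positive and negative parts inherit all hypotheses. Covariance is bilinear, so f and g are
  -- handled by four nonnegative pairs, which turns 20 and 48 into 80 and 192.
  have part : ∀ {u : 𝒳 × 𝒴 → ℝ} {w : ℝ → ℝ}, Measurable u → Measurable w → (∀ x, 0 ≤ w x) →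
      (∀ x, w x ≤ |x|) → Integrable (fun z => u z ^ 2) μ → ∫ z, u z ^ 2 ∂μ ≤ V →
      Integrable (fun z => w (u z) ^ 2) μ ∧ ∫ z, w (u z) ^ 2 ∂μ ≤ V ∧
      Integrable (fun z => w (u z)) μ ∧
      ∫ z, min (w (u z)) T ^ (5 / 2 : ℝ) ∂μ ≤ ∫ z, min |u z| T ^ (5 / 2 : ℝ) ∂μ := by
    intro u w hu hw hw0 hw1 h2 hV2
    have hle : ∀ z, w (u z) ^ 2 ≤ u z ^ 2 := fun z => by
      rw [← sq_abs (u z)]; exact pow_le_pow_left₀ (hw0 _) (hw1 _) 2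
    have i1 : Integrable (fun z => w (u z) ^ 2) μ :=
      h2.mono' ((hw.comp hu).pow_const 2).aestronglyMeasurable
        (Eventually.of_forall fun z => by rw [Real.norm_of_nonneg (sq_nonneg _)]; exact hle z)
    refine ⟨i1, (integral_mono i1 h2 hle).trans hV2, ?_, ?_⟩
    · exact ((memLp_two_iff_integrable_sq (hw.comp hu).aestronglyMeasurable).2 i1).integrable
        (by norm_num)
    · refine integral_mono (imin (hw.comp hu) fun z => hw0 _)
        (imin (by fun_prop : Measurable fun z => |u z|) fun z => abs_nonneg _) fun z => ?_
      exact Real.rpow_le_rpow (le_min (hw0 _) hT.le) (min_le_min_right _ (hw1 _)) (by norm_num)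
  have mpos : Measurable fun x : ℝ => max x 0 := by fun_prop
  have mneg : Measurable fun x : ℝ => max (-x) 0 := by fun_prop
  have pos1 : ∀ x : ℝ, max x 0 ≤ |x| := fun x => max_le (le_abs_self x) (abs_nonneg x)
  have neg1 : ∀ x : ℝ, max (-x) 0 ≤ |x| := fun x => max_le (neg_le_abs x) (abs_nonneg x)
  obtain ⟨fp2, fpV, fp1, fpT⟩ := part hf' mpos (fun x => le_max_right _ _) pos1 hf2 hfV
  obtain ⟨fn2, fnV, fn1, fnT⟩ := part hf' mneg (fun x => le_max_right _ _) neg1 hf2 hfV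
  obtain ⟨gp2, gpV, gp1, gpT⟩ := part hg' mpos (fun x => le_max_right _ _) pos1 hg2 hgV
  obtain ⟨gn2, gnV, gn1, gnT⟩ := part hg' mneg (fun x => le_max_right _ _) neg1 hg2 hgV
  have K1 := h.abs_cov_le_of_nonneg hδ hδ1 (mpos.comp hf) (mpos.comp hg)
    (fun x => le_max_right _ _) (fun x => le_max_right _ _) hV hT fp2 gp2 fpV gpV
  have K2 := h.abs_cov_le_of_nonneg hδ hδ1 (mpos.comp hf) (mneg.comp hg)
    (fun x => le_max_right _ _) (fun x => le_max_right _ _) hV hT fp2 gn2 fpV gnV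
  have K3 := h.abs_cov_le_of_nonneg hδ hδ1 (mneg.comp hf) (mpos.comp hg)
    (fun x => le_max_right _ _) (fun x => le_max_right _ _) hV hT fn2 gp2 fnV gpV
  have K4 := h.abs_cov_le_of_nonneg hδ hδ1 (mneg.comp hf) (mneg.comp hg)
    (fun x => le_max_right _ _) (fun x => le_max_right _ _) hV hT fn2 gn2 fnV gnV
  simp only [Function.comp_apply] at K1 K2 K3 K4
  have hml : ∀ {u : 𝒳 × 𝒴 → ℝ}, Measurable u → Integrable (fun z => u z ^ 2) μ → MemLp u 2 μ :=
    fun hu h2 => (memLp_two_iff_integrable_sq hu.aestronglyMeasurable).2 h2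
  have mfp := hml (mpos.comp hf') fp2
  have mfn := hml (mneg.comp hf') fn2
  have mgp := hml (mpos.comp hg') gp2
  have mgn := hml (mneg.comp hg') gn2
  have dec : ∀ x : ℝ, x = max x 0 - max (-x) 0 := fun x => by
    rcases le_total x 0 with hx | hx
    · rw [max_eq_right hx, max_eq_left (by linarith)]; ring
    · rw [max_eq_left hx, max_eq_right (by linarith)]; ring
  have ef : ∫ z, f z.1 ∂μ = ∫ z, max (f z.1) 0 ∂μ - ∫ z, max (-f z.1) 0 ∂μ := by
    rw [← integral_sub fp1 fn1]; exact integral_congr_ae (Eventually.of_forall fun z => dec _)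
  have eg : ∫ z, g z.2 ∂μ = ∫ z, max (g z.2) 0 ∂μ - ∫ z, max (-g z.2) 0 ∂μ := by
    rw [← integral_sub gp1 gn1]; exact integral_congr_ae (Eventually.of_forall fun z => dec _)
  have i1 : Integrable (fun z => max (f z.1) 0 * max (g z.2) 0) μ := mfp.integrable_mul mgp
  have i2 : Integrable (fun z => max (f z.1) 0 * max (-g z.2) 0) μ := mfp.integrable_mul mgn
  have i3 : Integrable (fun z => max (-f z.1) 0 * max (g z.2) 0) μ := mfn.integrable_mul mgp
  have i4 : Integrable (fun z => max (-f z.1) 0 * max (-g z.2) 0) μ := mfn.integrable_mul mgn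
  have efg : ∫ z, f z.1 * g z.2 ∂μ = ∫ z, max (f z.1) 0 * max (g z.2) 0 ∂μ -
      ∫ z, max (f z.1) 0 * max (-g z.2) 0 ∂μ - ∫ z, max (-f z.1) 0 * max (g z.2) 0 ∂μ +
      ∫ z, max (-f z.1) 0 * max (-g z.2) 0 ∂μ := by
    have : ∀ z : 𝒳 × 𝒴, f z.1 * g z.2 = max (f z.1) 0 * max (g z.2) 0 -
        max (f z.1) 0 * max (-g z.2) 0 - max (-f z.1) 0 * max (g z.2) 0 +
        max (-f z.1) 0 * max (-g z.2) 0 := fun z => by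
      nth_rw 1 [dec (f z.1), dec (g z.2)]
      ring
    simp_rw [this]
    have i12 : Integrable (fun z => max (f z.1) 0 * max (g z.2) 0 -
      max (f z.1) 0 * max (-g z.2) 0) μ := i1.sub i2
    have i123 : Integrable (fun z => max (f z.1) 0 * max (g z.2) 0 -
      max (f z.1) 0 * max (-g z.2) 0 - max (-f z.1) 0 * max (g z.2) 0) μ := i12.sub i3
    rw [integral_add i123 i4, integral_sub i12 i3, integral_sub i1 i2]
  rw [ef, eg, efg]
  have hδb : ∀ {a b c d : ℝ}, a ≤ c → b ≤ d →
      20 * δ * (4 + a + b) ≤ 20 * δ * (4 + c + d) := fun h1 h2 => by gcongr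
  have L1 := hδb fpT gpT
  have L2 := hδb fpT gnT
  have L3 := hδb fnT gpT
  have L4 := hδb fnT gnT
  have e192 : 192 * V ^ 2 / √T = 4 * (48 * V ^ 2 / √T) := by ring
  rw [e192]
  rw [abs_le] at *
  constructor <;> linarith [K1.1, K1.2, K2.1, K2.2, K3.1, K3.2, K4.1, K4.2]

end Covariance

end

noncomputable section

/-! ### Normal mixtures and the cross-entropy bound. -/

section Mixture

lemma llr_withDensity_ofReal {f g : ℝ → ℝ} (hf : Measurable f) (hg : Measurable g)
    (hf0 : ∀ x, 0 < f x) (hg0 : ∀ x, 0 < g x) {P Q : Measure ℝ} [SigmaFinite Q]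
    (hP : P = volume.withDensity fun x => ENNReal.ofReal (f x))
    (hQ : Q = volume.withDensity fun x => ENNReal.ofReal (g x)) :
    P ≪ Q ∧ llr P Q =ᵐ[P] fun x => Real.log (f x) - Real.log (g x) := by
  have h1 : P = Q.withDensity fun x => ENNReal.ofReal (f x / g x) := by
    have hm : Measurable fun x => ENNReal.ofReal (f x / g x) := (hf.div hg).ennreal_ofReal
    rw [hP, hQ, ← withDensity_mul _ hg.ennreal_ofReal hm]
    congr 1; ext x
    rw [Pi.mul_apply, ← ENNReal.ofReal_mul (hg0 x).le, mul_div_cancel₀ _ (hg0 x).ne']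
  have hac : P ≪ Q := by rw [h1]; exact withDensity_absolutelyContinuous _ _
  refine ⟨hac, ?_⟩
  have h2 := Measure.rnDeriv_withDensity Q (hf.div hg).ennreal_ofReal
  change (Q.withDensity fun x => ENNReal.ofReal (f x / g x)).rnDeriv Q =ᵐ[Q] _ at h2
  rw [← h1] at h2
  filter_upwards [hac.ae_le h2] with x hx
  rw [llr, hx]
  simp only [Pi.div_apply]
  rw [ENNReal.toReal_ofReal (div_pos (hf0 x) (hg0 x)).le,
    Real.log_div (hf0 x).ne' (hg0 x).ne']

/-- The law of `s + N` where `s` has law `ν` and `N` is standard normal. -/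
def gaussianMix (ν : Measure ℝ) : Measure ℝ := ν.bind fun s => gaussianReal s 1

/-- The density of `gaussianMix ν`. -/
def mixDensity (ν : Measure ℝ) (z : ℝ) : ℝ := ∫ s, gaussianPDFReal s 1 z ∂ν

lemma measurable_gaussianReal_one : Measurable fun s : ℝ => gaussianReal s 1 := by
  exact measurable_gaussianReal.comp (measurable_id.prodMk measurable_const)

lemma measurable_gaussianPDFReal_swap :
    Measurable fun p : ℝ × ℝ => gaussianPDFReal p.2 1 p.1 :=
  measurable_uncurry_gaussianPDFReal.comp
    (measurable_snd.prodMk (measurable_const.prodMk measurable_fst))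

lemma gaussianPDFReal_one_eq (s z : ℝ) :
    gaussianPDFReal s 1 z = (√(2 * Real.pi))⁻¹ * Real.exp (-(z - s) ^ 2 / 2) := by
  simp [gaussianPDFReal]

lemma gaussianPDFReal_one_le (s z : ℝ) : gaussianPDFReal s 1 z ≤ (√(2 * Real.pi))⁻¹ := by
  rw [gaussianPDFReal_one_eq]
  refine mul_le_of_le_one_right (by positivity) (Real.exp_le_one_iff.2 ?_)
  have := sq_nonneg (z - s); linarith

variable (ν : Measure ℝ) [IsProbabilityMeasure ν]

lemma measurable_mixDensity : Measurable (mixDensity ν) :=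
  (measurable_gaussianPDFReal_swap.stronglyMeasurable.integral_prod_right).measurable

lemma integrable_gaussianPDFReal_center (z : ℝ) : Integrable (fun s => gaussianPDFReal s 1 z) ν := by
  refine Integrable.of_bound (C := (√(2 * Real.pi))⁻¹)
    (measurable_gaussianPDFReal_swap.comp measurable_prodMk_left).aestronglyMeasurable
    (Eventually.of_forall fun s => ?_)
  rw [Real.norm_of_nonneg (gaussianPDFReal_nonneg _ _ _)]
  exact gaussianPDFReal_one_le s z

lemma mixDensity_pos (z : ℝ) : 0 < mixDensity ν z := by
  unfold mixDensity
  rw [integral_pos_iff_support_of_nonneg (fun s => gaussianPDFReal_nonneg _ _ _)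
    (integrable_gaussianPDFReal_center ν z)]
  have : Function.support (fun s => gaussianPDFReal s 1 z) = Set.univ := by
    ext s; simp [(gaussianPDFReal_pos s 1 z one_ne_zero).ne']
  rw [this]; simp

lemma mixDensity_le (z : ℝ) : mixDensity ν z ≤ (√(2 * Real.pi))⁻¹ := by
  calc mixDensity ν z ≤ ∫ _, (√(2 * Real.pi))⁻¹ ∂ν :=
        integral_mono (integrable_gaussianPDFReal_center ν z) (integrable_const _)
          fun s => gaussianPDFReal_one_le s z
    _ = _ := by simp

lemma gaussianMix_eq_withDensity :
    gaussianMix ν = volume.withDensity fun z => ENNReal.ofReal (mixDensity ν z) := by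
  ext A hA
  rw [gaussianMix, Measure.bind_apply hA measurable_gaussianReal_one.aemeasurable,
    withDensity_apply _ hA]
  have : ∀ s, gaussianReal s 1 A = ∫⁻ z in A, ENNReal.ofReal (gaussianPDFReal s 1 z) :=
    fun s => gaussianReal_apply s one_ne_zero A
  simp_rw [this]
  rw [lintegral_lintegral_swap]
  · refine lintegral_congr fun z => ?_
    rw [mixDensity, ofReal_integral_eq_lintegral_ofReal (integrable_gaussianPDFReal_center ν z)
      (Eventually.of_forall fun s => gaussianPDFReal_nonneg _ _ _)]
  · exact (measurable_gaussianPDFReal_swap.comp measurable_swap).ennreal_ofReal.aemeasurable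

instance : IsProbabilityMeasure (gaussianMix ν) := by
  constructor
  rw [gaussianMix, Measure.bind_apply .univ measurable_gaussianReal_one.aemeasurable]
  simp

lemma gaussianMix_eq_map :
    gaussianMix ν = (ν.prod (gaussianReal 0 1)).map fun p => p.1 + p.2 := by
  ext A hA
  have hm : Measurable fun p : ℝ × ℝ => p.1 + p.2 := by fun_prop
  rw [gaussianMix, Measure.bind_apply hA measurable_gaussianReal_one.aemeasurable,
    Measure.map_apply hm hA, Measure.prod_apply (hm hA)]
  refine lintegral_congr fun s => ?_
  have h : gaussianReal s 1 = (gaussianReal 0 1).map (fun z => s + z) := by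
    rw [gaussianReal_map_const_add, zero_add]
  rw [h, Measure.map_apply (by fun_prop) hA]
  rfl

lemma lintegral_gaussianMix {f : ℝ → ℝ≥0∞} (hf : Measurable f) :
    ∫⁻ z, f z ∂(gaussianMix ν) = ∫⁻ s, ∫⁻ z, f z ∂(gaussianReal s 1) ∂ν :=
  Measure.lintegral_bind measurable_gaussianReal_one.aemeasurable hf.aemeasurable

/-- `-log` of the density of `gaussianMix ν`, normalized to be nonnegative. -/
def mixPotential (z : ℝ) : ℝ := -Real.log (mixDensity ν z) - Real.log (2 * Real.pi) / 2

lemma log_inv_sqrt_two_pi : Real.log (√(2 * Real.pi))⁻¹ = -(Real.log (2 * Real.pi) / 2) := by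
  rw [Real.log_inv, Real.log_sqrt (by positivity)]

lemma mixPotential_nonneg (z : ℝ) : 0 ≤ mixPotential ν z := by
  have := Real.log_le_log (mixDensity_pos ν z) (mixDensity_le ν z)
  rw [log_inv_sqrt_two_pi] at this
  unfold mixPotential; linarith

lemma measurable_mixPotential : Measurable (mixPotential ν) :=
  ((measurable_mixDensity ν).log.neg).sub measurable_const

lemma log_gaussianPDFReal_one (s z : ℝ) :
    Real.log (gaussianPDFReal s 1 z) = -(Real.log (2 * Real.pi) / 2) - (z - s) ^ 2 / 2 := by
  rw [gaussianPDFReal_one_eq, Real.log_mul (by positivity) (Real.exp_pos _).ne',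
    log_inv_sqrt_two_pi, Real.log_exp]
  ring

lemma llr_gaussianMix (s : ℝ) : gaussianReal s 1 ≪ gaussianMix ν ∧
    llr (gaussianReal s 1) (gaussianMix ν) =ᵐ[gaussianReal s 1]
      fun z => mixPotential ν z - (z - s) ^ 2 / 2 := by
  obtain ⟨h1, h2⟩ := llr_withDensity_ofReal (measurable_gaussianPDFReal s 1)
    (measurable_mixDensity ν) (fun x => gaussianPDFReal_pos s 1 x one_ne_zero) (mixDensity_pos ν)
    (gaussianReal_of_var_ne_zero s one_ne_zero) (gaussianMix_eq_withDensity ν)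
  refine ⟨h1, h2.trans (Eventually.of_forall fun z => ?_)⟩
  simp only [log_gaussianPDFReal_one, mixPotential]
  ring

lemma integrable_sub_pow_gaussianReal (s a : ℝ) (v : ℝ≥0) (k : ℕ) :
    Integrable (fun z => (z - a) ^ k) (gaussianReal s v) := by
  have h : MemLp (fun z : ℝ => z - a) k (gaussianReal s v) :=
    (memLp_id_gaussianReal (k : ℝ≥0)).sub (memLp_const a)
  rcases Nat.eq_zero_or_pos k with rfl | hk
  · simp
  · have := h.integrable_norm_pow (by omega)
    rw [← integrable_norm_iff (Measurable.aestronglyMeasurable (by fun_prop))]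
    simpa using this

lemma integral_sub_sq_gaussianReal (s a : ℝ) (v : ℝ≥0) :
    ∫ z, (z - a) ^ 2 ∂(gaussianReal s v) = v + (s - a) ^ 2 := by
  have h1 := variance_fun_id_gaussianReal (μ := s) (v := v)
  rw [variance_eq_integral (by fun_prop)] at h1
  simp only [integral_id_gaussianReal] at h1
  have i2 := integrable_sub_pow_gaussianReal s s v 2
  have i1 : Integrable (fun z => z - s) (gaussianReal s v) := by
    simpa using integrable_sub_pow_gaussianReal s s v 1
  have i0 : ∫ z, (z - s) ∂(gaussianReal s v) = 0 := by
    rw [integral_sub (by simpa using integrable_sub_pow_gaussianReal s 0 v 1) (integrable_const _)]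
    simp
  have : ∀ z : ℝ, (z - a) ^ 2 = (z - s) ^ 2 + (2 * (s - a)) * (z - s) + (s - a) ^ 2 :=
    fun z => by ring
  have i21 : Integrable (fun z => (z - s) ^ 2 + (2 * (s - a)) * (z - s)) (gaussianReal s v) :=
    i2.add (i1.const_mul _)
  rw [funext this, integral_add i21 (integrable_const _), integral_add i2 (i1.const_mul _),
    integral_const_mul, i0, h1]
  simp

lemma lintegral_sub_sq_gaussianReal (s a : ℝ) :
    ∫⁻ z, ENNReal.ofReal ((z - a) ^ 2) ∂(gaussianReal s 1) = ENNReal.ofReal (1 + (s - a) ^ 2) := by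
  rw [← ofReal_integral_eq_lintegral_ofReal (integrable_sub_pow_gaussianReal s a 1 2)
    (Eventually.of_forall fun z => sq_nonneg _), integral_sub_sq_gaussianReal]
  simp

lemma integrable_sub_sq {ν : Measure ℝ} [IsProbabilityMeasure ν]
    (h2 : Integrable (fun s => s ^ 2) ν) (a : ℝ) : Integrable (fun s => (s - a) ^ 2) ν := by
  have h1 : MemLp (fun s : ℝ => s) 2 ν := (memLp_two_iff_integrable_sq (by fun_prop)).2 h2
  exact (memLp_two_iff_integrable_sq (by fun_prop)).1 (h1.sub (memLp_const a))

lemma integrable_sub_sq_gaussianMix {ν : Measure ℝ} [IsProbabilityMeasure ν]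
    (h2 : Integrable (fun s => s ^ 2) ν) (a : ℝ) :
    Integrable (fun z => (z - a) ^ 2) (gaussianMix ν) ∧
      ∫ z, (z - a) ^ 2 ∂(gaussianMix ν) = 1 + ∫ s, (s - a) ^ 2 ∂ν := by
  have h3 := integrable_sub_sq h2 a
  have key : ∫⁻ z, ENNReal.ofReal ((z - a) ^ 2) ∂(gaussianMix ν) =
      ENNReal.ofReal (1 + ∫ s, (s - a) ^ 2 ∂ν) := by
    rw [lintegral_gaussianMix ν (by fun_prop)]
    simp_rw [lintegral_sub_sq_gaussianReal]
    rw [← ofReal_integral_eq_lintegral_ofReal (by exact (integrable_const 1).add h3)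
      (Eventually.of_forall fun z => by positivity), integral_add (integrable_const 1) h3]
    simp
  have hi : Integrable (fun z => (z - a) ^ 2) (gaussianMix ν) := by
    refine ⟨by fun_prop, ?_⟩
    rw [hasFiniteIntegral_iff_ofReal (Eventually.of_forall fun z => sq_nonneg _), key]
    exact ENNReal.ofReal_lt_top
  refine ⟨hi, ?_⟩
  rw [integral_eq_lintegral_of_nonneg_ae (Eventually.of_forall fun z => sq_nonneg _) (by fun_prop),
    key, ENNReal.toReal_ofReal]
  have : 0 ≤ ∫ s, (s - a) ^ 2 ∂ν := integral_nonneg fun s => sq_nonneg _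
  linarith

/-- Jensen's inequality for the exponential: the logarithm of an average of normal densities is at
least the average of their logarithms. -/
lemma mixPotential_le {ν : Measure ℝ} [IsProbabilityMeasure ν]
    (h2 : Integrable (fun s => s ^ 2) ν) (z : ℝ) :
    mixPotential ν z ≤ (∫ s, (s - z) ^ 2 ∂ν) / 2 := by
  have hi := integrable_sub_sq h2 z
  have hj := convexOn_exp.map_integral_le (μ := ν) (f := fun s => -(s - z) ^ 2 / 2)
    Real.continuous_exp.continuousOn isClosed_univ (by simp)
    (by simpa using (hi.neg.div_const 2))
    (by
      refine Integrable.of_bound (C := 1) (by fun_prop) (Eventually.of_forall fun s => ?_)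
      simp only [Function.comp_apply, Real.norm_eq_abs, Real.abs_exp, Real.exp_le_one_iff]
      have := sq_nonneg (s - z); linarith)
  have h1 : mixDensity ν z = (√(2 * Real.pi))⁻¹ * ∫ s, Real.exp (-(s - z) ^ 2 / 2) ∂ν := by
    unfold mixDensity
    rw [← integral_const_mul]
    refine integral_congr_ae (Eventually.of_forall fun s => ?_)
    simp only [gaussianPDFReal_one_eq]
    rw [show (z - s) ^ 2 = (s - z) ^ 2 by ring]
  have h3 : (√(2 * Real.pi))⁻¹ * Real.exp (∫ s, -(s - z) ^ 2 / 2 ∂ν) ≤ mixDensity ν z := by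
    rw [h1]; exact mul_le_mul_of_nonneg_left hj (by positivity)
  have h4 := Real.log_le_log (by positivity) h3
  rw [Real.log_mul (by positivity) (Real.exp_pos _).ne', Real.log_exp, log_inv_sqrt_two_pi,
    integral_div, integral_neg] at h4
  unfold mixPotential; linarith

lemma integral_sub_sq_le {ν : Measure ℝ} [IsProbabilityMeasure ν]
    (h2 : Integrable (fun s => s ^ 2) ν) (z : ℝ) :
    ∫ s, (s - z) ^ 2 ∂ν ≤ 2 * z ^ 2 + 2 * ∫ s, s ^ 2 ∂ν := by
  calc ∫ s, (s - z) ^ 2 ∂ν ≤ ∫ s, (2 * z ^ 2 + 2 * s ^ 2) ∂ν :=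
        integral_mono (integrable_sub_sq h2 z) ((integrable_const _).add (h2.const_mul 2))
          fun s => by simp only; nlinarith [sq_nonneg (s + z)]
    _ = _ := by
        rw [integral_add (integrable_const _) (h2.const_mul 2), integral_const]
        simp [integral_const_mul]

lemma integrable_mixPotential {ν : Measure ℝ} [IsProbabilityMeasure ν]
    (h2 : Integrable (fun s => s ^ 2) ν) {P : Measure ℝ} [IsProbabilityMeasure P]
    (hP : Integrable (fun z => z ^ 2) P) : Integrable (mixPotential ν) P := by
  refine Integrable.mono' (g := fun z => z ^ 2 + ∫ s, s ^ 2 ∂ν) (hP.add (integrable_const _))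
    (measurable_mixPotential ν).aestronglyMeasurable (Eventually.of_forall fun z => ?_)
  rw [Real.norm_of_nonneg (mixPotential_nonneg ν z)]
  have := mixPotential_le h2 z
  have := integral_sub_sq_le h2 z
  linarith

-- The log-likelihood ratio is the mixture potential minus (z-s)²/2, whose mean is 1/2. Writing the
-- half on the left avoids truncated subtraction.
open InformationTheory in
lemma klDiv_gaussianMix_add_half {ν : Measure ℝ} [IsProbabilityMeasure ν]
    (h2 : Integrable (fun s => s ^ 2) ν) (s : ℝ) :
    klDiv (gaussianReal s 1) (gaussianMix ν) + ENNReal.ofReal (1 / 2) =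
      ∫⁻ z, ENNReal.ofReal (mixPotential ν z) ∂(gaussianReal s 1) := by
  obtain ⟨h1, h3⟩ := llr_gaussianMix ν s
  have iG : Integrable (mixPotential ν) (gaussianReal s 1) :=
    integrable_mixPotential h2 (by simpa using integrable_sub_pow_gaussianReal s 0 1 2)
  have i2 := (integrable_sub_pow_gaussianReal s s 1 2).div_const 2
  have il : Integrable (llr (gaussianReal s 1) (gaussianMix ν)) (gaussianReal s 1) :=
    (iG.sub i2).congr h3.symm
  have e : ∫ z, llr (gaussianReal s 1) (gaussianMix ν) z ∂(gaussianReal s 1) =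
      ∫ z, mixPotential ν z ∂(gaussianReal s 1) - 1 / 2 := by
    rw [integral_congr_ae h3, integral_sub iG i2, integral_div, integral_sub_sq_gaussianReal]
    simp
  have hn := integral_llr_add_sub_measure_univ_nonneg h1 il
  rw [klDiv_of_ac_of_integrable h1 il]
  simp only [probReal_univ, add_sub_cancel_right] at hn ⊢
  rw [← ENNReal.ofReal_add hn (by norm_num), e,
    ← ofReal_integral_eq_lintegral_ofReal iG (Eventually.of_forall fun z => mixPotential_nonneg ν z)]
  congr 1; ring

open InformationTheory in
/-- The mutual information of the Gaussian channel is bounded by the cross entropy with any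
(sub-)probability density `exp (-L)`. -/
theorem lintegral_klDiv_gaussianMix_le {ν : Measure ℝ} [IsProbabilityMeasure ν]
    (h2 : Integrable (fun s => s ^ 2) ν) {L : ℝ → ℝ} (hL : Measurable L)
    (hL1 : ∫⁻ z, ENNReal.ofReal (Real.exp (-L z)) ≤ 1) (hLi : Integrable L (gaussianMix ν)) :
    ∫⁻ s, klDiv (gaussianReal s 1) (gaussianMix ν) ∂ν ≤
      ENNReal.ofReal (∫ z, L z ∂(gaussianMix ν) - Real.log (2 * Real.pi) / 2 - 1 / 2) := by
  have iG : Integrable (mixPotential ν) (gaussianMix ν) :=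
    integrable_mixPotential h2 (by simpa using (integrable_sub_sq_gaussianMix h2 0).1)
  have e1 : ∫⁻ s, klDiv (gaussianReal s 1) (gaussianMix ν) ∂ν + ENNReal.ofReal (1 / 2) =
      ENNReal.ofReal (∫ z, mixPotential ν z ∂(gaussianMix ν)) := by
    rw [ofReal_integral_eq_lintegral_ofReal iG
      (Eventually.of_forall fun z => mixPotential_nonneg ν z),
      lintegral_gaussianMix ν (measurable_mixPotential ν).ennreal_ofReal]
    simp_rw [← klDiv_gaussianMix_add_half h2]
    rw [lintegral_add_right _ measurable_const]
    simp
  -- The mean under the mixture of the ratio of densities is the total mass of exp(-L).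
  have hq : ∫⁻ z, ENNReal.ofReal (Real.exp (-L z) / mixDensity ν z) ∂(gaussianMix ν) ≤ 1 := by
    rw [gaussianMix_eq_withDensity,
      lintegral_withDensity_eq_lintegral_mul _ (measurable_mixDensity ν).ennreal_ofReal
        (by have := measurable_mixDensity ν; fun_prop)]
    refine le_trans (le_of_eq (lintegral_congr fun z => ?_)) hL1
    rw [Pi.mul_apply, ← ENNReal.ofReal_mul (mixDensity_pos ν z).le,
      mul_div_cancel₀ _ (mixDensity_pos ν z).ne']
  have hq0 : ∀ z, 0 ≤ Real.exp (-L z) / mixDensity ν z := fun z =>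
    div_nonneg (Real.exp_pos _).le (mixDensity_pos ν z).le
  have mq : Measurable fun z => Real.exp (-L z) / mixDensity ν z := by
    have := measurable_mixDensity ν; fun_prop
  have iq : Integrable (fun z => Real.exp (-L z) / mixDensity ν z) (gaussianMix ν) := by
    refine ⟨mq.aestronglyMeasurable, ?_⟩
    rw [hasFiniteIntegral_iff_ofReal (Eventually.of_forall hq0)]
    exact lt_of_le_of_lt hq ENNReal.one_lt_top
  have hq' : ∫ z, Real.exp (-L z) / mixDensity ν z ∂(gaussianMix ν) ≤ 1 := by
    rw [integral_eq_lintegral_of_nonneg_ae (Eventually.of_forall hq0) mq.aestronglyMeasurable]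
    exact ENNReal.toReal_le_of_le_ofReal zero_le_one (by simpa using hq)
  -- Gibbs' inequality, from log x ≤ x - 1 applied pointwise to that ratio.
  have gibbs : ∫ z, mixPotential ν z ∂(gaussianMix ν) ≤
      ∫ z, L z ∂(gaussianMix ν) - Real.log (2 * Real.pi) / 2 := by
    have : ∫ z, mixPotential ν z ∂(gaussianMix ν) ≤ ∫ z, (L z +
        (Real.exp (-L z) / mixDensity ν z) + (-1 - Real.log (2 * Real.pi) / 2)) ∂(gaussianMix ν) := by
      refine integral_mono iG ((hLi.add iq).add (integrable_const _)) fun z => ?_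
      have hl := Real.log_le_sub_one_of_pos
        (div_pos (Real.exp_pos (-L z)) (mixDensity_pos ν z))
      rw [Real.log_div (Real.exp_pos _).ne' (mixDensity_pos ν z).ne', Real.log_exp] at hl
      simp only [mixPotential]; linarith
    have hLq : Integrable (fun z => L z + Real.exp (-L z) / mixDensity ν z) (gaussianMix ν) :=
      hLi.add iq
    rw [integral_add hLq (integrable_const _), integral_add hLi iq] at this
    simp at this
    linarith
  have hle : ∫⁻ s, klDiv (gaussianReal s 1) (gaussianMix ν) ∂ν ≤
      ENNReal.ofReal (∫ z, mixPotential ν z ∂(gaussianMix ν)) - ENNReal.ofReal (1 / 2) := by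
    rw [← e1]; exact (ENNReal.add_sub_cancel_right ENNReal.ofReal_ne_top).ge
  rw [← ENNReal.ofReal_sub _ (by norm_num)] at hle
  refine hle.trans (ENNReal.ofReal_le_ofReal ?_)
  linarith

end Mixture

end

noncomputable section

/-! ### Divergence variance against a normal mixture. -/

section DivergenceVariance

/-- Moving the observation by d multiplies each component density by exp(-d²/2 - d(z-s)). The
component weights decrease with the distance |z-s|, so the weighted mean distance is at most the
plain one, and Jensen's inequality under the weights gives the claim. The increment is linear in a
first moment, which is what keeps fourth moments of the inputs out of the variance bound. -/
lemma mixPotential_le_add {ν : Measure ℝ} [IsProbabilityMeasure ν]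
    (h1 : Integrable (fun s => s) ν) (z z' : ℝ) :
    mixPotential ν z' ≤ mixPotential ν z + (z' - z) ^ 2 / 2 + |z' - z| * ∫ s, |z - s| ∂ν := by
  set d := z' - z with hd
  set b := ∫ s, |z - s| ∂ν with hb
  have ir : Integrable (fun s => |z - s|) ν := ((integrable_const z).sub h1).abs
  have iφ := integrable_gaussianPDFReal_center ν z
  have iφr : Integrable (fun s => gaussianPDFReal s 1 z * |z - s|) ν := by
    refine Integrable.mono' (ir.const_mul (√(2 * Real.pi))⁻¹)
      ((measurable_gaussianPDFReal_swap.comp measurable_prodMk_left).mul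
        (by fun_prop)).aestronglyMeasurable (Eventually.of_forall fun s => ?_)
    rw [Real.norm_of_nonneg (mul_nonneg (gaussianPDFReal_nonneg _ _ _) (abs_nonneg _))]
    exact mul_le_mul_of_nonneg_right (gaussianPDFReal_one_le s z) (abs_nonneg _)
  have hb0 : 0 ≤ b := integral_nonneg fun s => abs_nonneg _
  -- the weight decreases with the distance, so the weighted mean distance is at most `b`
  have cheb : ∫ s, gaussianPDFReal s 1 z * |z - s| ∂ν ≤ b * mixDensity ν z := by
    have hpt : ∀ s, gaussianPDFReal s 1 z * |z - s| ≤ b * gaussianPDFReal s 1 z +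
        (√(2 * Real.pi))⁻¹ * Real.exp (-b ^ 2 / 2) * (|z - s| - b) := by
      intro s
      rw [gaussianPDFReal_one_eq, ← sq_abs (z - s)]
      have : (Real.exp (-|z - s| ^ 2 / 2) - Real.exp (-b ^ 2 / 2)) * (|z - s| - b) ≤ 0 := by
        rcases le_total b |z - s| with h | h
        · refine mul_nonpos_of_nonpos_of_nonneg ?_ (by linarith)
          have : b ^ 2 ≤ |z - s| ^ 2 := by gcongr
          have := Real.exp_le_exp.2 (show -|z - s| ^ 2 / 2 ≤ -b ^ 2 / 2 by linarith)
          linarith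
        · refine mul_nonpos_of_nonneg_of_nonpos ?_ (by linarith)
          have : |z - s| ^ 2 ≤ b ^ 2 := by gcongr
          have := Real.exp_le_exp.2 (show -b ^ 2 / 2 ≤ -|z - s| ^ 2 / 2 by linarith)
          linarith
      have h0 : 0 ≤ (√(2 * Real.pi))⁻¹ := by positivity
      nlinarith
    have irb : Integrable (fun s => |z - s| - b) ν := ir.sub (integrable_const b)
    calc _ ≤ ∫ s, (b * gaussianPDFReal s 1 z +
        (√(2 * Real.pi))⁻¹ * Real.exp (-b ^ 2 / 2) * (|z - s| - b)) ∂ν :=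
          integral_mono iφr ((iφ.const_mul b).add (irb.const_mul _)) hpt
      _ = _ := by
          rw [integral_add (iφ.const_mul b) (irb.const_mul _),
            integral_const_mul, integral_const_mul, integral_sub ir (integrable_const b)]
          simp [mixDensity, ← hb]
  have hlow : Real.exp (-(d ^ 2 / 2 + |d| * b)) * mixDensity ν z ≤ mixDensity ν z' := by
    set E := Real.exp (-(d ^ 2 / 2 + |d| * b)) with hE
    -- The exponential is linearized after factoring out exp(-|d|b), so that the first-order term
    -- |d|(b - |z-s|) has nonnegative weighted mean by `cheb`.
    have hpt : ∀ s, E * ((1 + |d| * b) * gaussianPDFReal s 1 z -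
        |d| * (gaussianPDFReal s 1 z * |z - s|)) ≤ gaussianPDFReal s 1 z' := by
      intro s
      have e : gaussianPDFReal s 1 z' = gaussianPDFReal s 1 z *
          (E * Real.exp (|d| * b - d * (z - s))) := by
        rw [gaussianPDFReal_one_eq, gaussianPDFReal_one_eq, mul_assoc, hE, ← Real.exp_add,
          ← Real.exp_add]
        congr 2; rw [hd]; ring
      rw [e]
      have h3 := Real.add_one_le_exp (|d| * b - d * (z - s))
      have h4 : d * (z - s) ≤ |d| * |z - s| := by rw [← abs_mul]; exact le_abs_self _
      have h5 : 1 + |d| * b - |d| * |z - s| ≤ Real.exp (|d| * b - d * (z - s)) := by linarith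
      have h6 : 0 ≤ gaussianPDFReal s 1 z * E :=
        mul_nonneg (gaussianPDFReal_nonneg _ _ _) (Real.exp_pos _).le
      nlinarith [mul_le_mul_of_nonneg_left h5 h6]
    have id : Integrable (fun s => (1 + |d| * b) * gaussianPDFReal s 1 z -
        |d| * (gaussianPDFReal s 1 z * |z - s|)) ν :=
      (iφ.const_mul (1 + |d| * b)).sub (iφr.const_mul |d|)
    have := integral_mono (id.const_mul E)
      (integrable_gaussianPDFReal_center ν z') hpt
    rw [integral_const_mul, integral_sub (iφ.const_mul (1 + |d| * b)) (iφr.const_mul |d|),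
      integral_const_mul, integral_const_mul] at this
    refine le_trans ?_ this
    refine mul_le_mul_of_nonneg_left ?_ (Real.exp_pos _).le
    have := mul_le_mul_of_nonneg_left cheb (abs_nonneg d)
    unfold mixDensity at this ⊢
    linarith
  have := Real.log_le_log (mul_pos (Real.exp_pos _) (mixDensity_pos ν z)) hlow
  rw [Real.log_mul (Real.exp_pos _).ne' (mixDensity_pos ν z).ne', Real.log_exp] at this
  unfold mixPotential
  linarith

lemma evariance_le_lintegral_sub_const {Ω : Type*} [MeasurableSpace Ω] {P : Measure Ω}
    [IsProbabilityMeasure P] {X : Ω → ℝ} (hX : Measurable X) (c : ℝ) :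
    evariance X P ≤ ∫⁻ ω, ENNReal.ofReal ((X ω - c) ^ 2) ∂P := by
  by_cases h : ∫⁻ ω, ENNReal.ofReal ((X ω - c) ^ 2) ∂P = ∞
  · rw [h]; exact le_top
  have hi : Integrable (fun ω => (X ω - c) ^ 2) P := by
    refine ⟨(by fun_prop : Measurable fun ω => (X ω - c) ^ 2).aestronglyMeasurable, ?_⟩
    rw [hasFiniteIntegral_iff_ofReal (Eventually.of_forall fun z => sq_nonneg _)]
    exact lt_top_iff_ne_top.2 h
  have hm : MemLp (fun ω => X ω - c) 2 P :=
    (memLp_two_iff_integrable_sq (hX.sub_const c).aestronglyMeasurable).2 hi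
  have hmX : MemLp X 2 P := by
    have := hm.add (memLp_const c)
    exact this.ae_eq (Eventually.of_forall fun ω => by simp)
  rw [← ofReal_variance hmX, ← ofReal_integral_eq_lintegral_ofReal hi
    (Eventually.of_forall fun z => sq_nonneg _)]
  refine ENNReal.ofReal_le_ofReal ?_
  rw [← variance_sub_const hX.aestronglyMeasurable c]
  exact variance_le_expectation_sq (hX.sub_const c).aestronglyMeasurable

/-- The fourth moment of the standard normal law. -/
def gaussianFourthMoment : ℝ := ∫ z, z ^ 4 ∂(gaussianReal 0 1)

lemma gaussianFourthMoment_nonneg : 0 ≤ gaussianFourthMoment :=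
  integral_nonneg fun z => by positivity

lemma integral_sub_pow_four_gaussianReal (s : ℝ) :
    ∫ z, (z - s) ^ 4 ∂(gaussianReal s 1) = gaussianFourthMoment := by
  have h : gaussianReal s 1 = (gaussianReal 0 1).map (fun z => z + s) := by
    rw [gaussianReal_map_add_const, zero_add]
  rw [h, integral_map (by fun_prop) (Measurable.aestronglyMeasurable (by fun_prop))]
  simp [gaussianFourthMoment]

/-- The variance is at most the mean square about the constant `mixPotential ν s`. Around it the
log-likelihood ratio deviates by at most 2(z-s)² + |z-s|b, where b is the mean distance from s to
the centres and b² is at most a second moment. Only z - s, a standard normal deviation, is raised to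
the fourth power. -/
theorem divergenceVariance_gaussianMix_le (ν : Measure ℝ) [IsProbabilityMeasure ν] (s : ℝ) :
    divergenceVariance (gaussianReal s 1) (gaussianMix ν) ≤
      ENNReal.ofReal (8 * gaussianFourthMoment + 4) *
        (1 + ENNReal.ofReal (s ^ 2) + ∫⁻ x, ENNReal.ofReal (x ^ 2) ∂ν) := by
  have h4 := gaussianFourthMoment_nonneg
  by_cases htop : ∫⁻ x, ENNReal.ofReal (x ^ 2) ∂ν = ∞
  · rw [htop, add_top, ENNReal.mul_top]
    · exact le_top
    · simpa using by positivity
  have h2 : Integrable (fun x : ℝ => x ^ 2) ν := by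
    refine ⟨by fun_prop, ?_⟩
    rw [hasFiniteIntegral_iff_ofReal (Eventually.of_forall fun z => sq_nonneg _)]
    exact lt_top_iff_ne_top.2 htop
  have hm2 : MemLp (fun x : ℝ => x) 2 ν := (memLp_two_iff_integrable_sq (by fun_prop)).2 h2
  have h1 : Integrable (fun x : ℝ => x) ν := hm2.integrable (by norm_num)
  obtain ⟨hac, hllr⟩ := llr_gaussianMix ν s
  set b := ∫ x, |s - x| ∂ν with hb
  have hb0 : 0 ≤ b := integral_nonneg fun s => abs_nonneg _
  have hbm : MemLp (fun x : ℝ => |s - x|) 2 ν := ((memLp_const s).sub hm2).norm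
  have hb2 : b ^ 2 ≤ 2 * s ^ 2 + 2 * ∫ x, x ^ 2 ∂ν := by
    have hv := variance_nonneg (fun x : ℝ => |s - x|) ν
    rw [variance_eq_sub hbm] at hv
    have e : ∫ x, ((fun x : ℝ => |s - x|) ^ 2) x ∂ν = ∫ x, (x - s) ^ 2 ∂ν := by
      refine integral_congr_ae (Eventually.of_forall fun x => ?_)
      simp only [Pi.pow_apply, sq_abs]; ring
    rw [e] at hv
    have := integral_sub_sq_le h2 s
    linarith
  have hbz : ∀ z, ∫ x, |z - x| ∂ν ≤ b + |z - s| := by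
    intro z
    calc ∫ x, |z - x| ∂ν ≤ ∫ x, (|s - x| + |z - s|) ∂ν := by
          refine integral_mono ((integrable_const z).sub h1).abs
            (((integrable_const s).sub h1).abs.add (integrable_const _)) fun x => ?_
          have := abs_add_le (s - x) (z - s)
          simpa [show s - x + (z - s) = z - x by ring] using this
      _ = _ := by
          have : Integrable (fun x => |s - x|) ν := ((integrable_const s).sub h1).abs
          rw [integral_add this (integrable_const _)]
          simp [hb]
  -- In the reverse direction the mean distance is taken from z and is at most b + |z-s|, so the
  -- coefficient 1/2 becomes 3/2.
  have hG : ∀ z, |mixPotential ν z - mixPotential ν s| ≤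
      3 / 2 * (z - s) ^ 2 + |z - s| * b := by
    intro z
    have k1 := mixPotential_le_add h1 s z
    have k2 := mixPotential_le_add h1 z s
    rw [abs_sub_comm s z, show (s - z) ^ 2 = (z - s) ^ 2 by ring] at k2
    have k3 := mul_le_mul_of_nonneg_left (hbz z) (abs_nonneg (z - s))
    have k4 : |z - s| * |z - s| = (z - s) ^ 2 := by rw [← sq, sq_abs]
    have k5 := sq_nonneg (z - s)
    rw [abs_le]
    constructor <;> nlinarith
  have hle : divergenceVariance (gaussianReal s 1) (gaussianMix ν) ≤
      evariance (llr (gaussianReal s 1) (gaussianMix ν)) (gaussianReal s 1) := by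
    unfold divergenceVariance; exact iInf_le _ hac
  refine hle.trans ?_
  refine (evariance_le_lintegral_sub_const (measurable_llr _ _) (mixPotential ν s)).trans ?_
  have iB : Integrable (fun z => 8 * (z - s) ^ 4 + (2 * b ^ 2) * (z - s) ^ 2)
      (gaussianReal s 1) :=
    ((integrable_sub_pow_gaussianReal s s 1 4).const_mul 8).add
      ((integrable_sub_pow_gaussianReal s s 1 2).const_mul _)
  calc ∫⁻ z, ENNReal.ofReal ((llr (gaussianReal s 1) (gaussianMix ν) z - mixPotential ν s) ^ 2)
        ∂(gaussianReal s 1)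
      ≤ ∫⁻ z, ENNReal.ofReal (8 * (z - s) ^ 4 + (2 * b ^ 2) * (z - s) ^ 2) ∂(gaussianReal s 1) := by
        refine lintegral_mono_ae ?_
        filter_upwards [hllr] with z hz
        rw [hz]
        refine ENNReal.ofReal_le_ofReal ?_
        have h := hG z
        have h5 : |mixPotential ν z - (z - s) ^ 2 / 2 - mixPotential ν s| ≤
            2 * (z - s) ^ 2 + |z - s| * b := by
          rw [abs_le] at h ⊢
          have := sq_nonneg (z - s)
          constructor <;> linarith [h.1, h.2]
        have h6 := pow_le_pow_left₀ (abs_nonneg _) h5 2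
        rw [sq_abs] at h6
        have h7 : |z - s| ^ 2 = (z - s) ^ 2 := sq_abs _
        nlinarith [sq_nonneg (2 * (z - s) ^ 2 - |z - s| * b)]
    _ = ENNReal.ofReal (8 * gaussianFourthMoment + 2 * b ^ 2) := by
        rw [← ofReal_integral_eq_lintegral_ofReal iB (Eventually.of_forall fun z => by positivity),
          integral_add ((integrable_sub_pow_gaussianReal s s 1 4).const_mul 8)
            ((integrable_sub_pow_gaussianReal s s 1 2).const_mul _), integral_const_mul,
          integral_const_mul, integral_sub_pow_four_gaussianReal, integral_sub_sq_gaussianReal]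
        simp
    _ ≤ _ := by
        have i0 : 0 ≤ ∫ x, x ^ 2 ∂ν := integral_nonneg fun x => sq_nonneg _
        rw [← ofReal_integral_eq_lintegral_ofReal h2 (Eventually.of_forall fun z => sq_nonneg _),
          ← ENNReal.ofReal_one, ← ENNReal.ofReal_add (by norm_num) (by positivity),
          ← ENNReal.ofReal_add (by positivity) i0, ← ENNReal.ofReal_mul (by positivity)]
        refine ENNReal.ofReal_le_ofReal ?_
        nlinarith [mul_nonneg h4 (sq_nonneg s), mul_nonneg h4 i0]

end DivergenceVariance

/-! ### Output laws of the Gaussian channel as mixtures; finiteness of the maximal variance. -/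

section Outputs

lemma bind_gaussianReal_comp {α : Type*} [MeasurableSpace α] (μ : Measure α) {f : α → ℝ}
    (hf : Measurable f) : (μ.bind fun a => gaussianReal (f a) 1) = gaussianMix (μ.map f) := by
  unfold gaussianMix Measure.bind
  rw [Measure.map_map measurable_gaussianReal_one hf]
  rfl

lemma outZ_gaussianMAC (S₁ S₂ : ℝ) (μ : Measure (ℝ × ℝ)) :
    (gaussianMAC S₁ S₂).outZ μ = gaussianMix (μ.map fun p => p.1 + p.2) :=
  bind_gaussianReal_comp μ (by fun_prop)

lemma outZGivenX_gaussianMAC (S₁ S₂ : ℝ) (μ : Measure (ℝ × ℝ)) [IsFiniteMeasure μ] (x : ℝ) :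
    (gaussianMAC S₁ S₂).outZGivenX μ x = gaussianMix ((μ.condKernel x).map fun y => x + y) :=
  bind_gaussianReal_comp (μ.condKernel x) (f := fun y => x + y) (by fun_prop)

lemma outZGivenY_gaussianMAC (S₁ S₂ : ℝ) (μ : Measure (ℝ × ℝ)) [IsFiniteMeasure μ] (y : ℝ) :
    (gaussianMAC S₁ S₂).outZGivenY μ y =
      gaussianMix (((μ.map Prod.swap).condKernel y).map fun x => x + y) :=
  bind_gaussianReal_comp ((μ.map Prod.swap).condKernel y) (f := fun x => x + y) (by fun_prop)

lemma gaussianMAC_W_apply (S₁ S₂ : ℝ) (p : ℝ × ℝ) :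
    (gaussianMAC S₁ S₂).W p = gaussianReal (p.1 + p.2) 1 := rfl

/-- Second moments of an input law that meets the power constraints. -/
lemma meetsCost_gaussianMAC_lintegral {S₁ S₂ : ℝ} {P : InputLaw ℝ ℝ}
    (h : (gaussianMAC S₁ S₂).MeetsCost P) :
    ∫⁻ u, ∫⁻ p, ENNReal.ofReal (p.1 ^ 2) ∂(P.PXY u) ∂P.PU ≤ ENNReal.ofReal S₁ ∧
    ∫⁻ u, ∫⁻ p, ENNReal.ofReal (p.2 ^ 2) ∂(P.PXY u) ∂P.PU ≤ ENNReal.ofReal S₂ := by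
  obtain ⟨⟨h1, h2⟩, h3, h4⟩ := h
  change Integrable (fun p : ℝ × ℝ => p.1 ^ 2) _ at h1
  change Integrable (fun p : ℝ × ℝ => p.2 ^ 2) _ at h3
  constructor
  · rw [← Measure.lintegral_bind P.PXY.measurable.aemeasurable
      (by fun_prop : Measurable fun p : ℝ × ℝ => ENNReal.ofReal (p.1 ^ 2)).aemeasurable,
      ← ofReal_integral_eq_lintegral_ofReal h1 (Eventually.of_forall fun p => sq_nonneg _)]
    exact ENNReal.ofReal_le_ofReal h2
  · rw [← Measure.lintegral_bind P.PXY.measurable.aemeasurable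
      (by fun_prop : Measurable fun p : ℝ × ℝ => ENNReal.ofReal (p.2 ^ 2)).aemeasurable,
      ← ofReal_integral_eq_lintegral_ofReal h3 (Eventually.of_forall fun p => sq_nonneg _)]
    exact ENNReal.ofReal_le_ofReal h4

/-- One direction of disintegration, without measurability of the integrand. -/
lemma lintegral_le_lintegral_condKernel {α Ω : Type*} [MeasurableSpace α] [MeasurableSpace Ω]
    [StandardBorelSpace Ω] [Nonempty Ω] (ρ : Measure (α × Ω)) [IsFiniteMeasure ρ]
    (F : α × Ω → ℝ≥0∞) :
    ∫⁻ z, F z ∂ρ ≤ ∫⁻ a, ∫⁻ ω, F (a, ω) ∂(ρ.condKernel a) ∂ρ.fst := by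
  obtain ⟨G, mG, hGF, hG⟩ := exists_measurable_le_lintegral_eq ρ F
  rw [hG, ← Measure.lintegral_condKernel mG]
  exact lintegral_mono fun a => lintegral_mono fun ω => hGF _

lemma lintegral_le_lintegral_condKernel_swap (μ : Measure (ℝ × ℝ)) [IsFiniteMeasure μ]
    (F : ℝ × ℝ → ℝ≥0∞) :
    ∫⁻ p, F p ∂μ ≤ ∫⁻ y, ∫⁻ x, F (x, y) ∂((μ.map Prod.swap).condKernel y)
      ∂(μ.map Prod.swap).fst := by
  have h : ∫⁻ p, F p ∂μ = ∫⁻ q, F q.swap ∂(μ.map Prod.swap) := by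
    have := lintegral_map_equiv (μ := μ) (fun q : ℝ × ℝ => F q.swap)
      (MeasurableEquiv.prodComm (α := ℝ) (β := ℝ))
    exact this.symm
  rw [h]
  exact lintegral_le_lintegral_condKernel (μ.map Prod.swap) fun q => F q.swap

lemma lintegral_condKernel_swap (μ : Measure (ℝ × ℝ)) [IsFiniteMeasure μ]
    {F : ℝ × ℝ → ℝ≥0∞} (hF : Measurable F) :
    ∫⁻ y, ∫⁻ x, F (x, y) ∂((μ.map Prod.swap).condKernel y) ∂(μ.map Prod.swap).fst =
      ∫⁻ p, F p ∂μ := by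
  have h := Measure.lintegral_condKernel (ρ := μ.map Prod.swap) (f := fun q : ℝ × ℝ => F q.swap)
    (hF.comp measurable_swap)
  simp only [Prod.swap_prod_mk] at h
  have hs : Measurable fun q : ℝ × ℝ => F q.swap := hF.comp measurable_swap
  rw [h, lintegral_map hs measurable_swap]
  simp

lemma ofReal_add_sq_le (x y : ℝ) : ENNReal.ofReal ((x + y) ^ 2) ≤
    2 * ENNReal.ofReal (x ^ 2) + 2 * ENNReal.ofReal (y ^ 2) := by
  rw [show (2 : ℝ≥0∞) = ENNReal.ofReal 2 by norm_num, ← ENNReal.ofReal_mul (by norm_num),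
    ← ENNReal.ofReal_mul (by norm_num), ← ENNReal.ofReal_add (by positivity) (by positivity)]
  exact ENNReal.ofReal_le_ofReal (by nlinarith [sq_nonneg (x - y)])

/-- A crude bound for the average divergence variance against one family of mixtures. -/
lemma lintegral_divergenceVariance_le (μ : Measure (ℝ × ℝ)) [IsProbabilityMeasure μ]
    (ν : ℝ × ℝ → Measure ℝ) [∀ p, IsProbabilityMeasure (ν p)] (J : ℝ × ℝ → ℝ≥0∞)
    (hν : ∀ p, ∫⁻ x, ENNReal.ofReal (x ^ 2) ∂(ν p) ≤ J p) (hJ : Measurable J)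
    {M : ℝ≥0∞} (hJM : ∫⁻ p, J p ∂μ ≤ 2 * M)
    (hM : ∫⁻ p, ENNReal.ofReal (p.1 ^ 2) ∂μ + ∫⁻ p, ENNReal.ofReal (p.2 ^ 2) ∂μ ≤ M) :
    ∫⁻ p, divergenceVariance (gaussianReal (p.1 + p.2) 1) (gaussianMix (ν p)) ∂μ ≤
      ENNReal.ofReal (8 * gaussianFourthMoment + 4) * (1 + 4 * M) := by
  have m1 : Measurable fun p : ℝ × ℝ => ENNReal.ofReal (p.1 ^ 2) := by fun_prop
  have m2 : Measurable fun p : ℝ × ℝ => ENNReal.ofReal (p.2 ^ 2) := by fun_prop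
  calc _ ≤ ∫⁻ p, ENNReal.ofReal (8 * gaussianFourthMoment + 4) * (1 +
        (2 * ENNReal.ofReal (p.1 ^ 2) + 2 * ENNReal.ofReal (p.2 ^ 2)) + J p) ∂μ := by
        refine lintegral_mono fun p => (divergenceVariance_gaussianMix_le (ν p) _).trans ?_
        gcongr
        · exact ofReal_add_sq_le _ _
        · exact hν p
    _ = ENNReal.ofReal (8 * gaussianFourthMoment + 4) * (1 +
        (2 * ∫⁻ p, ENNReal.ofReal (p.1 ^ 2) ∂μ + 2 * ∫⁻ p, ENNReal.ofReal (p.2 ^ 2) ∂μ) +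
          ∫⁻ p, J p ∂μ) := by
        rw [lintegral_const_mul _ (by fun_prop), lintegral_add_right _ hJ,
          lintegral_add_left measurable_const, lintegral_add_left (by fun_prop),
          lintegral_const_mul _ m1, lintegral_const_mul _ m2]
        simp
    _ ≤ _ := by
        rw [← mul_add, show (4 : ℝ≥0∞) * M = 2 * M + 2 * M by ring, add_assoc]
        gcongr

/-- The pointwise bound is affine in second moments, so it averages over U. Conditional second
moments given one input integrate back to unconditional ones by disintegration. -/
theorem Vmax_gaussianMAC_lt_top (S₁ S₂ : ℝ) : (gaussianMAC S₁ S₂).Vmax < ∞ := by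
  set c := ENNReal.ofReal (8 * gaussianFourthMoment + 4)
  refine lt_of_le_of_lt (b := c * (1 + 4 * (ENNReal.ofReal S₁ + ENNReal.ofReal S₂))) ?_ ?_
  swap
  · exact ENNReal.mul_lt_top ENNReal.ofReal_lt_top (by simp [ENNReal.mul_lt_top])
  refine iSup₂_le fun P hP => ?_
  obtain ⟨hS1, hS2⟩ := meetsCost_gaussianMAC_lintegral hP
  have mf : Measurable fun u => ∫⁻ p, ENNReal.ofReal (p.1 ^ 2) ∂(P.PXY u) :=
    (by fun_prop : Measurable fun p : ℝ × ℝ => ENNReal.ofReal (p.1 ^ 2)).lintegral_kernel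
  have ms : Measurable fun u => ∫⁻ p, ENNReal.ofReal (p.2 ^ 2) ∂(P.PXY u) :=
    (by fun_prop : Measurable fun p : ℝ × ℝ => ENNReal.ofReal (p.2 ^ 2)).lintegral_kernel
  set M : P.𝒰 → ℝ≥0∞ := fun u => ∫⁻ p, ENNReal.ofReal (p.1 ^ 2) ∂(P.PXY u) +
    ∫⁻ p, ENNReal.ofReal (p.2 ^ 2) ∂(P.PXY u) with hM
  have fin : ∀ G : P.𝒰 → ℝ≥0∞, (∀ u, G u ≤ c * (1 + 4 * M u)) →
      ∫⁻ u, G u ∂P.PU ≤ c * (1 + 4 * (ENNReal.ofReal S₁ + ENNReal.ofReal S₂)) := by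
    intro G hG
    calc _ ≤ ∫⁻ u, c * (1 + 4 * M u) ∂P.PU := lintegral_mono hG
      _ = c * (1 + 4 * (∫⁻ u, ∫⁻ p, ENNReal.ofReal (p.1 ^ 2) ∂(P.PXY u) ∂P.PU +
          ∫⁻ u, ∫⁻ p, ENNReal.ofReal (p.2 ^ 2) ∂(P.PXY u) ∂P.PU)) := by
          have mM : Measurable M := mf.add ms
          rw [lintegral_const_mul _ (by fun_prop), lintegral_add_left measurable_const,
            lintegral_const_mul _ mM, hM, lintegral_add_left mf]
          simp
      _ ≤ _ := by gcongr
  have sumsq : ∀ μ : Measure (ℝ × ℝ), ∫⁻ p, (2 * ENNReal.ofReal (p.1 ^ 2) +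
      2 * ENNReal.ofReal (p.2 ^ 2)) ∂μ = 2 * (∫⁻ p, ENNReal.ofReal (p.1 ^ 2) ∂μ +
        ∫⁻ p, ENNReal.ofReal (p.2 ^ 2) ∂μ) := by
    intro μ
    rw [lintegral_add_left (by fun_prop), lintegral_const_mul _ (by fun_prop),
      lintegral_const_mul _ (by fun_prop), mul_add]
  refine max_le (fin _ fun u => ?_) (max_le (fin _ fun u => ?_) (fin _ fun u => ?_))
  · simp only [gaussianMAC_W_apply, outZ_gaussianMAC]
    have : IsProbabilityMeasure ((P.PXY u).map fun p => p.1 + p.2) :=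
      Measure.isProbabilityMeasure_map (by fun_prop)
    refine lintegral_divergenceVariance_le (P.PXY u) (fun _ => (P.PXY u).map fun p => p.1 + p.2)
      (fun _ => 2 * M u) (fun p => ?_) measurable_const (by simp) le_rfl
    rw [lintegral_map (by fun_prop) (by fun_prop), hM, ← sumsq]
    exact lintegral_mono fun p => ofReal_add_sq_le _ _
  · simp only [gaussianMAC_W_apply, outZGivenY_gaussianMAC]
    have : ∀ p : ℝ × ℝ, IsProbabilityMeasure
        ((((P.PXY u).map Prod.swap).condKernel p.2).map fun x => x + p.2) :=
      fun p => Measure.isProbabilityMeasure_map (by fun_prop)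
    have mK : Measurable fun y => ∫⁻ x, (2 * ENNReal.ofReal (x ^ 2) + 2 * ENNReal.ofReal (y ^ 2))
        ∂(((P.PXY u).map Prod.swap).condKernel y) :=
      Measurable.lintegral_kernel_prod_right (f := fun y x => 2 * ENNReal.ofReal (x ^ 2) +
        2 * ENNReal.ofReal (y ^ 2)) (by simp only [Function.uncurry_def]; fun_prop)
    refine lintegral_divergenceVariance_le (P.PXY u)
      (fun p => (((P.PXY u).map Prod.swap).condKernel p.2).map fun x => x + p.2)
      (fun p => ∫⁻ x, (2 * ENNReal.ofReal (x ^ 2) + 2 * ENNReal.ofReal (p.2 ^ 2))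
        ∂(((P.PXY u).map Prod.swap).condKernel p.2)) (fun p => ?_) (mK.comp measurable_snd)
      ?_ le_rfl
    · rw [lintegral_map (by fun_prop) (by fun_prop)]
      exact lintegral_mono fun x => ofReal_add_sq_le _ _
    · refine (lintegral_le_lintegral_condKernel_swap _ _).trans ?_
      simp only [lintegral_const, measure_univ, mul_one]
      rw [lintegral_condKernel_swap (P.PXY u) (F := fun p => 2 * ENNReal.ofReal (p.1 ^ 2) +
        2 * ENNReal.ofReal (p.2 ^ 2)) (by fun_prop), sumsq]
  · simp only [gaussianMAC_W_apply, outZGivenX_gaussianMAC]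
    have : ∀ p : ℝ × ℝ, IsProbabilityMeasure
        (((P.PXY u).condKernel p.1).map fun y => p.1 + y) :=
      fun p => Measure.isProbabilityMeasure_map (by fun_prop)
    have mK : Measurable fun x => ∫⁻ y, (2 * ENNReal.ofReal (x ^ 2) + 2 * ENNReal.ofReal (y ^ 2))
        ∂((P.PXY u).condKernel x) :=
      Measurable.lintegral_kernel_prod_right (f := fun x y => 2 * ENNReal.ofReal (x ^ 2) +
        2 * ENNReal.ofReal (y ^ 2)) (by simp only [Function.uncurry_def]; fun_prop)
    refine lintegral_divergenceVariance_le (P.PXY u)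
      (fun p => ((P.PXY u).condKernel p.1).map fun y => p.1 + y)
      (fun p => ∫⁻ y, (2 * ENNReal.ofReal (p.1 ^ 2) + 2 * ENNReal.ofReal (y ^ 2))
        ∂((P.PXY u).condKernel p.1)) (fun p => ?_) (mK.comp measurable_fst)
      ?_ le_rfl
    · rw [lintegral_map (by fun_prop) (by fun_prop)]
      exact lintegral_mono fun x => ofReal_add_sq_le _ _
    · refine (lintegral_le_lintegral_condKernel _ _).trans ?_
      simp only [lintegral_const, measure_univ, mul_one]
      rw [Measure.lintegral_condKernel (f := fun p : ℝ × ℝ => 2 * ENNReal.ofReal (p.1 ^ 2) +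
        2 * ENNReal.ofReal (p.2 ^ 2)) (by fun_prop), sumsq]

end Outputs

end

noncomputable section

/-! ### Normal trial laws and the tangent to the capacity. -/

section GaussianInformation

open InformationTheory

lemma measurable_klDiv_gaussianMix {ν : Measure ℝ} [IsProbabilityMeasure ν]
    (h2 : Integrable (fun s => s ^ 2) ν) :
    Measurable fun s => klDiv (gaussianReal s 1) (gaussianMix ν) := by
  have h : (fun s => klDiv (gaussianReal s 1) (gaussianMix ν)) = fun s =>
      (∫⁻ z, ENNReal.ofReal (mixPotential ν z) ∂(gaussianReal s 1)) - ENNReal.ofReal (1 / 2) := by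
    ext s
    rw [← klDiv_gaussianMix_add_half h2, ENNReal.add_sub_cancel_right ENNReal.ofReal_ne_top]
  rw [h]
  let κ : Kernel ℝ ℝ := ⟨fun s => gaussianReal s 1, measurable_gaussianReal_one⟩
  have := (measurable_mixPotential ν).ennreal_ofReal.lintegral_kernel (κ := κ)
  exact this.sub measurable_const

/-- The quadratic potential of a normal law. -/
def gaussianPotential (a τ z : ℝ) : ℝ := (z - a) ^ 2 / (2 * τ) + Real.log (2 * Real.pi * τ) / 2

lemma exp_neg_gaussianPotential {τ : ℝ} (hτ : 0 < τ) (a z : ℝ) :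
    Real.exp (-gaussianPotential a τ z) = gaussianPDFReal a τ.toNNReal z := by
  have h : (√(2 * Real.pi * τ))⁻¹ = Real.exp (-(Real.log (2 * Real.pi * τ) / 2)) := by
    rw [Real.exp_neg, ← Real.log_sqrt (by positivity), Real.exp_log (by positivity)]
  rw [gaussianPDFReal, Real.coe_toNNReal _ hτ.le, h, ← Real.exp_add, gaussianPotential]
  congr 1; ring

/-- Cross entropy with the trial law of mean a and variance τ. Both parameters stay free, since
different regimes call for different choices. -/
lemma lintegral_klDiv_gaussianMix_le_gaussian {ν : Measure ℝ} [IsProbabilityMeasure ν]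
    (h2 : Integrable (fun s => s ^ 2) ν) {τ : ℝ} (hτ : 0 < τ) (a : ℝ) :
    ∫⁻ s, klDiv (gaussianReal s 1) (gaussianMix ν) ∂ν ≤
      ENNReal.ofReal (Real.log τ / 2 + (1 + ∫ s, (s - a) ^ 2 ∂ν) / (2 * τ) - 1 / 2) := by
  obtain ⟨i2, e2⟩ := integrable_sub_sq_gaussianMix h2 a
  have hL1 : ∫⁻ z, ENNReal.ofReal (Real.exp (-gaussianPotential a τ z)) ≤ 1 := by
    simp_rw [exp_neg_gaussianPotential hτ]
    exact (lintegral_gaussianPDFReal_eq_one a (by simpa using hτ)).le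
  have hLi : Integrable (gaussianPotential a τ) (gaussianMix ν) :=
    (i2.div_const _).add (integrable_const _)
  refine (lintegral_klDiv_gaussianMix_le h2 (by unfold gaussianPotential; fun_prop) hL1 hLi).trans ?_
  refine ENNReal.ofReal_le_ofReal (le_of_eq ?_)
  unfold gaussianPotential
  rw [integral_add (i2.div_const _) (integrable_const _), integral_div, e2,
    Real.log_mul (by positivity) hτ.ne']
  simp
  ring

/-- `½ log (1 + S) - S / (2 (1 + S))`, the intercept of the tangent to the capacity at `S`. -/
def capIntercept (S : ℝ) : ℝ := Real.log (1 + S) / 2 - S / (2 * (1 + S))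

lemma capIntercept_nonneg {S : ℝ} (hS : 0 ≤ S) : 0 ≤ capIntercept S := by
  have h := Real.log_le_sub_one_of_pos (show 0 < (1 + S)⁻¹ by positivity)
  rw [Real.log_inv] at h
  have e : (1 + S)⁻¹ - 1 = -(S / (1 + S)) := by field_simp; ring
  rw [e] at h
  unfold capIntercept
  rw [mul_comm 2 (1 + S), ← div_div]
  linarith

lemma ofReal_capIntercept_add {S : ℝ} (hS : 0 ≤ S) :
    ENNReal.ofReal (capIntercept S) + ENNReal.ofReal (1 / (2 * (1 + S))) * ENNReal.ofReal S =
      ENNReal.ofReal (Real.log (1 + S) / 2) := by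
  rw [← ENNReal.ofReal_mul (by positivity), ← ENNReal.ofReal_add (capIntercept_nonneg hS)
    (by positivity)]
  congr 1; unfold capIntercept; ring

/-- The trial variance 1+S makes the bound affine in the second moment, namely the tangent at S to
the capacity function. Affine bounds can be averaged over U and over conditional laws, which takes
the place of concavity of the logarithm. -/
lemma lintegral_klDiv_gaussianMix_le_capIntercept (ν : Measure ℝ) [IsProbabilityMeasure ν]
    {S : ℝ} (hS : 0 ≤ S) (a : ℝ) :
    ∫⁻ s, klDiv (gaussianReal s 1) (gaussianMix ν) ∂ν ≤ ENNReal.ofReal (capIntercept S) +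
      ENNReal.ofReal (1 / (2 * (1 + S))) * ∫⁻ s, ENNReal.ofReal ((s - a) ^ 2) ∂ν := by
  by_cases htop : ∫⁻ s, ENNReal.ofReal ((s - a) ^ 2) ∂ν = ∞
  · rw [htop, ENNReal.mul_top (by simpa using by positivity), add_top]; exact le_top
  have ha : Integrable (fun s => (s - a) ^ 2) ν := by
    refine ⟨by fun_prop, ?_⟩
    rw [hasFiniteIntegral_iff_ofReal (Eventually.of_forall fun z => sq_nonneg _)]
    exact lt_top_iff_ne_top.2 htop
  have hm : MemLp (fun s : ℝ => s - a) 2 ν := (memLp_two_iff_integrable_sq (by fun_prop)).2 ha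
  have h2 : Integrable (fun s : ℝ => s ^ 2) ν :=
    (memLp_two_iff_integrable_sq (by fun_prop)).1
      ((hm.add (memLp_const a)).ae_eq (Eventually.of_forall fun s => by simp))
  refine (lintegral_klDiv_gaussianMix_le_gaussian h2 (τ := 1 + S) (by linarith) a).trans ?_
  have i0 : 0 ≤ ∫ s, (s - a) ^ 2 ∂ν := integral_nonneg fun x => sq_nonneg _
  rw [← ofReal_integral_eq_lintegral_ofReal ha (Eventually.of_forall fun z => sq_nonneg _),
    ← ENNReal.ofReal_mul (by positivity),
    ← ENNReal.ofReal_add (capIntercept_nonneg hS) (by positivity)]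
  refine ENNReal.ofReal_le_ofReal (le_of_eq ?_)
  unfold capIntercept
  field_simp
  ring

/-- Given Y = y the trial law is centred at y, so that only X² is left. No independence of X and Y
is involved, hence no loss in δ for this term. -/
lemma infoX_integrand_le (S₁ S₂ : ℝ) (μ : Measure (ℝ × ℝ)) [IsProbabilityMeasure μ] {S : ℝ}
    (hS : 0 ≤ S) :
    ∫⁻ p, klDiv ((gaussianMAC S₁ S₂).W p) ((gaussianMAC S₁ S₂).outZGivenY μ p.2) ∂μ ≤
      ENNReal.ofReal (capIntercept S) +
        ENNReal.ofReal (1 / (2 * (1 + S))) * ∫⁻ p, ENNReal.ofReal (p.1 ^ 2) ∂μ := by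
  have : IsProbabilityMeasure (μ.map Prod.swap) :=
    Measure.isProbabilityMeasure_map measurable_swap.aemeasurable
  refine (lintegral_le_lintegral_condKernel_swap μ _).trans ?_
  simp only [gaussianMAC_W_apply, outZGivenY_gaussianMAC]
  set K := (μ.map Prod.swap).condKernel
  have key : ∀ y, ∫⁻ x, klDiv (gaussianReal (x + y) 1) (gaussianMix ((K y).map fun x => x + y))
      ∂(K y) ≤ ENNReal.ofReal (capIntercept S) +
        ENNReal.ofReal (1 / (2 * (1 + S))) * ∫⁻ x, ENNReal.ofReal (x ^ 2) ∂(K y) := by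
    intro y
    have : IsProbabilityMeasure ((K y).map fun x => x + y) :=
      Measure.isProbabilityMeasure_map (by fun_prop)
    have h := lintegral_klDiv_gaussianMix_le_capIntercept ((K y).map fun x => x + y) hS y
    have e := lintegral_map_equiv (μ := K y) (fun s : ℝ => klDiv (gaussianReal s 1)
      (gaussianMix ((K y).map fun x => x + y))) (MeasurableEquiv.addRight y)
    simp only [MeasurableEquiv.coe_addRight] at e
    rw [e, lintegral_map (by fun_prop) (by fun_prop)] at h
    simpa using h
  refine (lintegral_mono key).trans ?_
  have mx : Measurable fun p : ℝ × ℝ => ENNReal.ofReal (p.1 ^ 2) := by fun_prop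
  have mK : Measurable fun y => ∫⁻ x, ENNReal.ofReal (x ^ 2) ∂(K y) :=
    (by fun_prop : Measurable fun x : ℝ => ENNReal.ofReal (x ^ 2)).lintegral_kernel
  rw [lintegral_add_left measurable_const, lintegral_const_mul _ mK,
    lintegral_condKernel_swap μ mx]
  simp

lemma infoY_integrand_le (S₁ S₂ : ℝ) (μ : Measure (ℝ × ℝ)) [IsProbabilityMeasure μ] {S : ℝ}
    (hS : 0 ≤ S) :
    ∫⁻ p, klDiv ((gaussianMAC S₁ S₂).W p) ((gaussianMAC S₁ S₂).outZGivenX μ p.1) ∂μ ≤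
      ENNReal.ofReal (capIntercept S) +
        ENNReal.ofReal (1 / (2 * (1 + S))) * ∫⁻ p, ENNReal.ofReal (p.2 ^ 2) ∂μ := by
  refine (lintegral_le_lintegral_condKernel μ _).trans ?_
  simp only [gaussianMAC_W_apply, outZGivenX_gaussianMAC]
  set K := μ.condKernel
  have key : ∀ x, ∫⁻ y, klDiv (gaussianReal (x + y) 1) (gaussianMix ((K x).map fun y => x + y))
      ∂(K x) ≤ ENNReal.ofReal (capIntercept S) +
        ENNReal.ofReal (1 / (2 * (1 + S))) * ∫⁻ y, ENNReal.ofReal (y ^ 2) ∂(K x) := by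
    intro x
    have : IsProbabilityMeasure ((K x).map fun y => x + y) :=
      Measure.isProbabilityMeasure_map (by fun_prop)
    have h := lintegral_klDiv_gaussianMix_le_capIntercept ((K x).map fun y => x + y) hS x
    have e := lintegral_map_equiv (μ := K x) (fun s : ℝ => klDiv (gaussianReal s 1)
      (gaussianMix ((K x).map fun y => x + y))) (MeasurableEquiv.addLeft x)
    simp only [MeasurableEquiv.coe_addLeft] at e
    rw [e, lintegral_map (by fun_prop) (by fun_prop)] at h
    simpa using h
  refine (lintegral_mono key).trans ?_
  have mx : Measurable fun p : ℝ × ℝ => ENNReal.ofReal (p.2 ^ 2) := by fun_prop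
  have mK : Measurable fun y => ∫⁻ x, ENNReal.ofReal (x ^ 2) ∂(K y) :=
    (by fun_prop : Measurable fun x : ℝ => ENNReal.ofReal (x ^ 2)).lintegral_kernel
  rw [lintegral_add_left measurable_const, lintegral_const_mul _ mK,
    Measure.lintegral_condKernel mx]
  simp

lemma infoX_gaussianMAC_le {S₁ S₂ : ℝ} (hS₁ : 0 ≤ S₁) {P : InputLaw ℝ ℝ}
    (hP : (gaussianMAC S₁ S₂).MeetsCost P) :
    (gaussianMAC S₁ S₂).infoX P ≤ ENNReal.ofReal (Real.log (1 + S₁) / 2) := by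
  rw [← ofReal_capIntercept_add hS₁]
  refine (lintegral_mono fun u => infoX_integrand_le S₁ S₂ (P.PXY u) hS₁).trans ?_
  have mf : Measurable fun u => ∫⁻ p, ENNReal.ofReal (p.1 ^ 2) ∂(P.PXY u) :=
    (by fun_prop : Measurable fun p : ℝ × ℝ => ENNReal.ofReal (p.1 ^ 2)).lintegral_kernel
  rw [lintegral_add_left measurable_const, lintegral_const_mul _ mf]
  simp only [lintegral_const, measure_univ, mul_one]
  gcongr
  exact (meetsCost_gaussianMAC_lintegral hP).1

lemma infoY_gaussianMAC_le {S₁ S₂ : ℝ} (hS₂ : 0 ≤ S₂) {P : InputLaw ℝ ℝ}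
    (hP : (gaussianMAC S₁ S₂).MeetsCost P) :
    (gaussianMAC S₁ S₂).infoY P ≤ ENNReal.ofReal (Real.log (1 + S₂) / 2) := by
  rw [← ofReal_capIntercept_add hS₂]
  refine (lintegral_mono fun u => infoY_integrand_le S₁ S₂ (P.PXY u) hS₂).trans ?_
  have mf : Measurable fun u => ∫⁻ p, ENNReal.ofReal (p.2 ^ 2) ∂(P.PXY u) :=
    (by fun_prop : Measurable fun p : ℝ × ℝ => ENNReal.ofReal (p.2 ^ 2)).lintegral_kernel
  rw [lintegral_add_left measurable_const, lintegral_const_mul _ mf]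
  simp only [lintegral_const, measure_univ, mul_one]
  gcongr
  exact (meetsCost_gaussianMAC_lintegral hP).2

end GaussianInformation

/-! ### Independent normal inputs and the lower bound at δ = 0. -/

section GaussianInput

open InformationTheory

lemma gaussianMix_gaussianReal (a : ℝ) (v : ℝ≥0) :
    gaussianMix (gaussianReal a v) = gaussianReal a (v + 1) := by
  rw [gaussianMix_eq_map]
  have := gaussianReal_conv_gaussianReal (m₁ := a) (m₂ := 0) (v₁ := v) (v₂ := 1)
  rw [add_zero] at this
  exact this

lemma klDiv_gaussianReal (s a : ℝ) {τ : ℝ≥0} (hτ : τ ≠ 0) :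
    klDiv (gaussianReal s 1) (gaussianReal a τ) =
      ENNReal.ofReal (Real.log τ / 2 + (1 + (s - a) ^ 2) / (2 * τ) - 1 / 2) := by
  have hτ0 : (0 : ℝ) < τ := by positivity
  obtain ⟨h1, h2⟩ := llr_withDensity_ofReal (measurable_gaussianPDFReal s 1)
    (measurable_gaussianPDFReal a τ) (fun x => gaussianPDFReal_pos s 1 x one_ne_zero)
    (fun x => gaussianPDFReal_pos a τ x hτ) (gaussianReal_of_var_ne_zero s one_ne_zero)
    (gaussianReal_of_var_ne_zero a hτ)
  have h3 : llr (gaussianReal s 1) (gaussianReal a τ) =ᵐ[gaussianReal s 1] fun z =>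
      (z - a) ^ 2 / (2 * τ) - (z - s) ^ 2 / 2 + Real.log τ / 2 := by
    refine h2.trans (Eventually.of_forall fun z => ?_)
    have e := exp_neg_gaussianPotential hτ0 a z
    rw [Real.toNNReal_coe] at e
    simp only [log_gaussianPDFReal_one, ← e, Real.log_exp, gaussianPotential,
      Real.log_mul (show (2 * Real.pi) ≠ 0 by positivity) hτ0.ne']
    ring
  have i1 := (integrable_sub_pow_gaussianReal s a 1 2).div_const (2 * τ : ℝ)
  have i2 := (integrable_sub_pow_gaussianReal s s 1 2).div_const (2 : ℝ)
  have i12 : Integrable (fun z => (z - a) ^ 2 / (2 * τ) - (z - s) ^ 2 / 2) (gaussianReal s 1) :=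
    i1.sub i2
  rw [klDiv_of_ac_of_integrable h1 ((i12.add (integrable_const _)).congr h3.symm),
    integral_congr_ae h3, integral_add i12 (integrable_const _), integral_sub i1 i2, integral_div,
    integral_div, integral_sub_sq_gaussianReal, integral_sub_sq_gaussianReal]
  simp
  congr 1; ring

lemma lintegral_klDiv_gaussianReal (a : ℝ) (v : ℝ≥0) :
    ∫⁻ s, klDiv (gaussianReal s 1) (gaussianReal a (v + 1)) ∂(gaussianReal a v) =
      ENNReal.ofReal (Real.log (1 + v) / 2) := by
  have hv : v + 1 ≠ 0 := by positivity
  simp_rw [klDiv_gaussianReal _ a hv]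
  have hc := capIntercept_nonneg (S := v) v.2
  have e : ∀ s : ℝ, Real.log ((v + 1 : ℝ≥0) : ℝ) / 2 +
      (1 + (s - a) ^ 2) / (2 * ((v + 1 : ℝ≥0) : ℝ)) - 1 / 2 =
      capIntercept v + (1 / (2 * (1 + v))) * (s - a) ^ 2 := by
    intro s
    unfold capIntercept
    push_cast
    rw [add_comm (v : ℝ) 1]
    have : (0 : ℝ) < 1 + v := by positivity
    field_simp
    ring
  simp_rw [e]
  have i2 := (integrable_sub_pow_gaussianReal a a v 2).const_mul (1 / (2 * (1 + (v : ℝ))))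
  have ic : Integrable (fun s => capIntercept v + (1 / (2 * (1 + (v : ℝ)))) * (s - a) ^ 2)
    (gaussianReal a v) := (integrable_const _).add i2
  rw [← ofReal_integral_eq_lintegral_ofReal ic
    (Eventually.of_forall fun s => by positivity), integral_add (integrable_const _) i2,
    integral_const_mul, integral_sub_sq_gaussianReal]
  congr 1
  rw [integral_const, probReal_univ, one_smul, sub_self, capIntercept]
  ring

/-- Independent normal inputs with the given powers. -/
def gaussianInput (v₁ v₂ : ℝ≥0) : InputLaw ℝ ℝ where
  𝒰 := Unit
  mU := inferInstance
  PU := Measure.dirac ()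
  prob := inferInstance
  PXY := Kernel.const Unit ((gaussianReal 0 v₁).prod (gaussianReal 0 v₂))
  markov := inferInstance

lemma gaussianInput_meetsCost (v₁ v₂ : ℝ≥0) :
    (gaussianMAC v₁ v₂).MeetsCost (gaussianInput v₁ v₂) := by
  have hb : (gaussianInput v₁ v₂).PU.bind (gaussianInput v₁ v₂).PXY =
      (gaussianReal 0 v₁).prod (gaussianReal 0 v₂) := by
    change (Measure.dirac ()).bind (Kernel.const Unit _) = _
    rw [Measure.dirac_bind (Kernel.measurable _)]
    simp
  unfold MAC.MeetsCost
  rw [hb]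
  change (Integrable (fun p : ℝ × ℝ => p.1 ^ 2) _ ∧ ∫ p : ℝ × ℝ, p.1 ^ 2 ∂_ ≤ (v₁ : ℝ)) ∧
    (Integrable (fun p : ℝ × ℝ => p.2 ^ 2) _ ∧ ∫ p : ℝ × ℝ, p.2 ^ 2 ∂_ ≤ (v₂ : ℝ))
  have i : ∀ v : ℝ≥0, Integrable (fun z : ℝ => z ^ 2) (gaussianReal 0 v) := fun v => by
    simpa using integrable_sub_pow_gaussianReal 0 0 v 2
  have e : ∀ v : ℝ≥0, ∫ z, z ^ 2 ∂(gaussianReal 0 v) = v := fun v => by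
    simpa using integral_sub_sq_gaussianReal 0 0 v
  refine ⟨⟨(i v₁).comp_fst _, le_of_eq ?_⟩, (i v₂).comp_snd _, le_of_eq ?_⟩
  · rw [integral_fun_fst (μ := gaussianReal 0 v₁) (ν := gaussianReal 0 v₂) (fun z : ℝ => z ^ 2), e]
    simp
  · rw [integral_fun_snd (μ := gaussianReal 0 v₁) (ν := gaussianReal 0 v₂) (fun z : ℝ => z ^ 2), e]
    simp

lemma wringingDependence_prod {𝒳 𝒴 : Type} [MeasurableSpace 𝒳] [MeasurableSpace 𝒴]
    (μ : Measure 𝒳) (ν : Measure 𝒴) [IsProbabilityMeasure μ] [IsProbabilityMeasure ν] :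
    wringingDependence (μ.prod ν) = 0 := by
  rw [← nonpos_iff_eq_zero]
  refine iInf₂_le_of_le ⟨μ, inferInstance⟩ ⟨ν, inferInstance⟩ ?_
  refine iSup₂_le fun A _ => iSup₂_le fun B _ => iInf₂_le_of_le 0 ?_ (by simp)
  simp [Measure.prod_prod]

lemma infoXY_gaussianInput (v₁ v₂ : ℝ≥0) : (gaussianMAC v₁ v₂).infoXY (gaussianInput v₁ v₂) =
    ENNReal.ofReal (Real.log (1 + (v₁ + v₂)) / 2) := by
  have h : (gaussianMAC v₁ v₂).infoXY (gaussianInput v₁ v₂) =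
      ∫⁻ p, klDiv (gaussianReal (p.1 + p.2) 1) (gaussianMix
        (((gaussianReal 0 v₁).prod (gaussianReal 0 v₂)).map fun p => p.1 + p.2))
        ∂((gaussianReal 0 v₁).prod (gaussianReal 0 v₂)) := by
    unfold MAC.infoXY
    simp only [outZ_gaussianMAC, gaussianMAC_W_apply]
    change ∫⁻ u, _ ∂(Measure.dirac ()) = _
    rw [lintegral_dirac]
    rfl
  have hmap : ((gaussianReal 0 v₁).prod (gaussianReal 0 v₂)).map (fun p => p.1 + p.2) =
      gaussianReal 0 (v₁ + v₂) := by
    have := gaussianReal_conv_gaussianReal (m₁ := 0) (m₂ := 0) (v₁ := v₁) (v₂ := v₂)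
    rw [add_zero] at this
    exact this
  rw [h, hmap]
  have hm := measurable_klDiv_gaussianMix (ν := gaussianReal 0 (v₁ + v₂))
    (by simpa using integrable_sub_pow_gaussianReal 0 0 (v₁ + v₂) 2)
  rw [← lintegral_map (f := fun s => klDiv (gaussianReal s 1) (gaussianMix
    (gaussianReal 0 (v₁ + v₂)))) hm (by fun_prop : Measurable fun p : ℝ × ℝ => p.1 + p.2), hmap,
    gaussianMix_gaussianReal, lintegral_klDiv_gaussianReal]
  simp

lemma condKernel_prod_ae {α Ω : Type*} [MeasurableSpace α] [MeasurableSpace Ω]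
    [StandardBorelSpace Ω] [Nonempty Ω] (μ : Measure α) (ν : Measure Ω) [IsProbabilityMeasure μ]
    [IsProbabilityMeasure ν] {ρ : Measure (α × Ω)} [IsFiniteMeasure ρ] (hρ : ρ = μ.prod ν) :
    ∀ᵐ x ∂μ, ρ.condKernel x = ν := by
  subst hρ
  have h := eq_condKernel_of_measure_eq_compProd (ρ := μ.prod ν) (Kernel.const α ν) (by
    rw [Measure.compProd_const]; simp)
  simp only [Measure.fst_prod] at h
  filter_upwards [h] with x hx
  rw [← hx]; simp

lemma infoX_gaussianInput (v₁ v₂ : ℝ≥0) : (gaussianMAC v₁ v₂).infoX (gaussianInput v₁ v₂) =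
    ENNReal.ofReal (Real.log (1 + v₁) / 2) := by
  have h : (gaussianMAC v₁ v₂).infoX (gaussianInput v₁ v₂) =
      ∫⁻ p, klDiv (gaussianReal (p.1 + p.2) 1) (gaussianMix
        (((((gaussianReal 0 v₁).prod (gaussianReal 0 v₂)).map Prod.swap).condKernel p.2).map
          fun x => x + p.2)) ∂((gaussianReal 0 v₁).prod (gaussianReal 0 v₂)) := by
    unfold MAC.infoX
    simp only [outZGivenY_gaussianMAC, gaussianMAC_W_apply]
    change ∫⁻ u, _ ∂(Measure.dirac ()) = _
    rw [lintegral_dirac]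
    rfl
  rw [h]
  have hc := condKernel_prod_ae (gaussianReal 0 v₂) (gaussianReal 0 v₁)
    (Measure.prod_swap (μ := gaussianReal 0 v₁) (ν := gaussianReal 0 v₂))
  have hc' : ∀ᵐ p ∂((gaussianReal 0 v₁).prod (gaussianReal 0 v₂)),
      (((gaussianReal 0 v₁).prod (gaussianReal 0 v₂)).map Prod.swap).condKernel p.2 =
        gaussianReal 0 v₁ :=
    (Measure.quasiMeasurePreserving_snd (μ := gaussianReal 0 v₁)).ae hc
  have e : ∀ᵐ p ∂((gaussianReal 0 v₁).prod (gaussianReal 0 v₂)),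
      klDiv (gaussianReal (p.1 + p.2) 1) (gaussianMix
        (((((gaussianReal 0 v₁).prod (gaussianReal 0 v₂)).map Prod.swap).condKernel p.2).map
          fun x => x + p.2)) = klDiv (gaussianReal p.1 1) (gaussianReal 0 (v₁ + 1)) := by
    filter_upwards [hc'] with p hp
    rw [hp, gaussianReal_map_add_const, zero_add, gaussianMix_gaussianReal,
      klDiv_gaussianReal _ _ (by positivity), klDiv_gaussianReal _ _ (by positivity)]
    simp
  rw [lintegral_congr_ae e]
  have hm := measurable_klDiv_gaussianMix (ν := gaussianReal 0 v₁)
    (by simpa using integrable_sub_pow_gaussianReal 0 0 v₁ 2)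
  rw [gaussianMix_gaussianReal] at hm
  have hm' : Measurable fun p : ℝ × ℝ => klDiv (gaussianReal p.1 1) (gaussianReal 0 (v₁ + 1)) :=
    hm.comp measurable_fst
  rw [lintegral_prod _ hm'.aemeasurable]
  simp [lintegral_klDiv_gaussianReal]

lemma infoY_gaussianInput (v₁ v₂ : ℝ≥0) : (gaussianMAC v₁ v₂).infoY (gaussianInput v₁ v₂) =
    ENNReal.ofReal (Real.log (1 + v₂) / 2) := by
  have h : (gaussianMAC v₁ v₂).infoY (gaussianInput v₁ v₂) =
      ∫⁻ p, klDiv (gaussianReal (p.1 + p.2) 1) (gaussianMix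
        ((((gaussianReal 0 v₁).prod (gaussianReal 0 v₂)).condKernel p.1).map
          fun y => p.1 + y)) ∂((gaussianReal 0 v₁).prod (gaussianReal 0 v₂)) := by
    unfold MAC.infoY
    simp only [outZGivenX_gaussianMAC, gaussianMAC_W_apply]
    change ∫⁻ u, _ ∂(Measure.dirac ()) = _
    rw [lintegral_dirac]
    rfl
  rw [h]
  have hc := condKernel_prod_ae (gaussianReal 0 v₁) (gaussianReal 0 v₂) rfl
  have hc' : ∀ᵐ p ∂((gaussianReal 0 v₁).prod (gaussianReal 0 v₂)),
      ((gaussianReal 0 v₁).prod (gaussianReal 0 v₂)).condKernel p.1 = gaussianReal 0 v₂ :=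
    (Measure.quasiMeasurePreserving_fst (ν := gaussianReal 0 v₂)).ae hc
  have e : ∀ᵐ p ∂((gaussianReal 0 v₁).prod (gaussianReal 0 v₂)),
      klDiv (gaussianReal (p.1 + p.2) 1) (gaussianMix
        ((((gaussianReal 0 v₁).prod (gaussianReal 0 v₂)).condKernel p.1).map
          fun y => p.1 + y)) = klDiv (gaussianReal p.2 1) (gaussianReal 0 (v₂ + 1)) := by
    filter_upwards [hc'] with p hp
    rw [hp, gaussianReal_map_const_add, zero_add, gaussianMix_gaussianReal,
      klDiv_gaussianReal _ _ (by positivity), klDiv_gaussianReal _ _ (by positivity)]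
    simp
  rw [lintegral_congr_ae e]
  have hm := measurable_klDiv_gaussianMix (ν := gaussianReal 0 v₂)
    (by simpa using integrable_sub_pow_gaussianReal 0 0 v₂ 2)
  rw [gaussianMix_gaussianReal] at hm
  have hm' : Measurable fun p : ℝ × ℝ => klDiv (gaussianReal p.2 1) (gaussianReal 0 (v₂ + 1)) :=
    hm.comp measurable_snd
  rw [lintegral_prod _ hm'.aemeasurable]
  simp [lintegral_klDiv_gaussianReal]

/-- Independent normal inputs of full power have zero wringing dependence and reach all three
single-letter values at once. These equal the values of the tangent bounds, so differences at δ are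
measured from the right base point. -/
theorem le_weightedCapacity_zero {S₁ S₂ : ℝ} (hS₁ : 0 ≤ S₁) (hS₂ : 0 ≤ S₂) (α₁ α₂ : ℝ) :
    ENNReal.ofReal (min α₁ α₂) * ENNReal.ofReal (Real.log (1 + (S₁ + S₂)) / 2) +
      ENNReal.ofReal (α₁ - α₂) * ENNReal.ofReal (Real.log (1 + S₁) / 2) +
      ENNReal.ofReal (α₂ - α₁) * ENNReal.ofReal (Real.log (1 + S₂) / 2) ≤
    (gaussianMAC S₁ S₂).weightedCapacity α₁ α₂ 0 := by
  lift S₁ to ℝ≥0 using hS₁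
  lift S₂ to ℝ≥0 using hS₂
  rw [← infoXY_gaussianInput, ← infoX_gaussianInput S₁ S₂, ← infoY_gaussianInput S₁ S₂]
  refine le_iSup_of_le (gaussianInput S₁ S₂) (le_iSup₂_of_le (gaussianInput_meetsCost S₁ S₂) ?_
    le_rfl)
  intro u
  have : (gaussianInput S₁ S₂).PXY u = (gaussianReal 0 S₁).prod (gaussianReal 0 S₂) :=
    Kernel.const_apply _ _
  rw [this, wringingDependence_prod]
  simp

end GaussianInput

end

noncomputable section

/-! ### A penalty on heavy tails and the truncated moments it dominates. -/

section Penalty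

/-- `z² min (√|z|, R)`: it grows like `|z|^(5/2)` up to `R²` and quadratically beyond. -/
def penalty (R z : ℝ) : ℝ := z ^ 2 * min √|z| R

/-- The truncated moment function `min (|x|, R²) ^ (5/2)`. -/
def truncMoment (R x : ℝ) : ℝ := min √|x| R ^ 5

/-- Identifies the moment in the covariance bound, taken at the cut-off T = R², with an integer
power that is easier to compare with the penalty. -/
lemma min_rpow_eq_truncMoment {R : ℝ} (hR : 0 ≤ R) (x : ℝ) :
    min |x| (R ^ 2) ^ (5 / 2 : ℝ) = truncMoment R x := by
  have h : min |x| (R ^ 2) = min √|x| R ^ 2 := by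
    rcases le_total √|x| R with h | h
    · rw [min_eq_left h, Real.sq_sqrt (abs_nonneg x), min_eq_left]
      rw [← Real.sq_sqrt (abs_nonneg x)]; gcongr
    · rw [min_eq_right h, min_eq_right]
      rw [← Real.sq_sqrt (abs_nonneg x)]; gcongr
  have h0 : 0 ≤ min √|x| R := le_min (Real.sqrt_nonneg _) hR
  rw [h, ← Real.rpow_natCast (min √|x| R) 2, ← Real.rpow_mul h0, truncMoment,
    ← Real.rpow_natCast (min √|x| R) 5]
  norm_num

lemma measurable_penalty (R : ℝ) : Measurable (penalty R) := by unfold penalty; fun_prop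

lemma measurable_truncMoment (R : ℝ) : Measurable (truncMoment R) := by
  unfold truncMoment; fun_prop

lemma penalty_nonneg {R : ℝ} (hR : 0 ≤ R) (z : ℝ) : 0 ≤ penalty R z :=
  mul_nonneg (sq_nonneg z) (le_min (Real.sqrt_nonneg _) hR)

lemma penalty_le (R z : ℝ) : penalty R z ≤ R * z ^ 2 := by
  rw [mul_comm]; exact mul_le_mul_of_nonneg_left (min_le_right _ _) (sq_nonneg z)

lemma penalty_le_pow (R z : ℝ) : penalty R z ≤ z ^ 2 + z ^ 4 := by
  have h : √|z| ≤ 1 + z ^ 2 := by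
    rw [← sq_abs z]
    apply Real.sqrt_le_iff.2
    have := abs_nonneg z
    refine ⟨by positivity, ?_⟩
    nlinarith [sq_nonneg (|z| - 1), pow_nonneg this 4]
  calc penalty R z ≤ z ^ 2 * (1 + z ^ 2) :=
        mul_le_mul_of_nonneg_left ((min_le_left _ _).trans h) (sq_nonneg z)
    _ = _ := by ring

lemma truncMoment_nonneg {R : ℝ} (hR : 0 ≤ R) (x : ℝ) : 0 ≤ truncMoment R x :=
  pow_nonneg (le_min (Real.sqrt_nonneg _) hR) 5

lemma truncMoment_le {R : ℝ} (hR : 0 ≤ R) (x : ℝ) : truncMoment R x ≤ R ^ 5 :=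
  pow_le_pow_left₀ (le_min (Real.sqrt_nonneg _) hR) (min_le_right _ _) 5

/-- With t = min(√|x|, R), the hypothesis gives t⁴/4 ≤ z² and t/2 ≤ min(√|z|, R). Their product is
t⁵/8 ≤ `penalty R z`. -/
lemma truncMoment_le_penalty {R : ℝ} (hR : 0 ≤ R) {x z : ℝ} (h : |x| / 2 ≤ |z|) :
    truncMoment R x / 8 ≤ penalty R z := by
  set t := min √|x| R with ht
  have ht0 : 0 ≤ t := le_min (Real.sqrt_nonneg _) hR
  have h1 : t ^ 4 / 4 ≤ z ^ 2 := by
    have : t ^ 2 ≤ |x| := by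
      rw [← Real.sq_sqrt (abs_nonneg x)]; gcongr; exact min_le_left _ _
    rw [← sq_abs z]
    nlinarith [sq_nonneg t, abs_nonneg z]
  have h2 : t / 2 ≤ min √|z| R := by
    refine le_min ?_ ?_
    · apply Real.le_sqrt_of_sq_le
      have : t ^ 2 ≤ |x| := by
        rw [← Real.sq_sqrt (abs_nonneg x)]; gcongr; exact min_le_left _ _
      nlinarith
    · have : t ≤ R := min_le_right _ _
      linarith
  calc truncMoment R x / 8 = (t ^ 4 / 4) * (t / 2) := by unfold truncMoment; rw [← ht]; ring
    _ ≤ _ := mul_le_mul h1 h2 (by positivity) (sq_nonneg z)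

/-- If rectangles over `B` have at most half their marginal mass, up to `η`, then so do integrals
over `B` of bounded functions. -/
lemma setIntegral_le_half {Ω : Type*} [MeasurableSpace Ω] {μ : Measure Ω} [IsProbabilityMeasure μ]
    {ψ : Ω → ℝ} (hψ : Measurable ψ) (hψ0 : 0 ≤ ψ) {M η : ℝ} (hM : 0 ≤ M) (hη : 0 ≤ η)
    (hψM : ∀ ω, ψ ω ≤ M) {B : Set Ω}
    (h : ∀ t, μ.real ({ω | t < ψ ω} ∩ B) ≤ μ.real {ω | t < ψ ω} / 2 + η) :
    ∫ ω in B, ψ ω ∂μ ≤ (∫ ω, ψ ω ∂μ) / 2 + η * M := by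
  have hInt : Integrable ψ μ := Integrable.of_bound (C := M) hψ.aestronglyMeasurable
    (Eventually.of_forall fun ω => by rw [Real.norm_of_nonneg (hψ0 ω)]; exact hψM ω)
  have h1 : ∫⁻ ω in B, ENNReal.ofReal (ψ ω) ∂μ ≤
      ENNReal.ofReal (1 / 2) * ∫⁻ ω, ENNReal.ofReal (ψ ω) ∂μ + ENNReal.ofReal (η * M) := by
    rw [lintegral_eq_lintegral_meas_lt _ (Eventually.of_forall hψ0) hψ.aemeasurable,
      lintegral_eq_lintegral_meas_lt _ (Eventually.of_forall hψ0) hψ.aemeasurable,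
      ← lintegral_const_mul' _ _ ENNReal.ofReal_ne_top]
    have hD : Measurable ((Set.Iio M).indicator fun _ : ℝ => ENNReal.ofReal η) :=
      measurable_const.indicator measurableSet_Iio
    calc _ ≤ ∫⁻ t in Set.Ioi 0, (ENNReal.ofReal (1 / 2) * μ {ω | t < ψ ω} +
          (Set.Iio M).indicator (fun _ : ℝ => ENNReal.ofReal η) t) := by
          refine setLIntegral_mono' measurableSet_Ioi fun t _ => ?_
          rw [Measure.restrict_apply (measurableSet_lt measurable_const hψ)]
          by_cases ht : t < M
          · rw [Set.indicator_of_mem (show t ∈ Set.Iio M from ht), ← ofReal_measureReal,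
              ← ofReal_measureReal (s := {ω | t < ψ ω}), ← ENNReal.ofReal_mul (by norm_num),
              ← ENNReal.ofReal_add (by positivity) hη]
            exact ENNReal.ofReal_le_ofReal (by linarith [h t])
          · have : {ω | t < ψ ω} = ∅ := by
              ext ω; simp only [Set.mem_ofPred_eq, Set.mem_empty_iff_false, iff_false, not_lt]
              exact (hψM ω).trans (not_lt.1 ht)
            rw [this]; simp
      _ = _ := by
          rw [lintegral_add_right _ hD, setLIntegral_indicator measurableSet_Iio,
            Set.inter_comm, Set.Ioi_inter_Iio]
          simp [ENNReal.ofReal_mul hη]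
  rw [← ofReal_integral_eq_lintegral_ofReal hInt.integrableOn (Eventually.of_forall hψ0),
    ← ofReal_integral_eq_lintegral_ofReal hInt (Eventually.of_forall hψ0),
    ← ENNReal.ofReal_mul (by norm_num)] at h1
  have i0 : 0 ≤ ∫ ω, ψ ω ∂μ := integral_nonneg hψ0
  rw [← ENNReal.ofReal_add (by positivity) (by positivity),
    ENNReal.ofReal_le_ofReal_iff (by positivity)] at h1
  linarith

variable {𝒳 𝒴 : Type} [MeasurableSpace 𝒳] [MeasurableSpace 𝒴]

/-- The product of the marginals contributes at most a quarter of the mass of A. The weighted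
arithmetic-geometric inequality splits the error 20δ p^(7/8) into less than another quarter of p and
a term of order δ^8. So conditioning on the complement of B cannot lose most of a function of the
first coordinate. -/
lemma Wrung.real_prod_le_half {δ : ℝ} {μ : Measure (𝒳 × 𝒴)} [IsProbabilityMeasure μ]
    (h : Wrung δ μ) (hδ : 0 ≤ δ) (hδ1 : δ ≤ 1 / 15) {A : Set 𝒳} {B : Set 𝒴}
    (hA : MeasurableSet A) (hB : MeasurableSet B) (hq : μ.real (Set.univ ×ˢ B) ≤ 1 / 4) :
    μ.real (A ×ˢ B) ≤ μ.real (A ×ˢ Set.univ) / 2 + (80 * δ) ^ 8 := by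
  have h1 := h.real_prod_le_add_left hδ hδ1 hA hB
  set p := μ.real (A ×ˢ (Set.univ : Set 𝒴))
  have hp0 : 0 ≤ p := measureReal_nonneg
  have hy := Real.geom_mean_le_arith_mean2_weighted (w₁ := 7 / 8) (w₂ := 1 / 8)
        (p₁ := p / 4) (p₂ := (80 * δ) ^ 8) (by norm_num) (by norm_num) (by positivity)
        (by positivity) (by norm_num)
  have e2 : ((80 * δ) ^ 8) ^ (1 / 8 : ℝ) = 80 * δ := by
    rw [← Real.rpow_natCast, ← Real.rpow_mul (by positivity)]; norm_num
  have e1 : p ^ (7 / 8 : ℝ) / 4 ≤ (p / 4) ^ (7 / 8 : ℝ) := by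
    rw [Real.div_rpow hp0 (by norm_num)]
    have : (4 : ℝ) ^ (7 / 8 : ℝ) ≤ 4 := by
      calc (4 : ℝ) ^ (7 / 8 : ℝ) ≤ (4 : ℝ) ^ (1 : ℝ) :=
            Real.rpow_le_rpow_of_exponent_le (by norm_num) (by norm_num)
        _ = 4 := Real.rpow_one _
    exact div_le_div_of_nonneg_left (by positivity) (by positivity) this
  rw [e2] at hy
  have h3 : 20 * δ * p ^ (7 / 8 : ℝ) ≤ (p / 4) ^ (7 / 8 : ℝ) * (80 * δ) := by nlinarith
  have h4 : 0 ≤ (80 * δ) ^ 8 := by positivity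
  nlinarith

lemma real_gaussianReal_abs_le {r : ℝ} (hr : 2 ≤ r) :
    3 / 4 ≤ (gaussianReal 0 1).real {n | |n| ≤ r} := by
  have h := real_lt_le_div_sq (gaussianReal 0 1) (f := fun n => |n|) (by fun_prop) (V := 1)
    (s := r) (by norm_num) (by linarith) (by
      have := lintegral_sub_sq_gaussianReal 0 0
      simp only [sub_zero] at this
      simp [this])
  have hc : {n : ℝ | |n| ≤ r} = {n : ℝ | r < |n|}ᶜ := by ext; simp
  rw [hc, probReal_compl_eq_one_sub (measurableSet_lt measurable_const (by fun_prop))]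
  have : 1 / r ^ 2 ≤ 1 / 4 := by
    apply one_div_le_one_div_of_le (by norm_num); nlinarith
  linarith

/-- The expected penalty of the noisy sum dominates the truncated moment of a summand. -/
lemma Wrung.truncMoment_le_penalty {δ : ℝ} {μ : Measure (𝒳 × 𝒴)} [IsProbabilityMeasure μ]
    (h : Wrung δ μ) (hδ : 0 ≤ δ) (hδ1 : δ ≤ 1 / 15) {f : 𝒳 → ℝ} {g : 𝒴 → ℝ}
    (hf : Measurable f) (hg : Measurable g) {V R : ℝ} (hV : 1 ≤ V) (hR : 0 ≤ R)
    (hgV : ∫⁻ z, ENNReal.ofReal (g z.2 ^ 2) ∂μ ≤ ENNReal.ofReal V)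
    (hi : Integrable (fun w : (𝒳 × 𝒴) × ℝ => penalty R (f w.1.1 + g w.1.2 + w.2))
      (μ.prod (gaussianReal 0 1))) :
    (∫ z, truncMoment R (f z.1) ∂μ) / 32 - ((80 * δ) ^ 8 * R ^ 5 + (64 * V) ^ 5) ≤
      ∫ w, penalty R (f w.1.1 + g w.1.2 + w.2) ∂(μ.prod (gaussianReal 0 1)) := by
  -- By Chebyshev's inequality |g| exceeds r with probability at most 1/4, and since r ≥ 2 the noise
  -- stays within r with probability at least 3/4.
  set r := 2 * √V with hr
  have hsV : 1 ≤ √V := Real.one_le_sqrt.2 hV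
  have hr2 : 2 ≤ r := by linarith
  have hrsq : r ^ 2 = 4 * V := by rw [hr, mul_pow, Real.sq_sqrt (by linarith)]; norm_num
  set ψ : 𝒳 × 𝒴 → ℝ := fun z => truncMoment R (f z.1) with hψ
  have mψ : Measurable ψ := (measurable_truncMoment R).comp (hf.comp measurable_fst)
  have hψ0 : ∀ z, 0 ≤ ψ z := fun z => truncMoment_nonneg hR _
  have hψM : ∀ z, ψ z ≤ R ^ 5 := fun z => truncMoment_le hR _
  have iψ : Integrable ψ μ := Integrable.of_bound (C := R ^ 5) mψ.aestronglyMeasurable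
    (Eventually.of_forall fun ω => by rw [Real.norm_of_nonneg (hψ0 ω)]; exact hψM ω)
  set B : Set (𝒳 × 𝒴) := {z | r < |g z.2|} with hB
  have mB : MeasurableSet B :=
    measurableSet_lt measurable_const (hg.comp measurable_snd).norm
  have hq : μ.real B ≤ 1 / 4 := by
    have := real_lt_le_div_sq μ (f := fun z => |g z.2|) (hg.comp measurable_snd).norm (V := V)
      (s := r) (by linarith) (by linarith) (by simpa using hgV)
    refine this.trans ?_
    rw [hrsq, div_le_div_iff₀ (by linarith) (by norm_num)]; linarith
  have hhalf : ∫ z in B, ψ z ∂μ ≤ (∫ z, ψ z ∂μ) / 2 + (80 * δ) ^ 8 * R ^ 5 := by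
    refine setIntegral_le_half mψ hψ0 (by positivity) (by positivity) hψM fun t => ?_
    have e1 : {z : 𝒳 × 𝒴 | t < ψ z} ∩ B =
        {x | t < truncMoment R (f x)} ×ˢ {y | r < |g y|} := by ext; simp [hψ, hB]
    have e2 : {z : 𝒳 × 𝒴 | t < ψ z} = {x | t < truncMoment R (f x)} ×ˢ Set.univ := by
      ext; simp [hψ]
    have e3 : B = Set.univ ×ˢ {y | r < |g y|} := by ext; simp [hB]
    rw [e1, e2]
    refine h.real_prod_le_half hδ hδ1
      (measurableSet_lt measurable_const ((measurable_truncMoment R).comp hf))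
      (measurableSet_lt measurable_const hg.norm) ?_
    rw [← e3]; exact hq
  have hBc : (∫ z, ψ z ∂μ) / 2 - (80 * δ) ^ 8 * R ^ 5 ≤ ∫ z in Bᶜ, ψ z ∂μ := by
    have := integral_add_compl mB iψ
    linarith
  -- If |f| ≥ 4r while g and the noise are within r, the sum is at least |f|/2 in size and the
  -- penalty dominates. If |f| < 4r, the truncated moment is at most `C0`, because √(8√V) ≤ 64V, and
  -- its subtraction makes the lower bound nonpositive.
  set C0 : ℝ := (64 * V) ^ 5 with hC0
  set N : Set ℝ := {n | |n| ≤ r} with hN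
  have mN : MeasurableSet N := measurableSet_le (by fun_prop) measurable_const
  have pN : 3 / 4 ≤ (gaussianReal 0 1).real N := real_gaussianReal_abs_le hr2
  have pN1 : (gaussianReal 0 1).real N ≤ 1 := measureReal_le_one
  set F : (𝒳 × 𝒴) → ℝ := Bᶜ.indicator fun z => ψ z / 8 - C0 with hF
  have iF0 : Integrable (fun z => ψ z / 8 - C0) μ := (iψ.div_const 8).sub (integrable_const _)
  have iF : Integrable F μ := iF0.indicator mB.compl
  have iN : Integrable (N.indicator fun _ => (1 : ℝ)) (gaussianReal 0 1) :=
    (integrable_const _).indicator mN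
  have hpt : ∀ w : (𝒳 × 𝒴) × ℝ, F w.1 * N.indicator (fun _ => (1 : ℝ)) w.2 ≤
      penalty R (f w.1.1 + g w.1.2 + w.2) := by
    rintro ⟨z, n⟩
    simp only [hF]
    by_cases hz : z ∈ Bᶜ
    swap
    · rw [Set.indicator_of_notMem hz, zero_mul]; exact penalty_nonneg hR _
    by_cases hn : n ∈ N
    swap
    · rw [Set.indicator_of_notMem hn, mul_zero]; exact penalty_nonneg hR _
    rw [Set.indicator_of_mem hz, Set.indicator_of_mem hn, mul_one]
    have hz' : |g z.2| ≤ r := by simpa [hB] using hz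
    have hn' : |n| ≤ r := hn
    rcases le_or_gt (4 * r) |f z.1| with hfr | hfr
    · have hge : |f z.1| / 2 ≤ |f z.1 + g z.2 + n| := by
        have h1 := abs_add_le (f z.1 + g z.2 + n) (-(g z.2) + -n)
        rw [show f z.1 + g z.2 + n + (-(g z.2) + -n) = f z.1 by ring] at h1
        have h2 := abs_add_le (-(g z.2)) (-n)
        rw [abs_neg, abs_neg] at h2
        linarith
      have := _root_.truncMoment_le_penalty hR hge
      have : 0 ≤ C0 := by positivity
      simp only [hψ]; linarith
    · refine le_trans ?_ (penalty_nonneg hR _)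
      have h1 : min √|f z.1| R ≤ √(8 * √V) := by
        refine (min_le_left _ _).trans (Real.sqrt_le_sqrt ?_)
        rw [hr] at hfr; linarith
      have h2 : √(8 * √V) ≤ 64 * V := by
        apply Real.sqrt_le_iff.2
        refine ⟨by linarith, ?_⟩
        have : √V ≤ V := by nlinarith [Real.sq_sqrt (show 0 ≤ V by linarith)]
        nlinarith
      have h3 : ψ z ≤ C0 := pow_le_pow_left₀ (le_min (Real.sqrt_nonneg _) hR) (h1.trans h2) 5
      have := hψ0 z
      linarith
  have hmono := integral_mono (iF.mul_prod iN) hi hpt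
  rw [integral_prod_mul (μ := μ) (ν := gaussianReal 0 1) F (N.indicator fun _ => (1 : ℝ)),
    integral_indicator_const _ mN, smul_eq_mul, mul_one] at hmono
  have eF : ∫ z, F z ∂μ = (∫ z in Bᶜ, ψ z ∂μ) / 8 - C0 * μ.real Bᶜ := by
    rw [hF, integral_indicator mB.compl, integral_sub (iψ.div_const 8).integrableOn
      (integrable_const _).integrableOn, integral_div, setIntegral_const]
    simp [mul_comm]
  have hI0 : 0 ≤ ∫ w, penalty R (f w.1.1 + g w.1.2 + w.2) ∂(μ.prod (gaussianReal 0 1)) :=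
    integral_nonneg fun w => penalty_nonneg hR _
  have hC00 : 0 ≤ C0 := by positivity
  have hηM : 0 ≤ (80 * δ) ^ 8 * R ^ 5 := by positivity
  have hB1 : C0 * μ.real Bᶜ ≤ C0 := mul_le_of_le_one_right hC00 measureReal_le_one
  have hΨ0 : 0 ≤ ∫ z, ψ z ∂μ := integral_nonneg hψ0
  -- The factor 3/4 for the noise may be inserted only when the integral of F is nonnegative.
  -- Otherwise nonnegativity of the penalty is enough.
  rcases le_or_gt 0 (∫ z, F z ∂μ) with hs | hs
  · have : (∫ z, F z ∂μ) * (3 / 4) ≤ (∫ z, F z ∂μ) * (gaussianReal 0 1).real N :=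
      mul_le_mul_of_nonneg_left pN hs
    rw [eF] at this hmono
    linarith
  · rw [eF] at hs
    linarith

end Penalty

end

noncomputable section

/-! ### Sum information of wrung inputs and the derivative of the weighted capacity. -/

section SumInformation

open InformationTheory

/-- `∫ (z² + z⁴) exp (-κ z² / 2) dz`. -/
def tiltedMoment (κ : ℝ) : ℝ := ∫ z : ℝ, (z ^ 2 + z ^ 4) * Real.exp (-(κ / 2) * z ^ 2)

lemma integrable_pow_mul_exp_neg_mul_sq {b : ℝ} (hb : 0 < b) (k : ℕ) :
    Integrable fun z : ℝ => z ^ k * Real.exp (-b * z ^ 2) := by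
  have := integrable_rpow_mul_exp_neg_mul_sq hb (s := k) (by
    have : (0 : ℝ) ≤ k := Nat.cast_nonneg k
    linarith)
  simpa only [Real.rpow_natCast] using this

lemma tiltedMoment_nonneg (κ : ℝ) : 0 ≤ tiltedMoment κ :=
  integral_nonneg fun z => by positivity

/-- By e^u ≤ 1 + u e^u with u = d·`penalty R z`, the excess mass is linear in d. Since u ≤ κz²/2,
the remaining exponential is still a normal one. -/
lemma lintegral_exp_penalty_le {κ d R : ℝ} (hκ : 0 < κ) (hd : 0 ≤ d) (hR : 0 ≤ R)
    (hdR : d * R ≤ κ / 2) :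
    ∫⁻ z, ENNReal.ofReal (Real.exp (-κ * z ^ 2 + d * penalty R z)) ≤
      ENNReal.ofReal (√(Real.pi / κ) + d * tiltedMoment κ) := by
  have i1 : Integrable fun z : ℝ => Real.exp (-κ * z ^ 2) := integrable_exp_neg_mul_sq hκ
  have i2 : Integrable fun z : ℝ => (z ^ 2 + z ^ 4) * Real.exp (-(κ / 2) * z ^ 2) := by
    simp_rw [add_mul]
    exact (integrable_pow_mul_exp_neg_mul_sq (half_pos hκ) 2).add
      (integrable_pow_mul_exp_neg_mul_sq (half_pos hκ) 4)
  have hpt : ∀ z, Real.exp (-κ * z ^ 2 + d * penalty R z) ≤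
      Real.exp (-κ * z ^ 2) + d * ((z ^ 2 + z ^ 4) * Real.exp (-(κ / 2) * z ^ 2)) := by
    intro z
    have hp0 : 0 ≤ d * penalty R z := mul_nonneg hd (penalty_nonneg hR z)
    have h1 : Real.exp (d * penalty R z) ≤
        1 + d * penalty R z * Real.exp (d * penalty R z) := by
      have := Real.add_one_le_exp (-(d * penalty R z))
      have h2 : Real.exp (-(d * penalty R z)) * Real.exp (d * penalty R z) = 1 := by
        rw [← Real.exp_add]; simp
      nlinarith [Real.exp_pos (d * penalty R z)]
    have h2 : d * penalty R z ≤ κ / 2 * z ^ 2 := by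
      have := mul_le_mul_of_nonneg_left (penalty_le R z) hd
      nlinarith [sq_nonneg z]
    have h3 : Real.exp (-κ * z ^ 2) * Real.exp (d * penalty R z) ≤
        Real.exp (-(κ / 2) * z ^ 2) := by
      rw [← Real.exp_add]; apply Real.exp_le_exp.2; linarith
    have h4 : penalty R z ≤ z ^ 2 + z ^ 4 := penalty_le_pow _ _
    rw [Real.exp_add]
    calc Real.exp (-κ * z ^ 2) * Real.exp (d * penalty R z)
        ≤ Real.exp (-κ * z ^ 2) * (1 + d * penalty R z * Real.exp (d * penalty R z)) :=
          mul_le_mul_of_nonneg_left h1 (Real.exp_pos _).le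
      _ = Real.exp (-κ * z ^ 2) +
          d * (penalty R z * (Real.exp (-κ * z ^ 2) * Real.exp (d * penalty R z))) := by ring
      _ ≤ _ := by
          gcongr
  calc ∫⁻ z, ENNReal.ofReal (Real.exp (-κ * z ^ 2 + d * penalty R z))
      ≤ ∫⁻ z, ENNReal.ofReal (Real.exp (-κ * z ^ 2) +
          d * ((z ^ 2 + z ^ 4) * Real.exp (-(κ / 2) * z ^ 2))) :=
        lintegral_mono fun z => ENNReal.ofReal_le_ofReal (hpt z)
    _ = ENNReal.ofReal (∫ z, (Real.exp (-κ * z ^ 2) +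
          d * ((z ^ 2 + z ^ 4) * Real.exp (-(κ / 2) * z ^ 2)))) :=
        (ofReal_integral_eq_lintegral_ofReal (i1.add (i2.const_mul d))
          (Eventually.of_forall fun z =>
            add_nonneg (Real.exp_pos _).le (mul_nonneg hd (by positivity)))).symm
    _ = _ := by
        rw [integral_add i1 (i2.const_mul d), integral_gaussian, integral_const_mul]
        rfl

/-- The quadratic potential with the penalty subtracted. -/
def penalizedPotential (κ d R m z : ℝ) : ℝ :=
  κ * (z - m) ^ 2 - d * penalty R (z - m) + Real.log (√(Real.pi / κ) + d * tiltedMoment κ)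

lemma lintegral_exp_neg_penalizedPotential_le {κ d R : ℝ} (hκ : 0 < κ) (hd : 0 ≤ d) (hR : 0 ≤ R)
    (hdR : d * R ≤ κ / 2) (m : ℝ) :
    ∫⁻ z, ENNReal.ofReal (Real.exp (-penalizedPotential κ d R m z)) ≤ 1 := by
  have hpos : 0 < √(Real.pi / κ) + d * tiltedMoment κ :=
    add_pos_of_pos_of_nonneg (Real.sqrt_pos.2 (by positivity))
      (mul_nonneg hd (tiltedMoment_nonneg κ))
  set c := √(Real.pi / κ) + d * tiltedMoment κ with hc
  have e : ∀ z, ENNReal.ofReal (Real.exp (-penalizedPotential κ d R m z)) =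
      (fun y => ENNReal.ofReal (Real.exp (-κ * y ^ 2 + d * penalty R y))) (z - m) *
        ENNReal.ofReal c⁻¹ := by
    intro z
    simp only
    rw [← ENNReal.ofReal_mul (Real.exp_pos _).le, penalizedPotential, ← hc]
    congr 1
    rw [show -(κ * (z - m) ^ 2 - d * penalty R (z - m) + Real.log c) =
      (-κ * (z - m) ^ 2 + d * penalty R (z - m)) + -Real.log c by ring, Real.exp_add,
      Real.exp_neg (Real.log c), Real.exp_log hpos]
  simp_rw [e]
  rw [lintegral_mul_const' _ _ ENNReal.ofReal_ne_top,
    lintegral_sub_right_eq_self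
      (fun y => ENNReal.ofReal (Real.exp (-κ * y ^ 2 + d * penalty R y))) m]
  calc _ ≤ ENNReal.ofReal c * ENNReal.ofReal c⁻¹ :=
        mul_le_mul_left (lintegral_exp_penalty_le hκ hd hR hdR) _
    _ = 1 := by rw [← ENNReal.ofReal_mul hpos.le, mul_inv_cancel₀ hpos.ne', ENNReal.ofReal_one]

/-- The normalizing constant √(2π(1+S)) is at least one, so adding x to it raises the logarithm by
at most x. -/
lemma log_sqrt_add_le {S x : ℝ} (hS : 0 ≤ S) (hx : 0 ≤ x) :
    Real.log (√(Real.pi / (1 / (2 * (1 + S)))) + x) ≤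
      Real.log (2 * Real.pi) / 2 + Real.log (1 + S) / 2 + x := by
  have e : Real.pi / (1 / (2 * (1 + S))) = 2 * Real.pi * (1 + S) := by field_simp
  rw [e]
  have hp : 1 ≤ 2 * Real.pi * (1 + S) := by nlinarith [Real.pi_gt_three]
  have h1 : 1 ≤ √(2 * Real.pi * (1 + S)) := Real.one_le_sqrt.2 hp
  have h2 : √(2 * Real.pi * (1 + S)) + x ≤ √(2 * Real.pi * (1 + S)) * (1 + x) := by nlinarith
  calc _ ≤ Real.log (√(2 * Real.pi * (1 + S)) * (1 + x)) :=
        Real.log_le_log (by linarith) h2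
    _ = Real.log (2 * Real.pi) / 2 + Real.log (1 + S) / 2 + Real.log (1 + x) := by
        rw [Real.log_mul (by linarith) (by linarith), Real.log_sqrt (by linarith),
          Real.log_mul (by positivity) (by linarith)]
        ring
    _ ≤ _ := by
        have := Real.log_le_sub_one_of_pos (show 0 < 1 + x by linarith)
        linarith

lemma gaussianMix_map_add (μ : Measure (ℝ × ℝ)) [IsProbabilityMeasure μ] :
    gaussianMix (μ.map fun p => p.1 + p.2) =
      (μ.prod (gaussianReal 0 1)).map fun w => w.1.1 + w.1.2 + w.2 := by
  have : IsProbabilityMeasure (μ.map fun p => p.1 + p.2) :=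
    Measure.isProbabilityMeasure_map (by fun_prop)
  have h := Measure.map_prod_map (μa := μ) (μc := gaussianReal 0 1) (f := fun p : ℝ × ℝ => p.1 + p.2)
    (g := id) (by fun_prop) measurable_id
  rw [Measure.map_id] at h
  rw [gaussianMix_eq_map, h, Measure.map_map (by fun_prop) (by fun_prop)]
  rfl

lemma integrable_penalty_gaussianMix {ν : Measure ℝ} [IsProbabilityMeasure ν]
    (h2 : Integrable (fun s => s ^ 2) ν) {R : ℝ} (hR : 0 ≤ R) (a : ℝ) :
    Integrable (fun z => penalty R (z - a)) (gaussianMix ν) :=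
  ((integrable_sub_sq_gaussianMix h2 a).1.const_mul R).mono'
    ((measurable_penalty R).comp (by fun_prop : Measurable fun z : ℝ => z - a)).aestronglyMeasurable
    (Eventually.of_forall fun z => by
      rw [Real.norm_of_nonneg (penalty_nonneg hR _)]; exact penalty_le R _)

lemma Wrung.truncMoment_le_gaussianMix {δ : ℝ} {μ : Measure (ℝ × ℝ)} [IsProbabilityMeasure μ]
    (h : Wrung δ μ) (hδ : 0 ≤ δ) (hδ1 : δ ≤ 1 / 15) {V R : ℝ} (hV : 1 ≤ V) (hR : 0 ≤ R) (a b : ℝ)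
    (h2 : Integrable (fun s => s ^ 2) (μ.map fun p => p.1 + p.2))
    (hgV : ∫⁻ z, ENNReal.ofReal ((z.2 - b) ^ 2) ∂μ ≤ ENNReal.ofReal V) :
    (∫ z, truncMoment R (z.1 - a) ∂μ) / 32 - ((80 * δ) ^ 8 * R ^ 5 + (64 * V) ^ 5) ≤
      ∫ z, penalty R (z - (a + b)) ∂(gaussianMix (μ.map fun p => p.1 + p.2)) := by
  have : IsProbabilityMeasure (μ.map fun p => p.1 + p.2) :=
    Measure.isProbabilityMeasure_map (by fun_prop)
  have hi := integrable_penalty_gaussianMix h2 hR (a + b)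
  have mp : Measurable fun z : ℝ => penalty R (z - (a + b)) :=
    (measurable_penalty R).comp (by fun_prop)
  rw [gaussianMix_map_add] at hi ⊢
  rw [integrable_map_measure mp.aestronglyMeasurable (by fun_prop)] at hi
  rw [integral_map (by fun_prop) mp.aestronglyMeasurable]
  have e : ∀ w : (ℝ × ℝ) × ℝ, penalty R (w.1.1 + w.1.2 + w.2 - (a + b)) =
      penalty R ((w.1.1 - a) + (w.1.2 - b) + w.2) := fun w => by congr 1; ring
  simp_rw [e]
  refine h.truncMoment_le_penalty hδ hδ1 (f := fun x => x - a) (g := fun y => y - b) (by fun_prop)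
    (by fun_prop) hV hR hgV ?_
  refine hi.congr (Eventually.of_forall fun w => ?_)
  simp only [Function.comp_apply, e]

/-- The sum information of nearly independent inputs with bounded variances. -/
lemma Wrung.lintegral_klDiv_le_of_variance_le {δ : ℝ} {μ : Measure (ℝ × ℝ)}
    [IsProbabilityMeasure μ] (h : Wrung δ μ) (hδ : 0 < δ) (hδ1 : δ ≤ 1 / 15) {S V : ℝ} (hS : 0 ≤ S)
    (hV : 1 ≤ V) (h1 : Integrable (fun p => p.1 ^ 2) μ) (h2 : Integrable (fun p => p.2 ^ 2) μ)
    (hfV : ∫ p, (p.1 - ∫ q, q.1 ∂μ) ^ 2 ∂μ ≤ V) (hgV : ∫ p, (p.2 - ∫ q, q.2 ∂μ) ^ 2 ∂μ ≤ V) :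
    ∫⁻ s, klDiv (gaussianReal s 1) (gaussianMix (μ.map fun p => p.1 + p.2))
        ∂(μ.map fun p => p.1 + p.2) ≤
      ENNReal.ofReal (capIntercept S +
        1 / (2 * (1 + S)) * (∫ p, (p.1 - ∫ q, q.1 ∂μ) ^ 2 ∂μ + ∫ p, (p.2 - ∫ q, q.2 ∂μ) ^ 2 ∂μ) +
        (320 + 3932160 * V ^ 2 + 5120 * (1 + (64 * V) ^ 5 +
          tiltedMoment (1 / (2 * (1 + S))))) * δ) := by
  set a := ∫ q, q.1 ∂μ with ha
  set b := ∫ q, q.2 ∂μ with hb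
  set κ : ℝ := 1 / (2 * (1 + S)) with hκ
  set J := tiltedMoment κ with hJ
  have hJ0 : 0 ≤ J := tiltedMoment_nonneg κ
  have hκ0 : 0 < κ := by positivity
  have hκ1 : κ ≤ 1 / 2 := by
    rw [hκ]; apply one_div_le_one_div_of_le (by norm_num); linarith
  -- Three requirements fix d and R. The relation d/64 = 2κ·80δ makes the penalty gain cancel the
  -- truncated moments in the covariance bound; dR = κ/2 is the limit allowed for integrability; and
  -- R of order 1/δ, with cut-off T = R², makes the tail error 192V²/√T linear in δ.
  set d := 10240 * κ * δ with hd
  have hd0 : 0 ≤ d := by positivity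
  set R := 1 / (20480 * δ) with hR
  have hR0 : 0 < R := by positivity
  have hdR : d * R = κ / 2 := by rw [hd, hR]; field_simp; norm_num
  have m1 : MemLp (fun p : ℝ × ℝ => p.1) 2 μ := (memLp_two_iff_integrable_sq (by fun_prop)).2 h1
  have m2 : MemLp (fun p : ℝ × ℝ => p.2) 2 μ := (memLp_two_iff_integrable_sq (by fun_prop)).2 h2
  have i1 : Integrable (fun p : ℝ × ℝ => p.1) μ := m1.integrable one_le_two
  have i2 : Integrable (fun p : ℝ × ℝ => p.2) μ := m2.integrable one_le_two
  have mf : MemLp (fun p : ℝ × ℝ => p.1 - a) 2 μ := m1.sub (memLp_const a)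
  have mg : MemLp (fun p : ℝ × ℝ => p.2 - b) 2 μ := m2.sub (memLp_const b)
  have jf : Integrable (fun p : ℝ × ℝ => (p.1 - a) ^ 2) μ := mf.integrable_sq
  have jg : Integrable (fun p : ℝ × ℝ => (p.2 - b) ^ 2) μ := mg.integrable_sq
  have jfg : Integrable (fun p : ℝ × ℝ => (p.1 - a) * (p.2 - b)) μ := mf.integrable_mul mg
  have ef : ∫ p, (p.1 - a) ∂μ = 0 := by
    rw [integral_sub i1 (integrable_const _)]; simp [ha]
  set ν := μ.map fun p => p.1 + p.2 with hν
  have hνp : IsProbabilityMeasure ν := Measure.isProbabilityMeasure_map (by fun_prop)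
  have hν2 : Integrable (fun s => s ^ 2) ν := by
    rw [hν, integrable_map_measure (by fun_prop) (by fun_prop)]
    exact (m1.add m2).integrable_sq
  have hνsub : ∫ s, (s - (a + b)) ^ 2 ∂ν = (∫ p, (p.1 - a) ^ 2 ∂μ) + (∫ p, (p.2 - b) ^ 2 ∂μ) +
      2 * ∫ p, (p.1 - a) * (p.2 - b) ∂μ := by
    rw [hν, integral_map (by fun_prop) (by fun_prop)]
    have e : ∀ p : ℝ × ℝ, (p.1 + p.2 - (a + b)) ^ 2 =
        ((p.1 - a) ^ 2 + (p.2 - b) ^ 2) + 2 * ((p.1 - a) * (p.2 - b)) := fun p => by ring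
    simp_rw [e]
    have j : Integrable (fun p : ℝ × ℝ => (p.1 - a) ^ 2 + (p.2 - b) ^ 2) μ := jf.add jg
    rw [integral_add j (jfg.const_mul 2), integral_add jf jg, integral_const_mul]
  -- covariance
  have hcov := h.abs_cov_le hδ.le hδ1 (f := fun x => x - a) (g := fun y => y - b) (by fun_prop)
    (by fun_prop) hV (T := R ^ 2) (by positivity) jf jg hfV hgV
  rw [ef, zero_mul, sub_zero, Real.sqrt_sq hR0.le] at hcov
  simp only [min_rpow_eq_truncMoment hR0.le] at hcov
  have hcov' := (le_abs_self _).trans hcov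
  set Φf := ∫ z, truncMoment R (z.1 - a) ∂μ with hΦf
  set Φg := ∫ z, truncMoment R (z.2 - b) ∂μ with hΦg
  -- penalty
  have hlint : ∀ {φ : ℝ × ℝ → ℝ}, Integrable (fun p => φ p ^ 2) μ → ∫ p, φ p ^ 2 ∂μ ≤ V →
      ∫⁻ p, ENNReal.ofReal (φ p ^ 2) ∂μ ≤ ENNReal.ofReal V := by
    intro φ hi hle
    rw [← ofReal_integral_eq_lintegral_ofReal hi (Eventually.of_forall fun _ => sq_nonneg _)]
    exact ENNReal.ofReal_le_ofReal hle
  have hp1 := h.truncMoment_le_gaussianMix hδ.le hδ1 hV hR0.le a b hν2 (hlint jg hgV)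
  have hsp : IsProbabilityMeasure (μ.map Prod.swap) :=
    Measure.isProbabilityMeasure_map measurable_swap.aemeasurable
  have hsw : (μ.map Prod.swap).map (fun p => p.1 + p.2) = ν := by
    rw [hν, Measure.map_map (by fun_prop) measurable_swap]
    congr 1; ext p; simp [add_comm]
  have hp2 := h.swap.truncMoment_le_gaussianMix hδ.le hδ1 hV hR0.le b a (by rw [hsw]; exact hν2)
    (by
      rw [lintegral_map (by fun_prop) measurable_swap]
      exact hlint jf hfV)
  have mt : Measurable fun z : ℝ × ℝ => truncMoment R (z.1 - b) :=
    (measurable_truncMoment R).comp (by fun_prop)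
  rw [hsw, add_comm b a, integral_map measurable_swap.aemeasurable
    mt.aestronglyMeasurable] at hp2
  simp only [Prod.fst_swap] at hp2
  rw [← hΦg] at hp2
  rw [← hΦf, ← hν] at hp1
  set H := ∫ z, penalty R (z - (a + b)) ∂(gaussianMix ν) with hH
  have hR5 : (80 * δ) ^ 8 * R ^ 5 ≤ 1 := by
    have e : (80 * δ) ^ 8 * R ^ 5 = 80 ^ 8 / 20480 ^ 5 * δ ^ 3 := by
      rw [hR]; field_simp
    rw [e]
    have : δ ^ 3 ≤ 1 := pow_le_one₀ hδ.le (by linarith)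
    nlinarith
  have hHge : (Φf + Φg) / 64 - (1 + (64 * V) ^ 5) ≤ H := by linarith
  -- potential
  obtain ⟨k2, e2⟩ := integrable_sub_sq_gaussianMix hν2 (a + b)
  have kp := integrable_penalty_gaussianMix hν2 hR0.le (a + b)
  have : IsProbabilityMeasure (gaussianMix ν) := by
    rw [gaussianMix_eq_map]; exact Measure.isProbabilityMeasure_map (by fun_prop)
  have k3 : Integrable (fun z => κ * (z - (a + b)) ^ 2 - d * penalty R (z - (a + b)))
      (gaussianMix ν) := (k2.const_mul κ).sub (kp.const_mul d)
  have kL : Integrable (penalizedPotential κ d R (a + b)) (gaussianMix ν) :=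
    k3.add (integrable_const _)
  have mL : Measurable (penalizedPotential κ d R (a + b)) := by
    have : Measurable fun z : ℝ => penalty R (z - (a + b)) :=
      (measurable_penalty R).comp (by fun_prop)
    unfold penalizedPotential; fun_prop
  refine (lintegral_klDiv_gaussianMix_le hν2 mL
    (lintegral_exp_neg_penalizedPotential_le hκ0 hd0 hR0.le hdR.le (a + b)) kL).trans ?_
  refine ENNReal.ofReal_le_ofReal ?_
  have eL : ∫ z, penalizedPotential κ d R (a + b) z ∂(gaussianMix ν) =
      κ * (1 + ∫ s, (s - (a + b)) ^ 2 ∂ν) - d * H + Real.log (√(Real.pi / κ) + d * J) := by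
    unfold penalizedPotential
    rw [integral_add k3 (integrable_const _), integral_sub (k2.const_mul κ) (kp.const_mul d),
      integral_const_mul, integral_const_mul, e2]
    simp [hH, hJ]
  have hlog := log_sqrt_add_le hS (mul_nonneg hd0 hJ0)
  rw [← hκ] at hlog
  rw [eL, hνsub]
  set v1 := ∫ p, (p.1 - a) ^ 2 ∂μ
  set v2 := ∫ p, (p.2 - b) ^ 2 ∂μ
  set c := ∫ p, (p.1 - a) * (p.2 - b) ∂μ
  have hκS : κ - 1 / 2 = -(S / (2 * (1 + S))) := by rw [hκ]; field_simp; ring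
  have hRi : 192 * V ^ 2 / R = 3932160 * V ^ 2 * δ := by rw [hR]; field_simp; norm_num
  rw [hRi] at hcov'
  have t1 : 2 * κ * c ≤ 2 * κ * (80 * δ * (4 + Φf + Φg) + 3932160 * V ^ 2 * δ) :=
    mul_le_mul_of_nonneg_left hcov' (by positivity)
  have t2 : d * ((Φf + Φg) / 64 - (1 + (64 * V) ^ 5)) ≤ d * H := mul_le_mul_of_nonneg_left hHge hd0
  -- The truncated moments `Φf` and `Φg` cancel here, leaving a multiple of δ.
  have t3 : 2 * κ * (80 * δ * (4 + Φf + Φg) + 3932160 * V ^ 2 * δ) -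
      d * ((Φf + Φg) / 64 - (1 + (64 * V) ^ 5)) + d * J =
      2 * κ * ((320 + 3932160 * V ^ 2 + 5120 * (1 + (64 * V) ^ 5 + J)) * δ) := by rw [hd]; ring
  have t4 : 2 * κ * ((320 + 3932160 * V ^ 2 + 5120 * (1 + (64 * V) ^ 5 + J)) * δ) ≤
      1 * ((320 + 3932160 * V ^ 2 + 5120 * (1 + (64 * V) ^ 5 + J)) * δ) :=
    mul_le_mul_of_nonneg_right (by linarith) (by positivity)
  unfold capIntercept
  linarith

lemma integral_sub_mean_sq_le {Ω : Type*} [MeasurableSpace Ω] {μ : Measure Ω}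
    [IsProbabilityMeasure μ] {f : Ω → ℝ} (hf : MemLp f 2 μ) :
    ∫ ω, (f ω - ∫ q, f q ∂μ) ^ 2 ∂μ ≤ ∫ ω, f ω ^ 2 ∂μ := by
  have := variance_le_expectation_sq (μ := μ) (X := f) hf.aestronglyMeasurable
  rwa [variance_eq_integral hf.aestronglyMeasurable.aemeasurable] at this

/-- The sum information of nearly independent inputs lies below the tangent of the capacity, up
to a linear term in the dependence. -/
theorem exists_wrung_lintegral_klDiv_le {S : ℝ} (hS : 0 ≤ S) :
    ∃ K : ℝ, 0 ≤ K ∧ ∀ (δ : ℝ) (μ : Measure (ℝ × ℝ)) [IsProbabilityMeasure μ], 0 < δ → δ ≤ 1 / 15 →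
      Wrung δ μ →
      ∫⁻ p, klDiv (gaussianReal (p.1 + p.2) 1) (gaussianMix (μ.map fun p => p.1 + p.2)) ∂μ ≤
        ENNReal.ofReal (capIntercept S + K * δ) + ENNReal.ofReal (1 / (2 * (1 + S))) *
          (∫⁻ p, ENNReal.ofReal (p.1 ^ 2) ∂μ + ∫⁻ p, ENNReal.ofReal (p.2 ^ 2) ∂μ) := by
  set V := 8 * (1 + S) with hV
  have hJ0 := tiltedMoment_nonneg (1 / (2 * (1 + S)))
  set K := 320 + 3932160 * V ^ 2 + 5120 * (1 + (64 * V) ^ 5 + tiltedMoment (1 / (2 * (1 + S))))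
    with hK
  have hK0 : 0 ≤ K := by positivity
  refine ⟨K, hK0, fun δ μ _ hδ hδ1 h => ?_⟩
  have hκ0 : 0 < 1 / (2 * (1 + S)) := by positivity
  have htop : ENNReal.ofReal (1 / (2 * (1 + S))) ≠ 0 := by simpa using by positivity
  by_cases t1 : ∫⁻ p, ENNReal.ofReal (p.1 ^ 2) ∂μ = ∞
  · rw [t1, top_add, ENNReal.mul_top htop, add_top]; exact le_top
  by_cases t2 : ∫⁻ p, ENNReal.ofReal (p.2 ^ 2) ∂μ = ∞
  · rw [t2, add_top, ENNReal.mul_top htop, add_top]; exact le_top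
  have h1 : Integrable (fun p : ℝ × ℝ => p.1 ^ 2) μ := by
    refine ⟨by fun_prop, ?_⟩
    rw [hasFiniteIntegral_iff_ofReal (Eventually.of_forall fun z => sq_nonneg _)]
    exact lt_top_iff_ne_top.2 t1
  have h2 : Integrable (fun p : ℝ × ℝ => p.2 ^ 2) μ := by
    refine ⟨by fun_prop, ?_⟩
    rw [hasFiniteIntegral_iff_ofReal (Eventually.of_forall fun z => sq_nonneg _)]
    exact lt_top_iff_ne_top.2 t2
  have m1 : MemLp (fun p : ℝ × ℝ => p.1) 2 μ := (memLp_two_iff_integrable_sq (by fun_prop)).2 h1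
  have m2 : MemLp (fun p : ℝ × ℝ => p.2) 2 μ := (memLp_two_iff_integrable_sq (by fun_prop)).2 h2
  set ν := μ.map fun p => p.1 + p.2 with hν
  have hνp : IsProbabilityMeasure ν := Measure.isProbabilityMeasure_map (by fun_prop)
  have m12 : Integrable (fun p : ℝ × ℝ => (p.1 + p.2) ^ 2) μ := (m1.add m2).integrable_sq
  have hν2 : Integrable (fun s => s ^ 2) ν := by
    rw [hν, integrable_map_measure (by fun_prop) (by fun_prop)]
    exact m12
  have hmap : ∫⁻ p, klDiv (gaussianReal (p.1 + p.2) 1) (gaussianMix ν) ∂μ =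
      ∫⁻ s, klDiv (gaussianReal s 1) (gaussianMix ν) ∂ν := by
    conv_rhs => rw [hν]
    rw [lintegral_map (measurable_klDiv_gaussianMix hν2) (by fun_prop)]
  rw [hmap]
  have q1 : 0 ≤ ∫ p, p.1 ^ 2 ∂μ := integral_nonneg fun _ => sq_nonneg _
  have q2 : 0 ≤ ∫ p, p.2 ^ 2 ∂μ := integral_nonneg fun _ => sq_nonneg _
  have hc := capIntercept_nonneg hS
  rw [← ofReal_integral_eq_lintegral_ofReal h1 (Eventually.of_forall fun z => sq_nonneg _),
    ← ofReal_integral_eq_lintegral_ofReal h2 (Eventually.of_forall fun z => sq_nonneg _),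
    ← ENNReal.ofReal_add q1 q2, ← ENNReal.ofReal_mul hκ0.le,
    ← ENNReal.ofReal_add (by positivity) (by positivity)]
  -- Within power V the centred second moments are bounded and the penalized estimate applies.
  -- Beyond V the crude inequality E(X+Y)² ≤ 2(EX² + EY²) is enough with trial variance 4(1+S): this
  -- costs at most log 2 in the logarithm and halves the slope in the power, so v > V = 8(1+S)
  -- leaves a surplus of 2 below the tangent.
  rcases le_or_gt (∫ p, p.1 ^ 2 ∂μ + ∫ p, p.2 ^ 2 ∂μ) V with hv | hv
  · have b1 := integral_sub_mean_sq_le m1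
    have b2 := integral_sub_mean_sq_le m2
    refine (h.lintegral_klDiv_le_of_variance_le hδ hδ1 hS (V := V) (by linarith) h1 h2
      (by linarith) (by linarith)).trans (ENNReal.ofReal_le_ofReal ?_)
    have := mul_le_mul_of_nonneg_left (add_le_add b1 b2) hκ0.le
    linarith
  · refine (lintegral_klDiv_gaussianMix_le_gaussian hν2 (τ := 4 * (1 + S)) (by positivity) 0).trans
      (ENNReal.ofReal_le_ofReal ?_)
    have hs : ∫ s, (s - 0) ^ 2 ∂ν ≤ 2 * (∫ p, p.1 ^ 2 ∂μ + ∫ p, p.2 ^ 2 ∂μ) := by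
      simp only [sub_zero]
      rw [hν, integral_map (by fun_prop) (by fun_prop), ← integral_add h1 h2, ← integral_const_mul]
      exact integral_mono m12 ((h1.add h2).const_mul 2) fun p => by
        dsimp only; nlinarith [sq_nonneg (p.1 - p.2)]
    set v := ∫ p, p.1 ^ 2 ∂μ + ∫ p, p.2 ^ 2 ∂μ
    have hlog : Real.log (4 * (1 + S)) / 2 ≤ 1 + Real.log (1 + S) / 2 := by
      rw [Real.log_mul (by norm_num) (by positivity), show (4 : ℝ) = 2 ^ 2 by norm_num, Real.log_pow]
      have := Real.log_two_lt_d9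
      push_cast; linarith
    have hb : (1 + ∫ s, (s - 0) ^ 2 ∂ν) / (2 * (4 * (1 + S))) ≤ 1 / (2 * (1 + S)) * (1 + v) - 2 := by
      have e : (1 + ∫ s, (s - 0) ^ 2 ∂ν) / (2 * (4 * (1 + S))) =
          1 / (2 * (1 + S)) * ((1 + ∫ s, (s - 0) ^ 2 ∂ν) / 4) := by field_simp
      have e2 : (2 : ℝ) = 1 / (2 * (1 + S)) * (V / 2) := by rw [hV]; field_simp; norm_num
      rw [e]
      nth_rewrite 3 [e2]
      rw [← mul_sub]
      apply mul_le_mul_of_nonneg_left _ hκ0.le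
      linarith
    have hκS : 1 / (2 * (1 + S)) - 1 / 2 = -(S / (2 * (1 + S))) := by field_simp; ring
    have : 0 ≤ K * δ := by positivity
    unfold capIntercept
    linarith

/-- The bound for each u is affine in the powers and therefore averages over U. Replacing δ by 2δ
makes the dependence strictly smaller than the level, which explains the restriction δ ≤ 1/30 and
the factor 2 in the constant. -/
lemma exists_infoXY_gaussianMAC_le {S₁ S₂ : ℝ} (hS₁ : 0 ≤ S₁) (hS₂ : 0 ≤ S₂) :
    ∃ K : ℝ≥0, ∀ (δ : ℝ≥0) (P : InputLaw ℝ ℝ), 0 < δ → (δ : ℝ) ≤ 1 / 30 →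
      (gaussianMAC S₁ S₂).MeetsCost P → (∀ u, wringingDependence (P.PXY u) ≤ δ) →
      (gaussianMAC S₁ S₂).infoXY P ≤ ENNReal.ofReal (Real.log (1 + (S₁ + S₂)) / 2) + K * δ := by
  obtain ⟨K, hK, H⟩ := exists_wrung_lintegral_klDiv_le (add_nonneg hS₁ hS₂)
  refine ⟨K.toNNReal * 2, fun δ P hδ hδ1 hP hw => ?_⟩
  have hlt : ∀ u, Wrung ((2 * δ : ℝ≥0) : ℝ) (P.PXY u) := fun u => by
    refine wrung_of_wringingDependence_lt ((hw u).trans_lt ?_)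
    exact_mod_cast (by rw [two_mul]; exact lt_add_of_pos_left _ hδ : δ < 2 * δ)
  have hu : ∀ u, ∫⁻ p, klDiv ((gaussianMAC S₁ S₂).W p) ((gaussianMAC S₁ S₂).outZ (P.PXY u))
      ∂(P.PXY u) ≤ ENNReal.ofReal (capIntercept (S₁ + S₂) + K * ((2 * δ : ℝ≥0) : ℝ)) +
        ENNReal.ofReal (1 / (2 * (1 + (S₁ + S₂)))) * (∫⁻ p, ENNReal.ofReal (p.1 ^ 2) ∂(P.PXY u) +
          ∫⁻ p, ENNReal.ofReal (p.2 ^ 2) ∂(P.PXY u)) := fun u => by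
    simp only [outZ_gaussianMAC, gaussianMAC_W_apply]
    exact H _ (P.PXY u) (by exact_mod_cast (by positivity : 0 < 2 * δ))
      (by push_cast; linarith) (hlt u)
  refine (lintegral_mono hu).trans ?_
  have mf : Measurable fun u => ∫⁻ p, ENNReal.ofReal (p.1 ^ 2) ∂(P.PXY u) :=
    (by fun_prop : Measurable fun p : ℝ × ℝ => ENNReal.ofReal (p.1 ^ 2)).lintegral_kernel
  have mg : Measurable fun u => ∫⁻ p, ENNReal.ofReal (p.2 ^ 2) ∂(P.PXY u) :=
    (by fun_prop : Measurable fun p : ℝ × ℝ => ENNReal.ofReal (p.2 ^ 2)).lintegral_kernel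
  have mfg : Measurable fun u => ∫⁻ p, ENNReal.ofReal (p.1 ^ 2) ∂(P.PXY u) +
      ∫⁻ p, ENNReal.ofReal (p.2 ^ 2) ∂(P.PXY u) := mf.add mg
  rw [lintegral_add_left measurable_const, lintegral_const_mul _ mfg, lintegral_add_left mf]
  simp only [lintegral_const, measure_univ, mul_one]
  obtain ⟨c1, c2⟩ := meetsCost_gaussianMAC_lintegral hP
  have hc := capIntercept_nonneg (add_nonneg hS₁ hS₂)
  rw [ENNReal.ofReal_add hc (by positivity), ← ofReal_capIntercept_add (add_nonneg hS₁ hS₂)]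
  have e : ENNReal.ofReal (K * ((2 * δ : ℝ≥0) : ℝ)) = ((K.toNNReal * 2 : ℝ≥0) : ℝ≥0∞) * δ := by
    rw [ENNReal.ofReal_mul hK, ENNReal.ofReal_coe_nnreal, ENNReal.ofReal]
    push_cast; ring
  rw [e, add_assoc, add_assoc, add_comm (_ * _ : ℝ≥0∞) (ENNReal.ofReal (1 / _) * _)]
  gcongr
  rw [ENNReal.ofReal_add hS₁ hS₂]
  gcongr

/-- The weighted capacity is finite at `0`, with bounded upper derivative there. -/
theorem weightedCapacity_gaussianMAC {S₁ S₂ : ℝ} (hS₁ : 0 ≤ S₁) (hS₂ : 0 ≤ S₂) :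
    ∃ K : ℝ≥0, ∀ α₁ α₂ : ℝ, 0 ≤ α₁ → 0 ≤ α₂ → max α₁ α₂ = 1 →
      (gaussianMAC S₁ S₂).weightedCapacity α₁ α₂ 0 < ∞ ∧
      (gaussianMAC S₁ S₂).weightedCapacityDeriv α₁ α₂ ≤ K := by
  obtain ⟨K, H⟩ := exists_infoXY_gaussianMAC_le hS₁ hS₂
  refine ⟨K, fun α₁ α₂ h1 h2 hmax => ?_⟩
  have hmin : ENNReal.ofReal (min α₁ α₂) ≤ 1 := by
    rw [ENNReal.ofReal_le_one]; exact (min_le_max).trans hmax.le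
  set C := ENNReal.ofReal (min α₁ α₂) * ENNReal.ofReal (Real.log (1 + (S₁ + S₂)) / 2) +
    ENNReal.ofReal (α₁ - α₂) * ENNReal.ofReal (Real.log (1 + S₁) / 2) +
    ENNReal.ofReal (α₂ - α₁) * ENNReal.ofReal (Real.log (1 + S₂) / 2) with hC
  have hle : ∀ δ : ℝ≥0, 0 < δ → (δ : ℝ) ≤ 1 / 30 →
      (gaussianMAC S₁ S₂).weightedCapacity α₁ α₂ δ ≤ C + K * δ := by
    intro δ hδ hδ1
    refine iSup_le fun P => iSup_le fun hP => iSup_le fun hw => ?_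
    calc _ ≤ ENNReal.ofReal (min α₁ α₂) *
            (ENNReal.ofReal (Real.log (1 + (S₁ + S₂)) / 2) + K * δ) +
          ENNReal.ofReal (α₁ - α₂) * ENNReal.ofReal (Real.log (1 + S₁) / 2) +
          ENNReal.ofReal (α₂ - α₁) * ENNReal.ofReal (Real.log (1 + S₂) / 2) := by
          gcongr
          · exact H δ P hδ hδ1 hP hw
          · exact infoX_gaussianMAC_le hS₁ hP
          · exact infoY_gaussianMAC_le hS₂ hP
      _ = C + ENNReal.ofReal (min α₁ α₂) * (K * δ) := by rw [hC]; ring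
      _ ≤ C + 1 * (K * δ) := by gcongr
      _ = C + K * δ := by rw [one_mul]
  have hge : C ≤ (gaussianMAC S₁ S₂).weightedCapacity α₁ α₂ 0 :=
    le_weightedCapacity_zero hS₁ hS₂ α₁ α₂
  have hmono : ∀ δ : ℝ≥0, (gaussianMAC S₁ S₂).weightedCapacity α₁ α₂ 0 ≤
      (gaussianMAC S₁ S₂).weightedCapacity α₁ α₂ δ := fun δ => by
    refine iSup_mono fun P => iSup_mono fun hP => iSup_le fun hw => ?_
    exact le_iSup_of_le (fun u => (hw u).trans (by simp)) le_rfl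
  have hCtop : C < ∞ := by
    rw [hC]
    exact ENNReal.add_lt_top.2 ⟨ENNReal.add_lt_top.2
      ⟨ENNReal.mul_lt_top ENNReal.ofReal_lt_top ENNReal.ofReal_lt_top,
        ENNReal.mul_lt_top ENNReal.ofReal_lt_top ENNReal.ofReal_lt_top⟩,
      ENNReal.mul_lt_top ENNReal.ofReal_lt_top ENNReal.ofReal_lt_top⟩
  -- The upper bounds hold only for positive δ, so finiteness at zero comes from monotonicity and
  -- the bound at δ = 1/30.
  refine ⟨((hmono (1 / 30)).trans (hle (1 / 30) (by positivity) (by norm_num))).trans_lt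
    (ENNReal.add_lt_top.2 ⟨hCtop, ENNReal.mul_lt_top ENNReal.coe_lt_top ENNReal.coe_lt_top⟩), ?_⟩
  refine limsup_le_of_le (by isBoundedDefault) ?_
  have hev : ∀ᶠ δ : ℝ≥0 in 𝓝[>] 0, δ < 1 / 30 :=
    nhdsWithin_le_nhds (Iio_mem_nhds (by positivity))
  filter_upwards [hev, self_mem_nhdsWithin] with δ hδ hδ0
  have hδ0' : 0 < δ := hδ0
  refine ENNReal.div_le_of_le_mul ?_
  rw [tsub_le_iff_left]
  exact (hle δ hδ0' (by exact_mod_cast hδ.le)).trans (add_le_add hge le_rfl)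

end SumInformation

end

noncomputable section

/-! ### Normal vectors and change of measure. -/

section GaussianVector

/-- The squared Euclidean distance. -/
def sqDist {n : ℕ} (x y : Fin n → ℝ) : ℝ := ∑ t, (x t - y t) ^ 2

lemma sqDist_nonneg {n : ℕ} (x y : Fin n → ℝ) : 0 ≤ sqDist x y :=
  Finset.sum_nonneg fun _ _ => sq_nonneg _

lemma measurable_sqDist_left {n : ℕ} (y : Fin n → ℝ) : Measurable fun x => sqDist x y := by
  unfold sqDist; fun_prop

/-- The law of a vector with independent normal coordinates of common variance. -/
def gaussianVec {n : ℕ} (c : Fin n → ℝ) (v : ℝ≥0) : Measure (Fin n → ℝ) :=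
  Measure.pi fun t => gaussianReal (c t) v

instance {n : ℕ} (c : Fin n → ℝ) (v : ℝ≥0) : IsProbabilityMeasure (gaussianVec c v) := by
  unfold gaussianVec; infer_instance

lemma gaussianVec_eq_withDensity {n : ℕ} (c : Fin n → ℝ) {τ : ℝ} (hτ : 0 < τ) :
    gaussianVec c τ.toNNReal = volume.withDensity fun z =>
      ENNReal.ofReal (Real.exp (-(sqDist z c / (2 * τ) + n * (Real.log (2 * Real.pi * τ) / 2)))) := by
  have hτ' : τ.toNNReal ≠ 0 := by simpa using hτ
  have e : ∀ z : Fin n → ℝ,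
      Real.exp (-(sqDist z c / (2 * τ) + n * (Real.log (2 * Real.pi * τ) / 2))) =
        ∏ t, gaussianPDFReal (c t) τ.toNNReal (z t) := by
    intro z
    simp_rw [← exp_neg_gaussianPotential hτ]
    rw [← Real.exp_sum]
    congr 1
    simp only [gaussianPotential, sqDist, Finset.sum_neg_distrib, Finset.sum_add_distrib,
      Finset.sum_div]
    simp
  simp_rw [e]
  refine Measure.pi_eq fun s hs => ?_
  have hbox : MeasurableSet (Set.univ.pi s) := MeasurableSet.univ_pi hs
  have hi : ∀ t, Integrable ((s t).indicator (gaussianPDFReal (c t) τ.toNNReal)) :=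
    fun t => (integrable_gaussianPDFReal _ _).indicator (hs t)
  rw [withDensity_apply _ hbox, ← lintegral_indicator hbox]
  have e2 : ∀ z : Fin n → ℝ, (Set.univ.pi s).indicator (fun z =>
      ENNReal.ofReal (∏ t, gaussianPDFReal (c t) τ.toNNReal (z t))) z =
      ENNReal.ofReal (∏ t, (s t).indicator (gaussianPDFReal (c t) τ.toNNReal) (z t)) := by
    intro z
    by_cases hz : z ∈ Set.univ.pi s
    · rw [Set.indicator_of_mem hz]
      congr 1
      exact Finset.prod_congr rfl fun t _ => (Set.indicator_of_mem (hz t trivial) _).symm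
    · rw [Set.indicator_of_notMem hz]
      simp only [Set.mem_pi, Set.mem_univ, true_implies, not_forall] at hz
      obtain ⟨t, ht⟩ := hz
      rw [Finset.prod_eq_zero (Finset.mem_univ t) (Set.indicator_of_notMem ht _)]; simp
  simp_rw [e2]
  have hnn : ∀ t x, 0 ≤ (s t).indicator (gaussianPDFReal (c t) τ.toNNReal) x := fun t x =>
    Set.indicator_nonneg (fun x _ => gaussianPDFReal_nonneg _ _ x) x
  rw [volume_pi, ← ofReal_integral_eq_lintegral_ofReal (Integrable.fintype_prod hi)
    (Eventually.of_forall fun z => Finset.prod_nonneg fun t _ => hnn t _),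
    integral_fintype_prod_eq_prod (fun t => (s t).indicator (gaussianPDFReal (c t) τ.toNNReal)),
    ENNReal.ofReal_prod_of_nonneg fun t _ => integral_nonneg (hnn t)]
  refine Finset.prod_congr rfl fun t _ => ?_
  rw [integral_indicator (hs t), gaussianReal_apply_eq_integral _ hτ']

/-- Change of measure between normal vectors on a set where the likelihood ratio is bounded. -/
lemma setLIntegral_gaussianVec_le {n : ℕ} (c v : Fin n → ℝ) {σ τ l : ℝ} (hσ : 0 < σ) (hτ : 0 < τ)
    {A : Set (Fin n → ℝ)} (hA : MeasurableSet A)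
    (h : ∀ z ∈ A, n * (Real.log (τ / σ) / 2) + sqDist z v / (2 * τ) - sqDist z c / (2 * σ) ≤ l)
    {g : (Fin n → ℝ) → ℝ≥0∞} (hg : Measurable g) :
    ∫⁻ z in A, g z ∂(gaussianVec c σ.toNNReal) ≤
      ENNReal.ofReal (Real.exp l) * ∫⁻ z in A, g z ∂(gaussianVec v τ.toNNReal) := by
  have m : ∀ (c : Fin n → ℝ) (τ : ℝ), Measurable fun z => ENNReal.ofReal
      (Real.exp (-(sqDist z c / (2 * τ) + n * (Real.log (2 * Real.pi * τ) / 2)))) := by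
    intro c τ
    have := measurable_sqDist_left c
    fun_prop
  rw [gaussianVec_eq_withDensity c hσ, gaussianVec_eq_withDensity v hτ,
    setLIntegral_withDensity_eq_setLIntegral_mul _ (m c σ) hg hA,
    setLIntegral_withDensity_eq_setLIntegral_mul _ (m v τ) hg hA,
    ← lintegral_const_mul _ ((m v τ).mul hg)]
  refine setLIntegral_mono' hA fun z hz => ?_
  simp only [Pi.mul_apply]
  rw [← mul_assoc, ← ENNReal.ofReal_mul (Real.exp_pos _).le, ← Real.exp_add]
  refine mul_le_mul_left (ENNReal.ofReal_le_ofReal (Real.exp_le_exp.2 ?_)) _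
  have := h z hz
  rw [Real.log_div hτ.ne' hσ.ne'] at this
  rw [Real.log_mul (by positivity) hσ.ne', Real.log_mul (by positivity) hτ.ne']
  linarith

end GaussianVector

/-! ### Deviation of sums of independent coordinates. -/

section Chebyshev

/-- Chebyshev's inequality for a sum of functions of independent coordinates. -/
lemma pi_abs_sum_sub_le {n : ℕ} {Ω : Fin n → Type*} [∀ t, MeasurableSpace (Ω t)]
    (μ : ∀ t, Measure (Ω t)) [∀ t, IsProbabilityMeasure (μ t)] {X : ∀ t, Ω t → ℝ}
    (hX : ∀ t, MemLp (X t) 2 (μ t)) {m v : Fin n → ℝ} (hm : ∀ t, ∫ ω, X t ω ∂(μ t) = m t)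
    (hv : ∀ t, ∫ ω, X t ω ^ 2 ∂(μ t) ≤ v t) {s : ℝ} (hs : 0 < s) :
    Measure.pi μ {ω | s ≤ |∑ t, X t (ω t) - ∑ t, m t|} ≤ ENNReal.ofReal ((∑ t, v t) / s ^ 2) := by
  have hc : ∀ t, MemLp (fun ω : ∀ t, Ω t => X t (ω t)) 2 (Measure.pi μ) := fun t =>
    (hX t).comp_measurePreserving (measurePreserving_eval _ t)
  have hsum : MemLp (∑ t, fun ω : ∀ t, Ω t => X t (ω t)) 2 (Measure.pi μ) :=
    memLp_finsetSum' _ fun t _ => hc t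
  have hE : ∫ ω, (∑ t, fun ω : ∀ t, Ω t => X t (ω t)) ω ∂(Measure.pi μ) = ∑ t, m t := by
    simp only [Finset.sum_apply]
    rw [integral_finsetSum _ fun t _ => (hc t).integrable one_le_two]
    refine Finset.sum_congr rfl fun t _ => ?_
    rw [← hm t]
    exact integral_comp_eval (hX t).aestronglyMeasurable
  have h := meas_ge_le_variance_div_sq hsum hs
  rw [hE, variance_sum_pi hX] at h
  simp only [Finset.sum_apply] at h
  refine h.trans (ENNReal.ofReal_le_ofReal ?_)
  gcongr with t
  exact (variance_le_expectation_sq (hX t).aestronglyMeasurable).trans (hv t)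

end Chebyshev

/-! ### A strong converse for a single set of centres. -/

section PackingBound

lemma memLp_quadratic_gaussianReal (c a b : ℝ) (v : ℝ≥0) :
    MemLp (fun x => a * (x - c) ^ 2 + b * (x - c)) 2 (gaussianReal c v) := by
  refine (memLp_two_iff_integrable_sq (by fun_prop)).2 ?_
  have i : Integrable (fun x => a ^ 2 * (x - c) ^ 4 + 2 * a * b * (x - c) ^ 3 +
      b ^ 2 * (x - c) ^ 2) (gaussianReal c v) :=
    (((integrable_sub_pow_gaussianReal c c v 4).const_mul _).add
      ((integrable_sub_pow_gaussianReal c c v 3).const_mul _)).add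
      ((integrable_sub_pow_gaussianReal c c v 2).const_mul _)
  refine i.congr (Eventually.of_forall fun x => ?_)
  simp only
  ring

lemma integral_quadratic_gaussianReal (c a b : ℝ) (v : ℝ≥0) :
    ∫ x, (a * (x - c) ^ 2 + b * (x - c)) ∂(gaussianReal c v) = a * v := by
  have i1 := integrable_sub_pow_gaussianReal c c v 1
  simp only [pow_one] at i1
  rw [integral_add ((integrable_sub_pow_gaussianReal c c v 2).const_mul _) (i1.const_mul _),
    integral_const_mul, integral_const_mul, integral_sub_sq_gaussianReal]
  have : ∫ x, (x - c) ∂(gaussianReal c v) = 0 := by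
    have i : Integrable (fun x : ℝ => x) (gaussianReal c v) :=
      (memLp_id_gaussianReal 1).integrable le_rfl
    rw [integral_sub i (integrable_const _)]
    simp
  rw [this]; simp

lemma integral_quadratic_sq_gaussianReal_le (c a b : ℝ) :
    ∫ x, (a * (x - c) ^ 2 + b * (x - c)) ^ 2 ∂(gaussianReal c 1) ≤
      2 * a ^ 2 * gaussianFourthMoment + 2 * b ^ 2 := by
  have i4 := integrable_sub_pow_gaussianReal c c 1 4
  have i2 := integrable_sub_pow_gaussianReal c c 1 2
  calc _ ≤ ∫ x, (2 * a ^ 2 * (x - c) ^ 4 + 2 * b ^ 2 * (x - c) ^ 2) ∂(gaussianReal c 1) := by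
        refine integral_mono (memLp_quadratic_gaussianReal c a b 1).integrable_sq
          ((i4.const_mul _).add (i2.const_mul _)) fun x => ?_
        simp only
        nlinarith [sq_nonneg (a * (x - c) ^ 2 - b * (x - c))]
    _ = _ := by
        rw [integral_add (i4.const_mul _) (i2.const_mul _), integral_const_mul, integral_const_mul,
          integral_sub_sq_gaussianReal, integral_sub_pow_four_gaussianReal]
        simp

/-- A packing bound: few centres can be separated by normal noise when they are close to a common
point. -/
theorem exists_log_card_le {S k η : ℝ} (hS : 0 ≤ S) (hk : 0 ≤ k) (hη : 0 < η) :
    ∃ K : ℝ, 0 ≤ K ∧ ∀ (n : ℕ) (_ : 0 < n) (ι : Type) (s : Finset ι) (v : Fin n → ℝ)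
      (c : ι → Fin n → ℝ) (g : ι → (Fin n → ℝ) → ℝ≥0∞), (∀ i ∈ s, Measurable (g i)) →
      (∀ z, ∑ i ∈ s, g i z ≤ 1) → (∀ i ∈ s, sqDist (c i) v ≤ n * S + k * √n) →
      (∀ i ∈ s, ENNReal.ofReal η ≤ ∫⁻ z, g i z ∂(gaussianVec (c i) 1)) →
      Real.log s.card ≤ n * (Real.log (1 + S) / 2) + K * √n := by
  set m4 := gaussianFourthMoment
  have hm4 : 0 ≤ m4 := gaussianFourthMoment_nonneg
  set D := 2 * S ^ 2 * m4 + 8 * (S + k) with hD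
  have hD0 : 0 ≤ D := by positivity
  -- deviation level
  set r := √(2 * (D + 1) / η) with hr
  have hr0 : 0 < r := Real.sqrt_pos.2 (by positivity)
  have hr2 : r ^ 2 = 2 * (D + 1) / η := Real.sq_sqrt (by positivity)
  set B := (k + r) / (2 * (1 + S)) with hB
  have hB0 : 0 ≤ B := by positivity
  refine ⟨B + |Real.log (2 / η)|, by positivity, ?_⟩
  intro n hn ι s v c g hg hsum hdist hInt
  have hn1 : (1 : ℝ) ≤ n := by exact_mod_cast hn
  have hsq : (1 : ℝ) ≤ √n := Real.one_le_sqrt.2 hn1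
  have hsqsq : √(n : ℝ) ^ 2 = n := Real.sq_sqrt (by linarith)
  have hL0 : 0 ≤ Real.log (1 + S) := Real.log_nonneg (by linarith)
  set l := n * (Real.log (1 + S) / 2) + B * √n with hl
  rcases s.eq_empty_or_nonempty with rfl | hne
  · simp; positivity
  -- A common output law under which the decoding functions have total mass at most one. Each
  -- centre's success probability is compared with its share under Q.
  set Q := gaussianVec v (1 + S).toNNReal with hQ
  have key : ∀ i ∈ s, ENNReal.ofReal (η / 2) ≤ ENNReal.ofReal (Real.exp l) * ∫⁻ z, g i z ∂Q := by
    intro i hi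
    -- Coordinatewise part of |z-v|² - (1+S)|z-c|² without the constant |c-v|². Up to scale this is
    -- the centred exponent of the likelihood ratio of the law around c against Q, and each term has
    -- mean -S.
    set X : Fin n → ℝ → ℝ := fun t x =>
      -S * (x - c i t) ^ 2 + 2 * (c i t - v t) * (x - c i t) with hX
    set A : Set (Fin n → ℝ) := {z | r * √n ≤ |∑ t, X t (z t) - ∑ _t : Fin n, (-S * 1)|} with hA
    have mA : MeasurableSet A := by
      refine measurableSet_le measurable_const ?_
      simp only [hX]; fun_prop
    have hPA : gaussianVec (c i) 1 A ≤ ENNReal.ofReal (η / 2) := by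
      have h := pi_abs_sum_sub_le (fun t => gaussianReal (c i t) 1) (X := X)
        (m := fun _ => -S * 1) (v := fun t => 2 * (-S) ^ 2 * m4 + 2 * (2 * (c i t - v t)) ^ 2)
        (fun t => memLp_quadratic_gaussianReal _ _ _ _)
        (fun t => integral_quadratic_gaussianReal (c i t) (-S) (2 * (c i t - v t)) 1)
        (fun t => integral_quadratic_sq_gaussianReal_le _ _ _) (s := r * √n) (by positivity)
      refine h.trans (ENNReal.ofReal_le_ofReal ?_)
      have e : ∑ t, (2 * (-S) ^ 2 * m4 + 2 * (2 * (c i t - v t)) ^ 2) =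
          n * (2 * S ^ 2 * m4) + 8 * sqDist (c i) v := by
        rw [Finset.sum_add_distrib, sqDist, Finset.mul_sum]
        congr 1
        · simp
        · exact Finset.sum_congr rfl fun t _ => by ring
      have hle : sqDist (c i) v ≤ n * (S + k) := by
        have := hdist i hi
        have : √(n : ℝ) ≤ n := by nlinarith
        nlinarith
      rw [e, mul_pow, hr2, hsqsq, div_le_iff₀ (by positivity)]
      have : η / 2 * (2 * (D + 1) / η * n) = (D + 1) * n := by field_simp
      rw [this, hD]
      nlinarith
    have hcomp : ∫⁻ z in Aᶜ, g i z ∂(gaussianVec (c i) 1) ≤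
        ENNReal.ofReal (Real.exp l) * ∫⁻ z in Aᶜ, g i z ∂Q := by
      have := setLIntegral_gaussianVec_le (c i) v (σ := 1) (τ := 1 + S) (l := l) one_pos
        (by linarith) mA.compl ?_ (hg i hi)
      · simpa using this
      intro z hz
      have hz' : ∑ t, X t (z t) - ∑ _t : Fin n, (-S * 1) ≤ r * √n := by
        simp only [hA, Set.mem_compl_iff, Set.mem_ofPred_eq, not_le] at hz
        exact (le_abs_self _).trans hz.le
      have e : sqDist z v / (2 * (1 + S)) - sqDist z (c i) / (2 * 1) =
          (∑ t, X t (z t) + sqDist (c i) v) / (2 * (1 + S)) := by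
        have : sqDist z v - (1 + S) * sqDist z (c i) = ∑ t, X t (z t) + sqDist (c i) v := by
          simp only [sqDist, hX]
          rw [Finset.mul_sum, ← Finset.sum_sub_distrib, ← Finset.sum_add_distrib]
          exact Finset.sum_congr rfl fun t _ => by ring
        rw [← this]; field_simp
      have hs0 : ∑ _t : Fin n, (-S * 1) = -(n * S) := by simp
      rw [hs0] at hz'
      have hfin : (∑ t, X t (z t) + sqDist (c i) v) / (2 * (1 + S)) ≤ B * √n := by
        rw [hB, div_mul_eq_mul_div]
        gcongr
        have := hdist i hi
        linarith
      rw [hl, div_one]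
      linarith
    have hone : ∀ z, g i z ≤ 1 := fun z =>
      (Finset.single_le_sum (f := fun i => g i z) (fun _ _ => zero_le) hi).trans (hsum z)
    have hAle : ∫⁻ z in A, g i z ∂(gaussianVec (c i) 1) ≤ ENNReal.ofReal (η / 2) := by
      refine le_trans ?_ hPA
      calc _ ≤ ∫⁻ _ in A, 1 ∂(gaussianVec (c i) 1) := lintegral_mono fun z => hone z
        _ = _ := by simp
    have htot := hInt i hi
    rw [← lintegral_add_compl _ mA] at htot
    have h2 : ENNReal.ofReal η = ENNReal.ofReal (η / 2) + ENNReal.ofReal (η / 2) := by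
      rw [← ENNReal.ofReal_add (by positivity) (by positivity)]; congr 1; ring
    rw [h2] at htot
    have h3 := htot.trans (add_le_add hAle hcomp)
    have h4 := (ENNReal.add_le_add_iff_left ENNReal.ofReal_ne_top).1 h3
    exact h4.trans (mul_le_mul_right (setLIntegral_le_lintegral _ _) _)
  have htot : (s.card : ℝ≥0∞) * ENNReal.ofReal (η / 2) ≤ ENNReal.ofReal (Real.exp l) := by
    calc (s.card : ℝ≥0∞) * ENNReal.ofReal (η / 2) = ∑ _i ∈ s, ENNReal.ofReal (η / 2) := by simp
      _ ≤ ∑ i ∈ s, ENNReal.ofReal (Real.exp l) * ∫⁻ z, g i z ∂Q := Finset.sum_le_sum key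
      _ = ENNReal.ofReal (Real.exp l) * ∫⁻ z, ∑ i ∈ s, g i z ∂Q := by
          rw [← Finset.mul_sum, lintegral_finsetSum' _ fun i hi => (hg i hi).aemeasurable]
      _ ≤ ENNReal.ofReal (Real.exp l) * ∫⁻ z, 1 ∂Q := by
          gcongr with z; exact hsum z
      _ = _ := by simp
  have hcard : (0 : ℝ) < s.card := by exact_mod_cast hne.card_pos
  have hreal : (s.card : ℝ) * (η / 2) ≤ Real.exp l := by
    rw [← ENNReal.ofReal_natCast, ← ENNReal.ofReal_mul (by positivity)] at htot
    exact (ENNReal.ofReal_le_ofReal_iff (Real.exp_pos _).le).1 htot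
  have hlog : Real.log s.card ≤ l + Real.log (2 / η) := by
    have : (s.card : ℝ) ≤ Real.exp l * (2 / η) := by
      rw [← mul_div_assoc, le_div_iff₀ hη]; linarith
    calc Real.log s.card ≤ Real.log (Real.exp l * (2 / η)) := Real.log_le_log hcard this
      _ = _ := by rw [Real.log_mul (Real.exp_pos _).ne' (by positivity), Real.log_exp]
  have habs : Real.log (2 / η) ≤ |Real.log (2 / η)| * √n :=
    (le_abs_self _).trans (le_mul_of_one_le_right (abs_nonneg _) hsq)
  rw [hl] at hlog
  linarith

end PackingBound

end

noncomputable section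

/-! ### Uniform laws on finite sets. -/

section UniformMeasure

variable {α : Type*} [MeasurableSpace α]

/-- The uniform law on a finite set. -/
def finsetUniform (s : Finset α) : Measure α := (s.card : ℝ≥0∞)⁻¹ • ∑ p ∈ s, Measure.dirac p

lemma isProbabilityMeasure_finsetUniform {s : Finset α} (hs : s.Nonempty) :
    IsProbabilityMeasure (finsetUniform s) := by
  constructor
  have : (s.card : ℝ≥0∞) ≠ 0 := by simpa using hs.ne_empty
  simp [finsetUniform, ENNReal.inv_mul_cancel this]

variable [Finite α] [MeasurableSingletonClass α]

lemma integral_finsetUniform (s : Finset α) (f : α → ℝ) :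
    ∫ p, f p ∂(finsetUniform s) = (∑ p ∈ s, f p) / s.card := by
  rw [finsetUniform, integral_smul_measure, integral_finsetSum_measure fun p _ => .of_finite]
  simp [div_eq_inv_mul]

open Classical in
lemma real_finsetUniform (s : Finset α) (E : Set α) :
    (finsetUniform s).real E = ((s.filter (· ∈ E)).card : ℝ) / s.card := by
  rw [← integral_indicator_one (Set.toFinite E).measurableSet, integral_finsetUniform]
  congr 1
  simp [Set.indicator_apply, Finset.sum_boole]

end UniformMeasure

/-! ### Extraction of a wrung subset of message pairs. -/

section WringingSubset

variable {I J : Type} [Fintype I] [Fintype J] [MeasurableSpace I] [MeasurableSpace J]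
  [MeasurableSingletonClass I] [MeasurableSingletonClass J]

open Classical in
/-- A dense set of pairs contains a large subset whose uniform law is nearly independent. -/
lemma exists_wrung_subset {Γ : Finset (I × J)} (hΓ : Γ.Nonempty) {c δ : ℝ} (hc : 0 < c)
    (hδ : 0 < δ) (hcΓ : c * (Fintype.card I * Fintype.card J) ≤ Γ.card) :
    ∃ Γ' ⊆ Γ, Γ'.Nonempty ∧ c ^ (1 / δ) * Γ.card ≤ Γ'.card ∧ Wrung δ (finsetUniform Γ') := by
  set N : Finset I × Finset J → ℝ := fun q => ((Γ ∩ q.1 ×ˢ q.2).card : ℝ) with hN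
  set F : Finset I × Finset J → ℝ := fun q => N q ^ (1 + δ) / (q.1.card * q.2.card) with hF
  -- A and B maximize |Γ ∩ A×B|^(1+δ)/(|A||B|). Maximality against subrectangles is the rectangle
  -- inequality for the uniform law on Γ ∩ A×B, with the uniform laws on A and B as reference
  -- measures. Comparison with the full rectangle bounds the size from below.
  obtain ⟨⟨A, B⟩, -, hmax⟩ := Finset.exists_max_image Finset.univ F Finset.univ_nonempty
  replace hmax : ∀ A' B', F (A', B') ≤ F (A, B) := fun A' B' => hmax (A', B') (Finset.mem_univ _)
  have hΓ0 : (0 : ℝ) < Γ.card := by exact_mod_cast hΓ.card_pos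
  obtain ⟨⟨i0, j0⟩, -⟩ := hΓ
  have hI : (0 : ℝ) < Fintype.card I := by exact_mod_cast Fintype.card_pos_iff.2 ⟨i0⟩
  have hJ : (0 : ℝ) < Fintype.card J := by exact_mod_cast Fintype.card_pos_iff.2 ⟨j0⟩
  have hge : c * (Γ.card : ℝ) ^ δ ≤ F (A, B) := by
    refine le_trans ?_ (hmax Finset.univ Finset.univ)
    simp only [hF, hN, Finset.univ_product_univ, Finset.inter_univ, Finset.card_univ]
    rw [le_div_iff₀ (by positivity), Real.rpow_add hΓ0, Real.rpow_one]
    have : (0 : ℝ) ≤ (Γ.card : ℝ) ^ δ := by positivity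
    nlinarith
  have hFpos : 0 < F (A, B) := lt_of_lt_of_le (by positivity) hge
  have hN0 : 0 ≤ N (A, B) := Nat.cast_nonneg _
  have hNpos : 0 < N (A, B) := by
    rcases hN0.eq_or_lt with h | h
    · simp only [hF, ← h] at hFpos
      rw [Real.zero_rpow (by positivity), zero_div] at hFpos
      exact absurd hFpos (lt_irrefl _)
    · exact h
  have hNle : N (A, B) ≤ A.card * B.card := by
    simp only [hN]
    exact_mod_cast (Finset.card_le_card Finset.inter_subset_right).trans
      (Finset.card_product A B).le
  have hAB : 0 < (A.card : ℝ) * B.card := lt_of_lt_of_le hNpos hNle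
  have hA : A.Nonempty := by
    rw [← Finset.card_pos]; by_contra h
    have : A.card = 0 := by omega
    simp [this] at hAB
  have hB : B.Nonempty := by
    rw [← Finset.card_pos]; by_contra h
    have : B.card = 0 := by omega
    simp [this] at hAB
  have hAc : (0 : ℝ) < A.card := by exact_mod_cast hA.card_pos
  have hBc : (0 : ℝ) < B.card := by exact_mod_cast hB.card_pos
  refine ⟨Γ ∩ A ×ˢ B, Finset.inter_subset_left, ?_, ?_, finsetUniform A, finsetUniform B,
    isProbabilityMeasure_finsetUniform hA, isProbabilityMeasure_finsetUniform hB, ?_⟩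
  · rw [← Finset.card_pos]; exact Nat.cast_pos.1 hNpos
  -- Since N ≤ |A||B|, the maximal value is at most N^δ; it is also at least c|Γ|^δ. Taking the root
  -- of order δ gives N ≥ c^(1/δ)|Γ|.
  · have h1 : F (A, B) ≤ N (A, B) ^ δ := by
      simp only [hF]
      rw [div_le_iff₀ hAB, Real.rpow_add hNpos, Real.rpow_one, mul_comm]
      exact mul_le_mul_of_nonneg_left hNle (by positivity)
    have h2 := Real.rpow_le_rpow (by positivity) (hge.trans h1) (z := 1 / δ) (by positivity)
    rw [Real.mul_rpow hc.le (by positivity), ← Real.rpow_mul hΓ0.le, ← Real.rpow_mul hN0,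
      mul_one_div_cancel hδ.ne', Real.rpow_one, Real.rpow_one] at h2
    exact h2
  · intro A' B' _ _
    rw [real_finsetUniform, real_finsetUniform, real_finsetUniform]
    set a := A.filter (· ∈ A')
    set b := B.filter (· ∈ B')
    have e : (Γ ∩ A ×ˢ B).filter (· ∈ A' ×ˢ B') = Γ ∩ a ×ˢ b := by
      ext p; simp only [a, b, Finset.mem_filter, Finset.mem_inter, Finset.mem_product, Set.mem_prod]
      tauto
    have e' : (((Γ ∩ A ×ˢ B).filter (· ∈ A' ×ˢ B')).card : ℝ) = N (a, b) := by
      simp only [hN]; rw [← e]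
    have h1 : N (a, b) ^ (1 + δ) ≤ F (A, B) * (a.card * b.card) := by
      rcases eq_or_ne ((a.card : ℝ) * b.card) 0 with h0 | h0
      · have : N (a, b) = 0 := by
          have hle : N (a, b) ≤ a.card * b.card := by
            simp only [hN]
            exact_mod_cast (Finset.card_le_card Finset.inter_subset_right).trans
              (Finset.card_product a b).le
          exact le_antisymm (by linarith) (Nat.cast_nonneg _)
        rw [this, h0, Real.zero_rpow (by positivity), mul_zero]
      · have := hmax a b
        have hp : 0 < (a.card : ℝ) * b.card := lt_of_le_of_ne (by positivity) (Ne.symm h0)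
        simp only [hF] at this ⊢
        rwa [div_le_iff₀ hp] at this
    refine le_trans (le_of_eq (b := (N (a, b) / N (A, B)) ^ (1 + δ)) ?_) ?_
    · rw [← e']; congr!
    rw [Real.div_rpow (Nat.cast_nonneg _) hN0, div_mul_div_comm, div_le_div_iff₀ (by positivity) hAB]
    calc N (a, b) ^ (1 + δ) * (A.card * B.card)
        ≤ F (A, B) * (a.card * b.card) * (A.card * B.card) :=
          mul_le_mul_of_nonneg_right h1 hAB.le
      _ = a.card * b.card * N (A, B) ^ (1 + δ) := by simp only [hF]; field_simp

end WringingSubset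

/-! ### Random signs with fourth-moment control. -/

section RandomSigns

/-- A finite family of vectors, isotropic in mean and with controlled fourth moments. -/
lemma exists_isotropic_family (n : ℕ) : ∃ (E : Type) (_ : Fintype E) (σ : E → Fin n → ℝ),
    0 < Fintype.card E ∧
    (∀ x y : Fin n → ℝ, ∑ e, (∑ t, x t * σ e t) * (∑ t, y t * σ e t) =
      Fintype.card E * ∑ t, x t * y t) ∧
    (∀ x : Fin n → ℝ, ∑ e, (∑ t, x t * σ e t) ^ 4 ≤
      Fintype.card E * (3 * (∑ t, x t ^ 2) ^ 2)) := by
  induction n with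
  | zero => exact ⟨Unit, inferInstance, fun _ _ => 0, by simp, by simp, by simp⟩
  | succ n ih =>
    obtain ⟨E, _, σ, h0, h2, h4⟩ := ih
    -- An independent fair sign is prepended. Odd terms cancel, and the mean fourth moment obeys a⁴
    -- + 6a²Q + 3Q² ≤ 3(a² + Q)² with a the new coordinate and Q the remaining squared norm.
    refine ⟨E × Bool, inferInstance, fun p => Fin.cons (if p.2 then 1 else -1) (σ p.1), ?_, ?_, ?_⟩
    · simpa using h0
    · intro x y
      rw [Fintype.sum_prod_type]
      simp only [Fin.sum_univ_succ, Fin.cons_zero, Fin.cons_succ, Fintype.sum_bool, Fintype.card_prod,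
        Fintype.card_bool, if_true, Bool.false_eq_true, if_false]
      have := h2 (fun t => x t.succ) (fun t => y t.succ)
      have e : ∀ X Y : ℝ, (x 0 * 1 + X) * (y 0 * 1 + Y) + (x 0 * -1 + X) * (y 0 * -1 + Y) =
          2 * (x 0 * y 0) + 2 * (X * Y) := fun X Y => by ring
      simp_rw [e]
      rw [Finset.sum_add_distrib, ← Finset.mul_sum (f := fun e => (∑ t, x (Fin.succ t) * σ e t) *
        ∑ t, y (Fin.succ t) * σ e t), this]
      simp
      ring
    · intro x
      rw [Fintype.sum_prod_type]
      simp only [Fin.sum_univ_succ, Fin.cons_zero, Fin.cons_succ, Fintype.sum_bool, Fintype.card_prod,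
        Fintype.card_bool, if_true, Bool.false_eq_true, if_false]
      have hh2 := h2 (fun t => x t.succ) (fun t => x t.succ)
      have hh4 := h4 (fun t => x t.succ)
      have e : ∀ X : ℝ, (x 0 * 1 + X) ^ 4 + (x 0 * -1 + X) ^ 4 =
          2 * x 0 ^ 4 + (12 * x 0 ^ 2 * (X * X) + 2 * X ^ 4) := fun X => by ring
      simp_rw [e]
      rw [Finset.sum_add_distrib, Finset.sum_add_distrib, ← Finset.mul_sum, ← Finset.mul_sum,
        ← Finset.mul_sum, hh2]
      have e3 : ∑ t : Fin n, x t.succ * x t.succ = ∑ t : Fin n, x t.succ ^ 2 :=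
        Finset.sum_congr rfl fun t _ => by ring
      rw [e3]
      set Q := ∑ t : Fin n, x t.succ ^ 2
      set k : ℝ := (Fintype.card E : ℝ)
      have hk : 0 ≤ k := Nat.cast_nonneg _
      have e4 : ∑ _e : E, x 0 ^ 4 = k * x 0 ^ 4 := by simp [k]
      rw [e4]
      push_cast
      have : 0 ≤ k * x 0 ^ 4 := by positivity
      nlinarith

end RandomSigns

/-! ### Mean inner products of nearly independent vectors. -/

section InnerCovariance

variable {I J : Type} [Fintype I] [Fintype J] [MeasurableSpace I] [MeasurableSpace J]
  [MeasurableSingletonClass I] [MeasurableSingletonClass J]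

lemma rpow_five_halves_le {x T : ℝ} (hT : 0 ≤ T) : min |x| T ^ (5 / 2 : ℝ) ≤ 1 + x ^ 4 := by
  have h0 : 0 ≤ min |x| T := le_min (abs_nonneg _) hT
  refine (Real.rpow_le_rpow h0 (min_le_left _ _) (by norm_num)).trans ?_
  rcases le_total |x| 1 with h | h
  · have := Real.rpow_le_one (abs_nonneg x) h (z := 5 / 2) (by norm_num)
    have : 0 ≤ x ^ 4 := by positivity
    linarith
  · calc |x| ^ (5 / 2 : ℝ) ≤ |x| ^ (4 : ℝ) := Real.rpow_le_rpow_of_exponent_le h (by norm_num)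
      _ = x ^ 4 := by
          rw [show (4 : ℝ) = ((4 : ℕ) : ℝ) by norm_num, Real.rpow_natCast]
          exact Even.pow_abs (by decide) x
      _ ≤ _ := by linarith

lemma sq_integral_le_integral_sq {Ω : Type*} [MeasurableSpace Ω] {μ : Measure Ω}
    [IsProbabilityMeasure μ] {f : Ω → ℝ} (hf : MemLp f 2 μ) :
    (∫ ω, f ω ∂μ) ^ 2 ≤ ∫ ω, f ω ^ 2 ∂μ := by
  have h := variance_eq_sub hf
  have := variance_nonneg f μ
  simp only [Pi.pow_apply] at h
  linarith

/-- When fourth moments are available, they bound the truncated moments uniformly in the cut-off.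
The choice T = 1/δ² then makes the whole error linear in δ, with no need of a penalty. -/
lemma Wrung.abs_cov_le_fourth {δ : ℝ} {μ : Measure (I × J)} [IsProbabilityMeasure μ]
    (h : Wrung δ μ) (hδ : 0 < δ) (hδ1 : δ ≤ 1 / 15) (f : I → ℝ) (g : J → ℝ) :
    |∫ z, f z.1 * g z.2 ∂μ - (∫ z, f z.1 ∂μ) * ∫ z, g z.2 ∂μ| ≤
      1200 * δ * (1 + ∫ z, f z.1 ^ 4 ∂μ + ∫ z, g z.2 ^ 4 ∂μ) := by
  set vf := ∫ z, f z.1 ^ 2 ∂μ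
  set vg := ∫ z, g z.2 ^ 2 ∂μ
  have vf0 : 0 ≤ vf := integral_nonneg fun _ => sq_nonneg _
  have vg0 : 0 ≤ vg := integral_nonneg fun _ => sq_nonneg _
  have hc := h.abs_cov_le hδ.le hδ1 (f := f) (g := g) (measurable_of_finite f)
    (measurable_of_finite g) (V := 1 + vf + vg) (T := (1 / δ) ^ 2) (by linarith) (by positivity)
    .of_finite .of_finite (by linarith) (by linarith)
  rw [Real.sqrt_sq (by positivity)] at hc
  have hT : 0 ≤ (1 / δ) ^ 2 := by positivity
  have b1 : ∫ z, min |f z.1| ((1 / δ) ^ 2) ^ (5 / 2 : ℝ) ∂μ ≤ 1 + ∫ z, f z.1 ^ 4 ∂μ := by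
    have : ∫ z, (1 + f z.1 ^ 4) ∂μ = 1 + ∫ z, f z.1 ^ 4 ∂μ := by
      rw [integral_add .of_finite .of_finite]; simp
    rw [← this]
    exact integral_mono .of_finite .of_finite fun z => rpow_five_halves_le hT
  have b2 : ∫ z, min |g z.2| ((1 / δ) ^ 2) ^ (5 / 2 : ℝ) ∂μ ≤ 1 + ∫ z, g z.2 ^ 4 ∂μ := by
    have : ∫ z, (1 + g z.2 ^ 4) ∂μ = 1 + ∫ z, g z.2 ^ 4 ∂μ := by
      rw [integral_add .of_finite .of_finite]; simp
    rw [← this]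
    exact integral_mono .of_finite .of_finite fun z => rpow_five_halves_le hT
  have s1 : vf ^ 2 ≤ ∫ z, f z.1 ^ 4 ∂μ := by
    have := sq_integral_le_integral_sq (μ := μ) (f := fun z => f z.1 ^ 2)
      ((memLp_two_iff_integrable_sq (measurable_of_finite _).aestronglyMeasurable).2 .of_finite)
    simpa only [← pow_mul] using this
  have s2 : vg ^ 2 ≤ ∫ z, g z.2 ^ 4 ∂μ := by
    have := sq_integral_le_integral_sq (μ := μ) (f := fun z => g z.2 ^ 2)
      ((memLp_two_iff_integrable_sq (measurable_of_finite _).aestronglyMeasurable).2 .of_finite)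
    simpa only [← pow_mul] using this
  set Ff := ∫ z, f z.1 ^ 4 ∂μ
  set Fg := ∫ z, g z.2 ^ 4 ∂μ
  refine hc.trans ?_
  have hV : (1 + vf + vg) ^ 2 ≤ 3 * (1 + Ff + Fg) := by
    nlinarith [sq_nonneg (vf - 1), sq_nonneg (vg - 1), sq_nonneg (vf - vg)]
  have e : 192 * (1 + vf + vg) ^ 2 / (1 / δ) = δ * (192 * (1 + vf + vg) ^ 2) := by field_simp
  have t1 := mul_le_mul_of_nonneg_left hV hδ.le
  have t2 := mul_le_mul_of_nonneg_left (add_le_add b1 b2) hδ.le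
  have f0 : 0 ≤ Ff := (sq_nonneg _).trans s1
  have g0 : 0 ≤ Fg := (sq_nonneg _).trans s2
  have t3 := mul_nonneg hδ.le f0
  have t4 := mul_nonneg hδ.le g0
  rw [e]
  linarith

/-- The mean inner product of nearly independent bounded vectors almost factorizes. -/
lemma Wrung.inner_cov_le {δ : ℝ} {μ : Measure (I × J)} [IsProbabilityMeasure μ]
    (h : Wrung δ μ) (hδ : 0 < δ) (hδ1 : δ ≤ 1 / 15) {n : ℕ} (hn : 0 < n) (x : I → Fin n → ℝ)
    (y : J → Fin n → ℝ) {S₁ S₂ : ℝ} (hx : ∀ i, ∑ t, x i t ^ 2 ≤ n * S₁)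
    (hy : ∀ j, ∑ t, y j t ^ 2 ≤ n * S₂) :
    ∑ t, (∫ z, x z.1 t * y z.2 t ∂μ - (∫ z, x z.1 t ∂μ) * ∫ z, y z.2 t ∂μ) ≤
      n * (1200 * δ * (1 + 3 * S₁ ^ 2 + 3 * S₂ ^ 2)) := by
  -- Coordinate by coordinate one would meet the sum of x_t⁴, which can be of order n² when a
  -- codeword concentrates its energy. A random projection divided by √n has mean fourth moment at
  -- most 3S², and averaging products of projections recovers the inner product.
  obtain ⟨E, _, σ, h0, h2, h4⟩ := exists_isotropic_family n
  have hn0 : (0 : ℝ) < n := by exact_mod_cast hn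
  have hE0 : (0 : ℝ) < Fintype.card E := by exact_mod_cast h0
  set F : E → I → ℝ := fun e i => ∑ t, x i t * σ e t with hF
  set G : E → J → ℝ := fun e j => ∑ t, y j t * σ e t with hG
  have key : ∀ e, ∫ z, F e z.1 * G e z.2 ∂μ - (∫ z, F e z.1 ∂μ) * ∫ z, G e z.2 ∂μ ≤
      1200 * δ * (n + (∫ z, F e z.1 ^ 4 ∂μ) / n + (∫ z, G e z.2 ^ 4 ∂μ) / n) := by
    intro e
    have hc := (le_abs_self _).trans
      (h.abs_cov_le_fourth hδ hδ1 (fun i => F e i / √n) (fun j => G e j / √n))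
    have hs : √(n : ℝ) * √n = n := Real.mul_self_sqrt hn0.le
    have hs4 : √(n : ℝ) ^ 4 = n ^ 2 := by
      rw [show √(n : ℝ) ^ 4 = (√n * √n) ^ 2 by ring, hs]
    simp only [div_pow, div_mul_div_comm, integral_div, hs, hs4] at hc
    rw [← sub_div, div_le_iff₀ hn0] at hc
    refine hc.trans (le_of_eq ?_)
    field_simp
  have hsum := Finset.sum_le_sum fun e (_ : e ∈ Finset.univ) => key e
  have eL : ∑ e, (∫ z, F e z.1 * G e z.2 ∂μ - (∫ z, F e z.1 ∂μ) * ∫ z, G e z.2 ∂μ) =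
      Fintype.card E * ∑ t, (∫ z, x z.1 t * y z.2 t ∂μ -
        (∫ z, x z.1 t ∂μ) * ∫ z, y z.2 t ∂μ) := by
    rw [Finset.sum_sub_distrib, Finset.sum_sub_distrib, mul_sub]
    congr 1
    · rw [← integral_finsetSum _ fun _ _ => .of_finite, ← integral_finsetSum _ fun _ _ => .of_finite,
        ← integral_const_mul]
      congr 1; ext z
      exact h2 (x z.1) (y z.2)
    · have eF : ∀ e, ∫ z, F e z.1 ∂μ = ∑ t, (∫ z, x z.1 t ∂μ) * σ e t := fun e => by
        simp only [hF]
        rw [integral_finsetSum _ fun _ _ => .of_finite]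
        exact Finset.sum_congr rfl fun t _ => integral_mul_const _ _
      have eG : ∀ e, ∫ z, G e z.2 ∂μ = ∑ t, (∫ z, y z.2 t ∂μ) * σ e t := fun e => by
        simp only [hG]
        rw [integral_finsetSum _ fun _ _ => .of_finite]
        exact Finset.sum_congr rfl fun t _ => integral_mul_const _ _
      simp_rw [eF, eG]
      exact h2 _ _
  have b1 : ∑ e, ∫ z, F e z.1 ^ 4 ∂μ ≤ Fintype.card E * (3 * (n * S₁) ^ 2) := by
    rw [← integral_finsetSum _ fun _ _ => .of_finite]
    calc _ ≤ ∫ _z, (Fintype.card E * (3 * (n * S₁) ^ 2) : ℝ) ∂μ := by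
          refine integral_mono .of_finite .of_finite fun z => (h4 (x z.1)).trans ?_
          gcongr
          exact hx z.1
      _ = _ := by simp
  have b2 : ∑ e, ∫ z, G e z.2 ^ 4 ∂μ ≤ Fintype.card E * (3 * (n * S₂) ^ 2) := by
    rw [← integral_finsetSum _ fun _ _ => .of_finite]
    calc _ ≤ ∫ _z, (Fintype.card E * (3 * (n * S₂) ^ 2) : ℝ) ∂μ := by
          refine integral_mono .of_finite .of_finite fun z => (h4 (y z.2)).trans ?_
          gcongr
          exact hy z.2
      _ = _ := by simp
  rw [eL] at hsum
  have eR : ∑ e, 1200 * δ * (n + (∫ z, F e z.1 ^ 4 ∂μ) / n + (∫ z, G e z.2 ^ 4 ∂μ) / n) =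
      1200 * δ * (Fintype.card E * n + (∑ e, ∫ z, F e z.1 ^ 4 ∂μ) / n +
        (∑ e, ∫ z, G e z.2 ^ 4 ∂μ) / n) := by
    rw [← Finset.mul_sum, Finset.sum_add_distrib, Finset.sum_add_distrib, Finset.sum_div,
      Finset.sum_div]
    simp
  rw [eR] at hsum
  refine le_of_mul_le_mul_left (hsum.trans ?_) hE0
  calc 1200 * δ * (Fintype.card E * n + (∑ e, ∫ z, F e z.1 ^ 4 ∂μ) / n +
        (∑ e, ∫ z, G e z.2 ^ 4 ∂μ) / n)
      ≤ 1200 * δ * (Fintype.card E * n + (Fintype.card E * (3 * (n * S₁) ^ 2)) / n +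
        (Fintype.card E * (3 * (n * S₂) ^ 2)) / n) := by gcongr
    _ = _ := by field_simp

end InnerCovariance

end

noncomputable section

/-! ### The sum-rate converse. -/

section SumRate

lemma integral_add_sub_sq_le {Ω : Type*} [MeasurableSpace Ω] [Finite Ω] [MeasurableSingletonClass Ω]
    (μ : Measure Ω) [IsProbabilityMeasure μ] (X Y : Ω → ℝ) :
    ∫ z, (X z + Y z - (∫ z, X z ∂μ + ∫ z, Y z ∂μ)) ^ 2 ∂μ ≤ ∫ z, X z ^ 2 ∂μ + ∫ z, Y z ^ 2 ∂μ +
      2 * (∫ z, X z * Y z ∂μ - (∫ z, X z ∂μ) * ∫ z, Y z ∂μ) := by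
  set a := ∫ z, X z ∂μ with ha
  set b := ∫ z, Y z ∂μ with hb
  have i : ∀ f : Ω → ℝ, Integrable f μ := fun f => .of_finite
  have e : ∀ z, (X z + Y z - (a + b)) ^ 2 =
      X z ^ 2 + Y z ^ 2 + 2 * (X z * Y z) + (-2 * (a + b)) * X z + (-2 * (a + b)) * Y z +
        (a + b) ^ 2 := fun z => by ring
  simp_rw [e]
  rw [integral_add (i _) (i _), integral_add (i _) (i _), integral_add (i _) (i _),
    integral_add (i _) (i _), integral_add (i _) (i _), integral_const_mul, integral_const_mul,
    integral_const_mul, integral_const, probReal_univ, one_smul, ← ha, ← hb]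
  nlinarith [sq_nonneg a, sq_nonneg b]

/-- The mean squared distance to the mean is the total variance of the sum: at most the two energies
plus twice the covariances, which `Wrung.inner_cov_le` controls. -/
lemma Wrung.integral_sqDist_le {I J : Type} [Fintype I] [Fintype J] [MeasurableSpace I]
    [MeasurableSpace J] [MeasurableSingletonClass I] [MeasurableSingletonClass J] {δ : ℝ}
    {μ : Measure (I × J)} [IsProbabilityMeasure μ]
    (h : Wrung δ μ) (hδ : 0 < δ) (hδ1 : δ ≤ 1 / 15) {n : ℕ} (hn : 0 < n) (x : I → Fin n → ℝ)
    (y : J → Fin n → ℝ) {S₁ S₂ : ℝ} (hx : ∀ i, ∑ t, x i t ^ 2 ≤ n * S₁)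
    (hy : ∀ j, ∑ t, y j t ^ 2 ≤ n * S₂) :
    ∫ z, sqDist (fun t => x z.1 t + y z.2 t)
        (fun t => ∫ z, x z.1 t ∂μ + ∫ z, y z.2 t ∂μ) ∂μ ≤
      n * (S₁ + S₂) + 2 * (n * (1200 * δ * (1 + 3 * S₁ ^ 2 + 3 * S₂ ^ 2))) := by
  have h1 : ∑ t, ∫ z, x z.1 t ^ 2 ∂μ ≤ n * S₁ := by
    rw [← integral_finsetSum _ fun _ _ => .of_finite]
    calc _ ≤ ∫ _z, (n * S₁ : ℝ) ∂μ := integral_mono .of_finite .of_finite fun z => hx z.1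
      _ = _ := by simp
  have h2 : ∑ t, ∫ z, y z.2 t ^ 2 ∂μ ≤ n * S₂ := by
    rw [← integral_finsetSum _ fun _ _ => .of_finite]
    calc _ ≤ ∫ _z, (n * S₂ : ℝ) ∂μ := integral_mono .of_finite .of_finite fun z => hy z.2
      _ = _ := by simp
  have h3 := h.inner_cov_le hδ hδ1 hn x y hx hy
  unfold sqDist
  rw [integral_finsetSum _ fun _ _ => .of_finite]
  refine (Finset.sum_le_sum fun t _ =>
    integral_add_sub_sq_le μ (fun z => x z.1 t) (fun z => y z.2 t)).trans ?_
  rw [Finset.sum_add_distrib, Finset.sum_add_distrib, ← Finset.mul_sum]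
  linarith

open Classical in
/-- The sum-rate converse for deterministic codebooks. -/
theorem exists_log_add_log_le {S₁ S₂ η c : ℝ} (hS₁ : 0 ≤ S₁) (hS₂ : 0 ≤ S₂) (hη : 0 < η)
    (hc : 0 < c) :
    ∃ K : ℝ, 0 ≤ K ∧ ∀ (n : ℕ) (_ : 225 ≤ n) (M₁ M₂ : ℕ) (_ : 0 < M₁) (_ : 0 < M₂)
      (x : Fin M₁ → Fin n → ℝ) (y : Fin M₂ → Fin n → ℝ) (Γ : Finset (Fin M₁ × Fin M₂))
      (g : Fin M₁ × Fin M₂ → (Fin n → ℝ) → ℝ≥0∞), (∀ i, ∑ t, x i t ^ 2 ≤ n * S₁) →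
      (∀ j, ∑ t, y j t ^ 2 ≤ n * S₂) → c * (M₁ * M₂) ≤ Γ.card → (∀ p, Measurable (g p)) →
      (∀ z, ∑ p, g p z ≤ 1) → (∀ p ∈ Γ, ENNReal.ofReal η ≤
        ∫⁻ z, g p z ∂(gaussianVec (fun t => x p.1 t + y p.2 t) 1)) →
      Real.log M₁ + Real.log M₂ ≤ n * (Real.log (1 + (S₁ + S₂)) / 2) + K * √n := by
  set C := 2 * (1200 * (1 + 3 * S₁ ^ 2 + 3 * S₂ ^ 2)) with hC
  have hC0 : 0 ≤ C := by positivity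
  obtain ⟨K, hK, H⟩ := exists_log_card_le (S := S₁ + S₂) (k := C + 1) (add_nonneg hS₁ hS₂)
    (by linarith) hη
  set D := S₁ + S₂ + C + 1 with hD
  have hD0 : 0 < D := by positivity
  refine ⟨K + 1 + D + 2 * |Real.log c|, by positivity, ?_⟩
  intro n hn M₁ M₂ hM₁ hM₂ x y Γ g hx hy hΓ hg hsum hInt
  have hn0 : 0 < n := by omega
  have hnR : (225 : ℝ) ≤ n := by exact_mod_cast hn
  have hs15 : (15 : ℝ) ≤ √n := Real.le_sqrt_of_sq_le (by linarith)
  have hss : √(n : ℝ) * √n = n := Real.mul_self_sqrt (by linarith)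
  have hm1 : (0 : ℝ) < M₁ := by exact_mod_cast hM₁
  have hm2 : (0 : ℝ) < M₂ := by exact_mod_cast hM₂
  have hΓ0 : (0 : ℝ) < Γ.card := lt_of_lt_of_le (by positivity) hΓ
  have hΓne : Γ.Nonempty := by rw [← Finset.card_pos]; exact_mod_cast hΓ0
  -- This choice balances two losses of order √n: extracting the subset costs a factor c^(1/δ) =
  -- c^√n, and the covariance adds nδ = √n to the squared distance. The assumption n ≥ 225 gives δ ≤
  -- 1/15.
  set δ : ℝ := 1 / √n with hδ
  have hδ0 : 0 < δ := by positivity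
  have hδ1 : δ ≤ 1 / 15 := one_div_le_one_div_of_le (by norm_num) hs15
  obtain ⟨Γ', hsub, hne, hcard, hw⟩ := exists_wrung_subset hΓne hc hδ0 (by simpa using hΓ)
  have hpm := isProbabilityMeasure_finsetUniform hne
  have hmean := hw.integral_sqDist_le hδ0 hδ1 hn0 x y hx hy
  set v : Fin n → ℝ := fun t => ∫ z, x z.1 t ∂(finsetUniform Γ') + ∫ z, y z.2 t ∂(finsetUniform Γ')
    with hv
  rw [integral_finsetUniform] at hmean
  have hN0 : (0 : ℝ) < Γ'.card := by exact_mod_cast hne.card_pos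
  have et : n * (S₁ + S₂) + 2 * (n * (1200 * δ * (1 + 3 * S₁ ^ 2 + 3 * S₂ ^ 2))) =
      n * (S₁ + S₂) + C * √n := by
    have : (n : ℝ) * δ = √n := by rw [hδ, mul_one_div, Real.div_sqrt]
    rw [hC, ← this]; ring
  rw [et, div_le_iff₀ hN0] at hmean
  set d : Fin M₁ × Fin M₂ → ℝ := fun p => sqDist (fun t => x p.1 t + y p.2 t) v with hd
  -- The threshold exceeds the bound on the mean by √n. By Markov's inequality at least a fraction
  -- 1/(D√n) of the pairs lies below it, and the logarithm of this fraction is absorbed in the O(√n)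
  -- term.
  set τ : ℝ := n * (S₁ + S₂) + (C + 1) * √n with hτ
  set Γ'' := Γ'.filter fun p => d p ≤ τ with hΓ''
  have hmarkov : (Γ'.card : ℝ) * √n ≤ Γ''.card * τ := by
    have h1 : ((Γ'.card : ℝ) - Γ''.card) * τ ≤ ∑ p ∈ Γ', d p := by
      have hsplit := Finset.card_filter_add_card_filter_not (s := Γ') (fun p => d p ≤ τ)
      have : ((Γ'.card : ℝ) - Γ''.card) = ((Γ'.filter fun p => ¬ d p ≤ τ).card : ℝ) := by
        rw [← hsplit]; push_cast; rw [← hΓ'']; ring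
      rw [this, ← nsmul_eq_mul, ← Finset.sum_const]
      calc _ ≤ ∑ p ∈ Γ'.filter fun p => ¬ d p ≤ τ, d p :=
            Finset.sum_le_sum fun p hp => (not_le.1 (Finset.mem_filter.1 hp).2).le
        _ ≤ _ := Finset.sum_le_sum_of_subset_of_nonneg (Finset.filter_subset _ _)
            fun p _ _ => sqDist_nonneg _ _
    have h2 := h1.trans hmean
    have h3 : (n * (S₁ + S₂) + C * √n) * Γ'.card = Γ'.card * τ - Γ'.card * √n := by rw [hτ]; ring
    rw [h3, sub_mul] at h2
    linarith
  have hτle : τ ≤ √n * √n * D := by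
    rw [hss, hτ, hD]
    have h1 : √(n : ℝ) ≤ n := Real.sqrt_le_iff.2 ⟨by linarith, le_self_pow₀ (by linarith) two_ne_zero⟩
    have h2 := mul_le_mul_of_nonneg_left h1 (show 0 ≤ C + 1 by linarith)
    linarith
  have hcount : (Γ'.card : ℝ) ≤ Γ''.card * (√n * D) := by
    have h1 : (Γ'.card : ℝ) * √n ≤ (Γ''.card * (√n * D)) * √n :=
      hmarkov.trans ((mul_le_mul_of_nonneg_left hτle (Nat.cast_nonneg _)).trans (le_of_eq (by ring)))
    exact le_of_mul_le_mul_right h1 (by linarith)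
  have hN''0 : (0 : ℝ) < Γ''.card := by
    by_contra h
    have : (Γ''.card : ℝ) = 0 := le_antisymm (not_lt.1 h) (Nat.cast_nonneg _)
    rw [this, zero_mul] at hcount
    linarith
  have hlog := H n hn0 _ Γ'' v (fun p t => x p.1 t + y p.2 t) g (fun p _ => hg p)
    (fun z => (Finset.sum_le_sum_of_subset (Finset.subset_univ _)).trans (hsum z))
    (fun p hp => (Finset.mem_filter.1 hp).2)
    (fun p hp => hInt p (hsub (Finset.mem_filter.1 hp).1))
  have hprod : c * (M₁ * M₂) * c ^ √n ≤ Γ''.card * (√n * D) := by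
    refine le_trans ?_ hcount
    have e : (1 : ℝ) / δ = √n := by rw [hδ, one_div_one_div]
    rw [e] at hcard
    refine le_trans ?_ hcard
    rw [mul_comm]
    exact mul_le_mul_of_nonneg_left hΓ (by positivity)
  have hfin := Real.log_le_log (by positivity) hprod
  rw [Real.log_mul (by positivity) (by positivity), Real.log_mul (by positivity) (by positivity),
    Real.log_mul (by positivity) (by positivity), Real.log_rpow hc,
    Real.log_mul (by positivity) (by positivity), Real.log_mul (by positivity) (by positivity)]
    at hfin
  have hc1 : -Real.log c ≤ |Real.log c| := neg_le_abs _
  have a1 : Real.log √n ≤ √n := Real.log_le_self (by linarith)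
  have a2 : Real.log D ≤ D * √n := (Real.log_le_self hD0.le).trans
    (le_mul_of_one_le_right hD0.le (by linarith))
  have a3 : -Real.log c - √n * Real.log c ≤ 2 * |Real.log c| * √n := by
    have h1 := mul_le_mul_of_nonneg_right hc1 (Real.sqrt_nonneg (n : ℝ))
    have h2 : |Real.log c| ≤ |Real.log c| * √n :=
      le_mul_of_one_le_right (abs_nonneg _) (by linarith)
    linarith
  linarith

end SumRate

/-! ### Reduction to deterministic codebooks. -/

section Derandomize

lemma gaussianVec_eq_map {n : ℕ} (c : Fin n → ℝ) (v : ℝ≥0) :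
    gaussianVec c v = (gaussianVec 0 v).map fun z => z + c := by
  unfold gaussianVec
  have := Measure.pi_map_pi (μ := fun _ : Fin n => gaussianReal 0 v) (f := fun t z => z + c t)
    (fun t => by fun_prop)
  simp only [gaussianReal_map_add_const, zero_add] at this
  exact this.symm

lemma lintegral_gaussianVec {n : ℕ} (c : Fin n → ℝ) (v : ℝ≥0) {g : (Fin n → ℝ) → ℝ≥0∞}
    (hg : Measurable g) :
    ∫⁻ z, g z ∂(gaussianVec c v) = ∫⁻ z, g (z + c) ∂(gaussianVec 0 v) := by
  rw [gaussianVec_eq_map, lintegral_map hg (by fun_prop)]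

lemma measurable_lintegral_gaussianVec {n : ℕ} {α : Type*} [MeasurableSpace α] (v : ℝ≥0)
    {c : α → Fin n → ℝ} (hc : Measurable c) {g : (Fin n → ℝ) → ℝ≥0∞} (hg : Measurable g) :
    Measurable fun a => ∫⁻ z, g z ∂(gaussianVec (c a) v) := by
  simp_rw [lintegral_gaussianVec _ v hg]
  have : Measurable fun p : α × (Fin n → ℝ) => g (p.2 + c p.1) := hg.comp (by fun_prop)
  exact this.lintegral_prod_right'

variable {S₁ S₂ : ℝ} {n M₁ M₂ : ℕ}

lemma pi_gaussianMAC_W (x y : Fin n → ℝ) :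
    (Measure.pi fun t => (gaussianMAC S₁ S₂).W (x t, y t)) =
      gaussianVec (fun t => x t + y t) 1 := rfl

lemma lintegral_pi_prod_sum {α β : Type*} [MeasurableSpace α] [MeasurableSpace β]
    (P : Fin M₁ → Measure α) (Q : Fin M₂ → Measure β) [∀ i, IsProbabilityMeasure (P i)]
    [∀ j, IsProbabilityMeasure (Q j)] (e : Fin M₁ → Fin M₂ → α → β → ℝ≥0∞)
    (me : ∀ i j, Measurable fun p : α × β => e i j p.1 p.2) :
    ∫⁻ q, ∑ i, ∑ j, e i j (q.1 i) (q.2 j) ∂((Measure.pi P).prod (Measure.pi Q)) =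
      ∑ i, ∑ j, ∫⁻ x, ∫⁻ y, e i j x y ∂(Q j) ∂(P i) := by
  have mcomp : ∀ i j, Measurable fun q : (Fin M₁ → α) × (Fin M₂ → β) => e i j (q.1 i) (q.2 j) :=
    fun i j => (me i j).comp (by fun_prop : Measurable fun q : (Fin M₁ → α) × (Fin M₂ → β) =>
      (q.1 i, q.2 j))
  rw [lintegral_finsetSum _ fun i _ => Finset.measurable_fun_sum _ fun j _ => mcomp i j]
  refine Finset.sum_congr rfl fun i _ => ?_
  rw [lintegral_finsetSum _ fun j _ => mcomp i j]
  refine Finset.sum_congr rfl fun j _ => ?_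
  rw [lintegral_prod _ (mcomp i j).aemeasurable]
  have h1 : ∀ x : α, ∫⁻ Y, e i j x (Y j) ∂(Measure.pi Q) = ∫⁻ y, e i j x y ∂(Q j) := fun x =>
    (measurePreserving_eval Q j).lintegral_comp ((me i j).comp measurable_prodMk_left)
  simp_rw [h1]
  have m2 : Measurable fun x => ∫⁻ y, e i j x y ∂(Q j) := (me i j).lintegral_prod_right'
  exact (measurePreserving_eval P i).lintegral_comp m2

lemma MAC.Code.sum_sq_le₁ (hn : 0 < n) (c : (gaussianMAC S₁ S₂).Code n M₁ M₂) (i : Fin M₁) :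
    ∀ᵐ x ∂(c.enc₁ i), ∑ t, x t ^ 2 ≤ n * S₁ := by
  have hnR : (0 : ℝ) < n := by exact_mod_cast hn
  refine (c.cost₁ i).mono fun x hx => ?_
  have hx' : (1 / (n : ℝ)) * ∑ t, x t ^ 2 ≤ S₁ := hx
  rwa [one_div, inv_mul_le_iff₀ hnR] at hx'

lemma MAC.Code.sum_sq_le₂ (hn : 0 < n) (c : (gaussianMAC S₁ S₂).Code n M₁ M₂) (j : Fin M₂) :
    ∀ᵐ y ∂(c.enc₂ j), ∑ t, y t ^ 2 ≤ n * S₂ := by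
  have hnR : (0 : ℝ) < n := by exact_mod_cast hn
  refine (c.cost₂ j).mono fun x hx => ?_
  have hx' : (1 / (n : ℝ)) * ∑ t, x t ^ 2 ≤ S₂ := hx
  rwa [one_div, inv_mul_le_iff₀ hnR] at hx'

lemma ae_pi_eval {ι α : Type*} [Fintype ι] [MeasurableSpace α] (P : ι → Measure α)
    [∀ i, IsProbabilityMeasure (P i)] (i : ι) {p : α → Prop} (h : ∀ᵐ x ∂(P i), p x) :
    ∀ᵐ X ∂(Measure.pi P), p (X i) :=
  (measurePreserving_eval P i).quasiMeasurePreserving.ae h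

/-- Draw all codewords independently from the encoders. The mean of the summed error is that of the
stochastic code, so some realization outside the null set of bad codewords does at least as well. -/
lemma exists_pi_prod_le {α β : Type*} [MeasurableSpace α] [MeasurableSpace β]
    (P : Fin M₁ → Measure α) (Q : Fin M₂ → Measure β) [∀ i, IsProbabilityMeasure (P i)]
    [∀ j, IsProbabilityMeasure (Q j)] (e : Fin M₁ → Fin M₂ → α → β → ℝ≥0∞)
    (me : ∀ i j, Measurable fun p : α × β => e i j p.1 p.2) {p : α → Prop} {q : β → Prop}
    (hp : ∀ i, ∀ᵐ x ∂(P i), p x) (hq : ∀ j, ∀ᵐ y ∂(Q j), q y) :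
    ∃ (x : Fin M₁ → α) (y : Fin M₂ → β), (∀ i, p (x i)) ∧ (∀ j, q (y j)) ∧
      ∑ i, ∑ j, e i j (x i) (y j) ≤ ∑ i, ∑ j, ∫⁻ x, ∫⁻ y, e i j x y ∂(Q j) ∂(P i) := by
  have mcomp : ∀ i j, Measurable fun q : (Fin M₁ → α) × (Fin M₂ → β) => e i j (q.1 i) (q.2 j) :=
    fun i j => (me i j).comp (by fun_prop : Measurable fun q : (Fin M₁ → α) × (Fin M₂ → β) =>
      (q.1 i, q.2 j))
  have ae1 : ∀ᵐ z ∂((Measure.pi P).prod (Measure.pi Q)), ∀ i, p (z.1 i) :=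
    ae_all_iff.2 fun i => Measure.quasiMeasurePreserving_fst.ae (ae_pi_eval P i (hp i))
  have ae2 : ∀ᵐ z ∂((Measure.pi P).prod (Measure.pi Q)), ∀ j, q (z.2 j) :=
    ae_all_iff.2 fun j => Measure.quasiMeasurePreserving_snd.ae (ae_pi_eval Q j (hq j))
  obtain ⟨z, hz, hle⟩ := exists_notMem_null_le_lintegral
    (μ := (Measure.pi P).prod (Measure.pi Q)) (f := fun z => ∑ i, ∑ j, e i j (z.1 i) (z.2 j))
    (Finset.measurable_fun_sum _ fun i _ =>
      Finset.measurable_fun_sum _ fun j _ => mcomp i j).aemeasurable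
    (ae_iff.1 (ae1.and ae2))
  simp only [Set.mem_ofPred_eq, not_not] at hz
  exact ⟨z.1, z.2, hz.1, hz.2, hle.trans (lintegral_pi_prod_sum P Q e me).le⟩

/-- Some deterministic codebooks are at least as good as the stochastic encoders. -/
lemma exists_codebook (hn : 0 < n) (c : (gaussianMAC S₁ S₂).Code n M₁ M₂) :
    ∃ (x : Fin M₁ → Fin n → ℝ) (y : Fin M₂ → Fin n → ℝ), (∀ i, ∑ t, x i t ^ 2 ≤ n * S₁) ∧
      (∀ j, ∑ t, y j t ^ 2 ≤ n * S₂) ∧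
      ∑ i, ∑ j, ∫⁻ z, c.dec z {(i, j)}ᶜ ∂(gaussianVec (fun t => x i t + y j t) 1) ≤
        ∑ i, ∑ j, ∫⁻ x, ∫⁻ y, ∫⁻ z, c.dec z {(i, j)}ᶜ
          ∂(Measure.pi fun t => (gaussianMAC S₁ S₂).W (x t, y t)) ∂(c.enc₂ j) ∂(c.enc₁ i) := by
  have := c.enc₁_markov
  have := c.enc₂_markov
  simp only [pi_gaussianMAC_W]
  have md : ∀ i j, Measurable fun z => c.dec z {(i, j)}ᶜ := fun i j =>
    Kernel.measurable_coe _ (Set.toFinite _).measurableSet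
  have mc : Measurable fun p : (Fin n → ℝ) × (Fin n → ℝ) => fun t => p.1 t + p.2 t := by fun_prop
  exact exists_pi_prod_le (fun i => c.enc₁ i) (fun j => c.enc₂ j)
    (fun i j x y => ∫⁻ z, c.dec z {(i, j)}ᶜ ∂(gaussianVec (fun t => x t + y t) 1))
    (fun i j => measurable_lintegral_gaussianVec 1 mc (md i j))
    (fun i => c.sum_sq_le₁ hn i) (fun j => c.sum_sq_le₂ hn j)

end Derandomize

/-! ### The converse for all three rate constraints. -/

section Converse

/-- Keeping a constant fraction c of the messages changes log M by at most |log c|, which is at most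
|log c|√n. -/
lemma log_card_filter {M : ℕ} (hM : 0 < M) {c : ℝ} (hc : 0 < c) {s : Finset (Fin M)}
    (hs : c * M ≤ s.card) {n : ℕ} (hn : 0 < n) {L K : ℝ}
    (h : Real.log s.card ≤ n * L + K * √n) :
    Real.log M ≤ n * L + (K + |Real.log c|) * √n := by
  have hMR : (0 : ℝ) < M := by exact_mod_cast hM
  have h1 := Real.log_le_log (by positivity) hs
  rw [Real.log_mul hc.ne' hMR.ne'] at h1
  have hsq : (1 : ℝ) ≤ √n := Real.one_le_sqrt.2 (by exact_mod_cast hn)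
  have h2 : -Real.log c ≤ |Real.log c| * √n :=
    (neg_le_abs _).trans (le_mul_of_one_le_right (abs_nonneg _) hsq)
  linarith

open Classical in
/-- The converse: rate bounds for codes whose error probability is bounded away from `1`. -/
theorem exists_converse {S₁ S₂ ε : ℝ} (hS₁ : 0 ≤ S₁) (hS₂ : 0 ≤ S₂) (hε : 0 < ε) (hε1 : ε < 1) :
    ∃ K : ℝ, 0 ≤ K ∧ ∀ (n : ℕ) (_ : 225 ≤ n) (M₁ M₂ : ℕ) (_ : 0 < M₁) (_ : 0 < M₂)
      (c : (gaussianMAC S₁ S₂).Code n M₁ M₂), c.errorProb ≤ ENNReal.ofReal ε →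
      Real.log M₁ ≤ n * (Real.log (1 + S₁) / 2) + K * √n ∧
      Real.log M₂ ≤ n * (Real.log (1 + S₂) / 2) + K * √n ∧
      Real.log M₁ + Real.log M₂ ≤ n * (Real.log (1 + (S₁ + S₂)) / 2) + K * √n := by
  -- Halfway between ε and 1. By Markov's inequality at least a fraction κ of the message pairs has
  -- error at most ε', hence success probability at least η.
  set ε' := (1 + ε) / 2 with hε'
  set η := 1 - ε' with hη
  have hη0 : 0 < η := by rw [hη, hε']; linarith
  have hε'0 : 0 < ε' := by rw [hε']; linarith
  set κ := 1 - ε / ε' with hκ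
  have hκ0 : 0 < κ := by
    rw [hκ, sub_pos, div_lt_one hε'0, hε']; linarith
  obtain ⟨K₁, hK₁, H₁⟩ := exists_log_card_le (k := 0) hS₁ le_rfl hη0
  obtain ⟨K₂, hK₂, H₂⟩ := exists_log_card_le (k := 0) hS₂ le_rfl hη0
  obtain ⟨K₃, hK₃, H₃⟩ := exists_log_add_log_le hS₁ hS₂ hη0 hκ0
  refine ⟨K₁ + K₂ + K₃ + |Real.log κ|, by positivity, ?_⟩
  intro n hn M₁ M₂ hM₁ hM₂ c hc
  have hn0 : 0 < n := by omega
  obtain ⟨x, y, hx, hy, hxy⟩ := exists_codebook hn0 c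
  have := c.dec_markov
  have hm1 : (0 : ℝ) < M₁ := by exact_mod_cast hM₁
  have hm2 : (0 : ℝ) < M₂ := by exact_mod_cast hM₂
  set g : Fin M₁ × Fin M₂ → (Fin n → ℝ) → ℝ≥0∞ := fun p z => c.dec z {p} with hg
  have mg : ∀ p, Measurable (g p) := fun p => Kernel.measurable_coe _ (measurableSet_singleton p)
  have hsum : ∀ z, ∑ p, g p z ≤ 1 := fun z => by
    simp only [hg]
    rw [sum_measure_singleton]; exact prob_le_one
  set e : Fin M₁ × Fin M₂ → ℝ≥0∞ := fun p =>
    ∫⁻ z, c.dec z {p}ᶜ ∂(gaussianVec (fun t => x p.1 t + y p.2 t) 1) with he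
  have etot : ∑ p, e p ≤ ENNReal.ofReal (ε * (M₁ * M₂)) := by
    rw [Fintype.sum_prod_type]
    refine hxy.trans ?_
    unfold MAC.Code.errorProb at hc
    rw [ENNReal.div_le_iff (by simp; omega) (by simp [ENNReal.mul_eq_top])] at hc
    refine hc.trans (le_of_eq ?_)
    rw [ENNReal.ofReal_mul hε.le]
    congr 1
    rw [← Nat.cast_mul, ENNReal.ofReal_natCast]
  set Γ : Finset (Fin M₁ × Fin M₂) := Finset.univ.filter fun p => e p ≤ ENNReal.ofReal ε' with hΓ
  have hInt : ∀ p ∈ Γ, ENNReal.ofReal η ≤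
      ∫⁻ z, g p z ∂(gaussianVec (fun t => x p.1 t + y p.2 t) 1) := by
    intro p hp
    have h1 : e p ≤ ENNReal.ofReal ε' := (Finset.mem_filter.1 hp).2
    have h2 : ∫⁻ z, g p z ∂(gaussianVec (fun t => x p.1 t + y p.2 t) 1) + e p = 1 := by
      rw [he, ← lintegral_add_left (mg p)]
      have : ∀ z, g p z + c.dec z {p}ᶜ = 1 := fun z => by
        simp only [hg]
        rw [measure_add_measure_compl (measurableSet_singleton p), measure_univ]
      simp [this]
    have h3 : ENNReal.ofReal η + ENNReal.ofReal ε' = 1 := by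
      rw [← ENNReal.ofReal_add hη0.le hε'0.le, hη]; simp
    rw [← h3] at h2
    have h4 : ENNReal.ofReal η + ENNReal.ofReal ε' ≤
        ∫⁻ z, g p z ∂(gaussianVec (fun t => x p.1 t + y p.2 t) 1) + ENNReal.ofReal ε' :=
      h2.ge.trans (add_le_add le_rfl h1)
    exact (ENNReal.add_le_add_iff_right ENNReal.ofReal_ne_top).1 h4
  have hΓcard : κ * (M₁ * M₂) ≤ Γ.card := by
    have hsplit := Finset.card_filter_add_card_filter_not
      (s := (Finset.univ : Finset (Fin M₁ × Fin M₂))) (fun p => e p ≤ ENNReal.ofReal ε')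
    set B := Finset.univ.filter fun p => ¬ e p ≤ ENNReal.ofReal ε' with hB
    have h1 : (B.card : ℝ≥0∞) * ENNReal.ofReal ε' ≤ ENNReal.ofReal (ε * (M₁ * M₂)) := by
      refine le_trans ?_ etot
      rw [← nsmul_eq_mul, ← Finset.sum_const]
      calc _ ≤ ∑ p ∈ B, e p :=
            Finset.sum_le_sum fun p hp => (not_le.1 (Finset.mem_filter.1 hp).2).le
        _ ≤ _ := Finset.sum_le_sum_of_subset (Finset.subset_univ _)
    rw [← ENNReal.ofReal_natCast, ← ENNReal.ofReal_mul (by positivity),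
      ENNReal.ofReal_le_ofReal_iff (by positivity)] at h1
    have h2 : (Γ.card : ℝ) + B.card = M₁ * M₂ := by
      rw [← hΓ] at hsplit
      have : Γ.card + B.card = M₁ * M₂ := by simpa using hsplit
      exact_mod_cast this
    have h3 : (B.card : ℝ) ≤ ε / ε' * (M₁ * M₂) := by
      rw [div_mul_eq_mul_div, le_div_iff₀ hε'0]; exact h1
    rw [hκ]; linarith
  -- the best partner for each user
  have hfib2 : ∃ j : Fin M₂, κ * M₁ ≤ ((Finset.univ.filter fun i => (i, j) ∈ Γ).card : ℝ) := by
    by_contra! hcon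
    have h1 : (Γ.card : ℝ) = ∑ j : Fin M₂, ((Finset.univ.filter fun i => (i, j) ∈ Γ).card : ℝ) := by
      have : Γ.card = ∑ j : Fin M₂, (Finset.univ.filter fun i => (i, j) ∈ Γ).card := by
        rw [Finset.card_eq_sum_card_fiberwise (f := Prod.snd) (t := Finset.univ)
          (fun _ _ => Finset.mem_univ _)]
        refine Finset.sum_congr rfl fun j _ => ?_
        refine Finset.card_bij' (fun p _ => p.1) (fun i _ => (i, j)) ?_ ?_ ?_ ?_
        · rintro ⟨i, j'⟩ hp; simp only [Finset.mem_filter] at hp ⊢; obtain ⟨h, rfl⟩ := hp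
          exact ⟨Finset.mem_univ _, h⟩
        · intro i hi; simpa using hi
        · rintro ⟨i, j'⟩ hp; simp only [Finset.mem_filter] at hp; simp [hp.2]
        · intro i _; rfl
      exact_mod_cast this
    have h2 : ∑ j : Fin M₂, ((Finset.univ.filter fun i => (i, j) ∈ Γ).card : ℝ) <
        ∑ _j : Fin M₂, κ * M₁ :=
      Finset.sum_lt_sum_of_nonempty ⟨⟨0, hM₂⟩, Finset.mem_univ _⟩ fun j _ => hcon j
    simp only [Finset.sum_const, Finset.card_univ, Fintype.card_fin, nsmul_eq_mul] at h2
    linarith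
  have hfib1 : ∃ i : Fin M₁, κ * M₂ ≤ ((Finset.univ.filter fun j => (i, j) ∈ Γ).card : ℝ) := by
    by_contra! hcon
    have h1 : (Γ.card : ℝ) = ∑ i : Fin M₁, ((Finset.univ.filter fun j => (i, j) ∈ Γ).card : ℝ) := by
      have : Γ.card = ∑ i : Fin M₁, (Finset.univ.filter fun j => (i, j) ∈ Γ).card := by
        rw [Finset.card_eq_sum_card_fiberwise (f := Prod.fst) (t := Finset.univ)
          (fun _ _ => Finset.mem_univ _)]
        refine Finset.sum_congr rfl fun i _ => ?_
        refine Finset.card_bij' (fun p _ => p.2) (fun j _ => (i, j)) ?_ ?_ ?_ ?_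
        · rintro ⟨i', j⟩ hp; simp only [Finset.mem_filter] at hp ⊢; obtain ⟨h, rfl⟩ := hp
          exact ⟨Finset.mem_univ _, h⟩
        · intro i hi; simpa using hi
        · rintro ⟨i', j⟩ hp; simp only [Finset.mem_filter] at hp; simp [hp.2]
        · intro i _; rfl
      exact_mod_cast this
    have h2 : ∑ i : Fin M₁, ((Finset.univ.filter fun j => (i, j) ∈ Γ).card : ℝ) <
        ∑ _i : Fin M₁, κ * M₂ :=
      Finset.sum_lt_sum_of_nonempty ⟨⟨0, hM₁⟩, Finset.mem_univ _⟩ fun j _ => hcon j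
    simp only [Finset.sum_const, Finset.card_univ, Fintype.card_fin, nsmul_eq_mul] at h2
    linarith
  have hsq0 : 0 ≤ √(n : ℝ) := Real.sqrt_nonneg _
  have habs := abs_nonneg (Real.log κ)
  refine ⟨?_, ?_, ?_⟩
  · obtain ⟨j, hj⟩ := hfib2
    -- With the second message frozen at j, the common point is its codeword. The squared distances
    -- are then the energies of the first user's codewords, at most nS₁, so the excess k is zero.
    have hl := H₁ n hn0 _ (Finset.univ.filter fun i => (i, j) ∈ Γ) (y j)
      (fun i t => x i t + y j t) (fun i => g (i, j)) (fun i _ => mg _)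
      (fun z => by
        refine le_trans ?_ (hsum z)
        rw [Fintype.sum_prod_type]
        refine (Finset.sum_le_sum_of_subset (Finset.subset_univ _)).trans
          (Finset.sum_le_sum fun i _ => ?_)
        exact Finset.single_le_sum (f := fun j => g (i, j) z) (fun _ _ => zero_le)
          (Finset.mem_univ j))
      (fun i _ => by simpa [sqDist] using hx i)
      (fun i hi => hInt (i, j) (Finset.mem_filter.1 hi).2)
    refine (log_card_filter hM₁ hκ0 hj hn0 hl).trans ?_
    gcongr; linarith
  · obtain ⟨i, hi⟩ := hfib1
    have hl := H₂ n hn0 _ (Finset.univ.filter fun j => (i, j) ∈ Γ) (x i)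
      (fun j t => x i t + y j t) (fun j => g (i, j)) (fun i _ => mg _)
      (fun z => by
        refine le_trans ?_ (hsum z)
        rw [Fintype.sum_prod_type]
        refine (Finset.sum_le_sum_of_subset (Finset.subset_univ _)).trans ?_
        exact Finset.single_le_sum (f := fun i => ∑ j, g (i, j) z) (fun _ _ => zero_le)
          (Finset.mem_univ i))
      (fun j _ => by simpa [sqDist] using hy j)
      (fun j hj => hInt (i, j) (Finset.mem_filter.1 hj).2)
    refine (log_card_filter hM₂ hκ0 hi hn0 hl).trans ?_
    gcongr; linarith
  · refine (H₃ n hn M₁ M₂ hM₁ hM₂ x y Γ g hx hy hΓcard mg hsum hInt).trans ?_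
    gcongr; linarith

end Converse

end

noncomputable section

/-! ### Random coding with a threshold set. -/

section RandomCoding

variable {α β γ : Type*} [MeasurableSpace α] [MeasurableSpace β] [MeasurableSpace γ]

/-- Distinct codewords are independent; no more than pairwise independence within a codebook enters
the random coding argument. -/
lemma lintegral_pi_pair {ι : Type*} [Fintype ι] (P : Measure α) [IsProbabilityMeasure P] {i i' : ι}
    (h : i ≠ i') {f : α → α → ℝ≥0∞} (hf : Measurable fun p : α × α => f p.1 p.2) :
    ∫⁻ X, f (X i) (X i') ∂(Measure.pi fun _ : ι => P) = ∫⁻ x, ∫⁻ x', f x x' ∂P ∂P := by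
  have hind := (iIndepFun_pi (μ := fun _ : ι => P) (X := fun _ => (id : α → α))
    (fun _ => measurable_id.aemeasurable)).indepFun h
  simp only [id] at hind
  have hmap := (indepFun_iff_map_prod_eq_prod_map_map (measurable_pi_apply i).aemeasurable
    (measurable_pi_apply i').aemeasurable).1 hind
  have hi : ∀ k : ι, Measure.map (fun X : ι → α => X k) (Measure.pi fun _ : ι => P) = P := fun k =>
    (measurePreserving_eval (fun _ : ι => P) k).map_eq
  rw [hi i, hi i'] at hmap
  rw [← lintegral_prod (fun p : α × α => f p.1 p.2) hf.aemeasurable, ← hmap,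
    lintegral_map hf (by fun_prop)]

lemma lintegral_pi_single {ι : Type*} [Fintype ι] (P : Measure α) [IsProbabilityMeasure P] (i : ι)
    {f : α → ℝ≥0∞} (hf : Measurable f) :
    ∫⁻ X, f (X i) ∂(Measure.pi fun _ : ι => P) = ∫⁻ x, f x ∂P :=
  (measurePreserving_eval (fun _ : ι => P) i).lintegral_comp hf

/-- The probability that the output from inputs `x, y` is jointly in `T` with `x', y'`. -/
def hitProb (W : Kernel (α × β) γ) (T : Set (α × β × γ)) (x : α) (y : β) (x' : α) (y' : β) : ℝ≥0∞ :=
  W (x, y) {z | (x', y', z) ∈ T}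

lemma measurable_hitProb (W : Kernel (α × β) γ) [IsMarkovKernel W] {T : Set (α × β × γ)}
    (hT : MeasurableSet T) : Measurable fun q : α × β × α × β =>
      hitProb W T q.1 q.2.1 q.2.2.1 q.2.2.2 := by
  let κ : Kernel (α × β × α × β) γ := W.comap (fun q => (q.1, q.2.1)) (by fun_prop)
  have hS : MeasurableSet {p : (α × β × α × β) × γ | (p.1.2.2.1, p.1.2.2.2, p.2) ∈ T} :=
    (by fun_prop : Measurable fun p : (α × β × α × β) × γ => (p.1.2.2.1, p.1.2.2.2, p.2)) hT
  exact Kernel.measurable_kernel_prodMk_left (κ := κ) hS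

variable {M₁ M₂ : ℕ}

/-- The union bound on the error probability of a pair of messages. -/
def unionBound (W : Kernel (α × β) γ) (T : Set (α × β × γ)) (X : Fin M₁ → α) (Y : Fin M₂ → β)
    (i : Fin M₁) (j : Fin M₂) : ℝ≥0∞ :=
  hitProb W Tᶜ (X i) (Y j) (X i) (Y j) +
    ∑ i' ∈ Finset.univ.erase i, hitProb W T (X i) (Y j) (X i') (Y j) +
    ∑ j' ∈ Finset.univ.erase j, hitProb W T (X i) (Y j) (X i) (Y j') +
    ∑ i' ∈ Finset.univ.erase i, ∑ j' ∈ Finset.univ.erase j,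
      hitProb W T (X i) (Y j) (X i') (Y j')

/-- Random coding: some codebooks meet the averaged union bound. -/
lemma exists_codebook_unionBound_le (W : Kernel (α × β) γ) [IsMarkovKernel W] {T : Set (α × β × γ)}
    (hT : MeasurableSet T) (P : Measure α) (Q : Measure β) [IsProbabilityMeasure P]
    [IsProbabilityMeasure Q] {a₀ a₁ a₂ a₃ : ℝ≥0∞}
    (h₀ : ∫⁻ x, ∫⁻ y, hitProb W Tᶜ x y x y ∂Q ∂P ≤ a₀)
    (h₁ : ∫⁻ y, ∫⁻ x', ∫⁻ x, hitProb W T x y x' y ∂P ∂P ∂Q ≤ a₁)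
    (h₂ : ∫⁻ x, ∫⁻ y', ∫⁻ y, hitProb W T x y x y' ∂Q ∂Q ∂P ≤ a₂)
    (h₃ : ∫⁻ x', ∫⁻ x, ∫⁻ y', ∫⁻ y, hitProb W T x y x' y' ∂Q ∂Q ∂P ∂P ≤ a₃) :
    ∃ (X : Fin M₁ → α) (Y : Fin M₂ → β), ∑ i, ∑ j, unionBound W T X Y i j ≤
      (M₁ * M₂ : ℕ) * (a₀ + (M₁ - 1 : ℕ) * a₁ + (M₂ - 1 : ℕ) * a₂ +
        (M₁ - 1 : ℕ) * ((M₂ - 1 : ℕ) * a₃)) := by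
  set μ := (Measure.pi fun _ : Fin M₁ => P).prod (Measure.pi fun _ : Fin M₂ => Q) with hμ
  have mh := measurable_hitProb W hT
  have mhc := measurable_hitProb W hT.compl
  have mq : ∀ i j i' j', Measurable fun q : (Fin M₁ → α) × (Fin M₂ → β) =>
      hitProb W T (q.1 i) (q.2 j) (q.1 i') (q.2 j') := fun i j i' j' =>
    mh.comp (by fun_prop : Measurable fun q : (Fin M₁ → α) × (Fin M₂ → β) =>
      (q.1 i, q.2 j, q.1 i', q.2 j'))
  have mqc : ∀ i j, Measurable fun q : (Fin M₁ → α) × (Fin M₂ → β) =>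
      hitProb W Tᶜ (q.1 i) (q.2 j) (q.1 i) (q.2 j) := fun i j =>
    mhc.comp (by fun_prop : Measurable fun q : (Fin M₁ → α) × (Fin M₂ → β) =>
      (q.1 i, q.2 j, q.1 i, q.2 j))
  have e₀ : ∀ i j, ∫⁻ q, hitProb W Tᶜ (q.1 i) (q.2 j) (q.1 i) (q.2 j) ∂μ ≤ a₀ := by
    intro i j
    refine le_trans (le_of_eq ?_) h₀
    rw [hμ, lintegral_prod _ (mqc i j).aemeasurable]
    have : ∀ x, ∫⁻ Y, hitProb W Tᶜ x (Y j) x (Y j) ∂(Measure.pi fun _ : Fin M₂ => Q) =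
        ∫⁻ y, hitProb W Tᶜ x y x y ∂Q := fun x => lintegral_pi_single Q j
      (mhc.comp (by fun_prop : Measurable fun y : β => (x, y, x, y)))
    simp_rw [this]
    refine lintegral_pi_single P i (f := fun x => ∫⁻ y, hitProb W Tᶜ x y x y ∂Q) ?_
    exact (mhc.comp (by fun_prop : Measurable fun p : α × β =>
      (p.1, p.2, p.1, p.2))).lintegral_prod_right'
  have e₁ : ∀ i j i', i' ≠ i →
      ∫⁻ q, hitProb W T (q.1 i) (q.2 j) (q.1 i') (q.2 j) ∂μ ≤ a₁ := by
    intro i j i' hi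
    refine le_trans (le_of_eq ?_) h₁
    rw [hμ, lintegral_prod_symm _ (mq i j i' j).aemeasurable]
    have : ∀ y, ∫⁻ X, hitProb W T (X i) y (X i') y ∂(Measure.pi fun _ : Fin M₁ => P) =
        ∫⁻ x', ∫⁻ x, hitProb W T x y x' y ∂P ∂P := fun y =>
      lintegral_pi_pair P hi (f := fun x' x => hitProb W T x y x' y)
        (mh.comp (by fun_prop : Measurable fun p : α × α => (p.2, y, p.1, y)))
    simp_rw [this]
    refine lintegral_pi_single Q j (f := fun y => ∫⁻ x', ∫⁻ x, hitProb W T x y x' y ∂P ∂P) ?_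
    have m3 : Measurable fun p : (β × α) × α => hitProb W T p.2 p.1.1 p.1.2 p.1.1 :=
      mh.comp (by fun_prop : Measurable fun p : (β × α) × α => (p.2, p.1.1, p.1.2, p.1.1))
    have m2 : Measurable fun p : β × α => ∫⁻ x, hitProb W T x p.1 p.2 p.1 ∂P :=
      m3.lintegral_prod_right'
    exact m2.lintegral_prod_right'
  have e₂ : ∀ i j j', j' ≠ j →
      ∫⁻ q, hitProb W T (q.1 i) (q.2 j) (q.1 i) (q.2 j') ∂μ ≤ a₂ := by
    intro i j j' hj
    refine le_trans (le_of_eq ?_) h₂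
    rw [hμ, lintegral_prod _ (mq i j i j').aemeasurable]
    have : ∀ x, ∫⁻ Y, hitProb W T x (Y j) x (Y j') ∂(Measure.pi fun _ : Fin M₂ => Q) =
        ∫⁻ y', ∫⁻ y, hitProb W T x y x y' ∂Q ∂Q := fun x =>
      lintegral_pi_pair Q hj (f := fun y' y => hitProb W T x y x y')
        (mh.comp (by fun_prop : Measurable fun p : β × β => (x, p.2, x, p.1)))
    simp_rw [this]
    refine lintegral_pi_single P i (f := fun x => ∫⁻ y', ∫⁻ y, hitProb W T x y x y' ∂Q ∂Q) ?_
    have m3 : Measurable fun p : (α × β) × β => hitProb W T p.1.1 p.2 p.1.1 p.1.2 :=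
      mh.comp (by fun_prop : Measurable fun p : (α × β) × β => (p.1.1, p.2, p.1.1, p.1.2))
    have m2 : Measurable fun p : α × β => ∫⁻ y, hitProb W T p.1 y p.1 p.2 ∂Q :=
      m3.lintegral_prod_right'
    exact m2.lintegral_prod_right'
  have e₃ : ∀ i j i' j', i' ≠ i → j' ≠ j →
      ∫⁻ q, hitProb W T (q.1 i) (q.2 j) (q.1 i') (q.2 j') ∂μ ≤ a₃ := by
    intro i j i' j' hi hj
    refine le_trans (le_of_eq ?_) h₃
    rw [hμ, lintegral_prod _ (mq i j i' j').aemeasurable]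
    have : ∀ x x', ∫⁻ Y, hitProb W T x (Y j) x' (Y j') ∂(Measure.pi fun _ : Fin M₂ => Q) =
        ∫⁻ y', ∫⁻ y, hitProb W T x y x' y' ∂Q ∂Q := fun x x' =>
      lintegral_pi_pair Q hj (f := fun y' y => hitProb W T x y x' y')
        (mh.comp (by fun_prop : Measurable fun p : β × β => (x, p.2, x', p.1)))
    simp_rw [this]
    refine lintegral_pi_pair P hi
      (f := fun x' x => ∫⁻ y', ∫⁻ y, hitProb W T x y x' y' ∂Q ∂Q) ?_
    have m3 : Measurable fun p : ((α × α) × β) × β =>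
        hitProb W T p.1.1.2 p.2 p.1.1.1 p.1.2 :=
      mh.comp (by fun_prop : Measurable fun p : ((α × α) × β) × β =>
        (p.1.1.2, p.2, p.1.1.1, p.1.2))
    have m2 : Measurable fun p : (α × α) × β => ∫⁻ y, hitProb W T p.1.2 y p.1.1 p.2 ∂Q :=
      m3.lintegral_prod_right'
    exact m2.lintegral_prod_right'
  have mu : ∀ i j, Measurable fun q : (Fin M₁ → α) × (Fin M₂ → β) =>
      unionBound W T q.1 q.2 i j := fun i j => by
    unfold unionBound
    exact (((mqc i j).add (Finset.measurable_fun_sum _ fun i' _ => mq i j i' j)).add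
      (Finset.measurable_fun_sum _ fun j' _ => mq i j i j')).add
      (Finset.measurable_fun_sum _ fun i' _ => Finset.measurable_fun_sum _ fun j' _ => mq i j i' j')
  have eU : ∀ i j, ∫⁻ q, unionBound W T q.1 q.2 i j ∂μ ≤
      a₀ + (M₁ - 1 : ℕ) * a₁ + (M₂ - 1 : ℕ) * a₂ + (M₁ - 1 : ℕ) * ((M₂ - 1 : ℕ) * a₃) := by
    intro i j
    unfold unionBound
    rw [lintegral_add_right _ (Finset.measurable_fun_sum _ fun i' _ =>
        Finset.measurable_fun_sum _ fun j' _ => mq i j i' j'),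
      lintegral_add_right _ (Finset.measurable_fun_sum _ fun j' _ => mq i j i j'),
      lintegral_add_right _ (Finset.measurable_fun_sum _ fun i' _ => mq i j i' j),
      lintegral_finsetSum _ fun i' _ => mq i j i' j,
      lintegral_finsetSum _ fun j' _ => mq i j i j',
      lintegral_finsetSum _ fun i' _ => Finset.measurable_fun_sum _ fun j' _ => mq i j i' j']
    have c₁ : (Finset.univ.erase i).card = M₁ - 1 := by simp
    have c₂ : (Finset.univ.erase j).card = M₂ - 1 := by simp
    refine add_le_add (add_le_add (add_le_add (e₀ i j) ?_) ?_) ?_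
    · rw [← c₁, ← nsmul_eq_mul]
      exact Finset.sum_le_card_nsmul _ _ _ fun i' hi' => e₁ i j i' (Finset.ne_of_mem_erase hi')
    · rw [← c₂, ← nsmul_eq_mul]
      exact Finset.sum_le_card_nsmul _ _ _ fun j' hj' => e₂ i j j' (Finset.ne_of_mem_erase hj')
    · rw [← c₁, ← c₂, ← nsmul_eq_mul, ← nsmul_eq_mul]
      refine Finset.sum_le_card_nsmul _ _ _ fun i' hi' => ?_
      rw [lintegral_finsetSum _ fun j' _ => mq i j i' j']
      exact Finset.sum_le_card_nsmul _ _ _ fun j' hj' =>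
        e₃ i j i' j' (Finset.ne_of_mem_erase hi') (Finset.ne_of_mem_erase hj')
  -- Some codebook pair does no worse than the average over the ensemble.
  obtain ⟨q, hq⟩ := exists_le_lintegral (μ := μ)
    (f := fun q => ∑ i, ∑ j, unionBound W T q.1 q.2 i j)
    (Finset.measurable_fun_sum _ fun i _ =>
      Finset.measurable_fun_sum _ fun j _ => mu i j).aemeasurable
  refine ⟨q.1, q.2, hq.trans ?_⟩
  rw [lintegral_finsetSum _ fun i _ => Finset.measurable_fun_sum _ fun j _ => mu i j]
  calc _ ≤ ∑ _i : Fin M₁, ∑ _j : Fin M₂, (a₀ + (M₁ - 1 : ℕ) * a₁ + (M₂ - 1 : ℕ) * a₂ +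
        (M₁ - 1 : ℕ) * ((M₂ - 1 : ℕ) * a₃)) := by
        refine Finset.sum_le_sum fun i _ => ?_
        rw [lintegral_finsetSum _ fun j _ => mu i j]
        exact Finset.sum_le_sum fun j _ => eU i j
    _ = _ := by
        rw [Finset.sum_const, Finset.sum_const, Finset.card_univ, Finset.card_univ, Fintype.card_fin,
          Fintype.card_fin, nsmul_eq_mul, nsmul_eq_mul, Nat.cast_mul, mul_assoc]

/-- A measurable decoder which outputs the jointly typical pair when it is unique. -/
lemma exists_decoder [Nonempty (Fin M₁ × Fin M₂)] {T : Set (α × β × γ)} (hT : MeasurableSet T)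
    (X : Fin M₁ → α) (Y : Fin M₂ → β) :
    ∃ φ : γ → Fin M₁ × Fin M₂, Measurable φ ∧ ∀ p z, (X p.1, Y p.2, z) ∈ T →
      (∀ p', p' ≠ p → (X p'.1, Y p'.2, z) ∉ T) → φ z = p := by
  set t : Fin M₁ × Fin M₂ → Set γ := fun p =>
    {z | (X p.1, Y p.2, z) ∈ T ∧ ∀ p', p' ≠ p → (X p'.1, Y p'.2, z) ∉ T} with ht
  have mt : ∀ p : Fin M₁ × Fin M₂, MeasurableSet {z | (X p.1, Y p.2, z) ∈ T} := fun p =>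
    (by fun_prop : Measurable fun z : γ => (X p.1, Y p.2, z)) hT
  have mtt : ∀ p, MeasurableSet (t p) := fun p => by
    have : t p = {z | (X p.1, Y p.2, z) ∈ T} ∩
        ⋂ p', ⋂ _ : p' ≠ p, {z | (X p'.1, Y p'.2, z) ∈ T}ᶜ := by
      ext z; simp [ht]
    rw [this]
    exact (mt p).inter (MeasurableSet.iInter fun p' => MeasurableSet.iInter fun _ => (mt p').compl)
  obtain ⟨φ, hφ, h⟩ := exists_measurable_piecewise t mtt (fun p _ => p) (fun p => measurable_const)
    (fun p p' hne z hz => by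
      exact absurd hz.2.1 (hz.1.2 p' hne.symm))
  exact ⟨φ, hφ, fun p z h1 h2 => h p ⟨h1, h2⟩⟩

/-- The error probability of that decoder obeys the union bound. -/
lemma measure_decoder_ne_le (W : Kernel (α × β) γ) [IsMarkovKernel W] {T : Set (α × β × γ)}
    (X : Fin M₁ → α) (Y : Fin M₂ → β) {φ : γ → Fin M₁ × Fin M₂}
    (hφ : ∀ p z, (X p.1, Y p.2, z) ∈ T → (∀ p', p' ≠ p → (X p'.1, Y p'.2, z) ∉ T) → φ z = p)
    (i : Fin M₁) (j : Fin M₂) : W (X i, Y j) {z | φ z ≠ (i, j)} ≤ unionBound W T X Y i j := by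
  have hsub : {z | φ z ≠ (i, j)} ⊆ (({z | (X i, Y j, z) ∈ Tᶜ} ∪
      ⋃ i' ∈ Finset.univ.erase i, {z | (X i', Y j, z) ∈ T}) ∪
      ⋃ j' ∈ Finset.univ.erase j, {z | (X i, Y j', z) ∈ T}) ∪
      ⋃ i' ∈ Finset.univ.erase i, ⋃ j' ∈ Finset.univ.erase j, {z | (X i', Y j', z) ∈ T} := by
    intro z hz
    by_contra hcon
    simp only [Set.mem_union, Set.mem_iUnion, not_or, not_exists, Set.mem_ofPred_eq,
      Set.mem_compl_iff, not_not, Finset.mem_erase, Finset.mem_univ, and_true] at hcon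
    obtain ⟨⟨⟨h0, h1⟩, h2⟩, h3⟩ := hcon
    refine hz (hφ (i, j) z h0 fun p' hp' => ?_)
    by_cases hi : p'.1 = i
    · by_cases hj : p'.2 = j
      · exact absurd (Prod.ext hi hj) hp'
      · rw [hi]; exact h2 _ hj
    · by_cases hj : p'.2 = j
      · rw [hj]; exact h1 _ hi
      · exact h3 _ hi _ hj
  refine (measure_mono hsub).trans ?_
  unfold unionBound hitProb
  refine (measure_union_le _ _).trans (add_le_add ((measure_union_le _ _).trans (add_le_add
    ((measure_union_le _ _).trans (add_le_add le_rfl ?_)) ?_)) ?_)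
  · exact measure_biUnion_finset_le _ _
  · exact measure_biUnion_finset_le _ _
  · exact (measure_biUnion_finset_le _ _).trans
      (Finset.sum_le_sum fun i' _ => measure_biUnion_finset_le _ _)

end RandomCoding

end

noncomputable section

/-! ### Sums and concentration of normal vectors. -/

section GaussianSums

variable {n : ℕ}

lemma gaussianVec_conv (s v : ℝ≥0) :
    ((gaussianVec (n := n) 0 s).prod (gaussianVec 0 v)).map (fun p => p.1 + p.2) =
      gaussianVec 0 (s + v) := by
  have h1 := (measurePreserving_arrowProdEquivProdArrow ℝ ℝ (Fin n) (fun _ => gaussianReal 0 s)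
    (fun _ => gaussianReal 0 v)).map_eq
  have h2 : (gaussianVec (n := n) 0 s).prod (gaussianVec 0 v) =
      (Measure.pi fun _ : Fin n => (gaussianReal 0 s).prod (gaussianReal 0 v)).map
        (MeasurableEquiv.arrowProdEquivProdArrow ℝ ℝ (Fin n)) := h1.symm
  have h3 : ((gaussianReal 0 s).prod (gaussianReal 0 v)).map (fun p : ℝ × ℝ => p.1 + p.2) =
      gaussianReal 0 (s + v) := by
    have := gaussianReal_conv_gaussianReal (m₁ := 0) (m₂ := 0) (v₁ := s) (v₂ := v)
    rw [add_zero] at this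
    exact this
  rw [h2, Measure.map_map (by fun_prop) (MeasurableEquiv.measurable _)]
  have : ∀ _ : Fin n, SigmaFinite (((gaussianReal 0 s).prod (gaussianReal 0 v)).map
      (fun p : ℝ × ℝ => p.1 + p.2)) := fun _ => by rw [h3]; infer_instance
  have h4 := Measure.pi_map_pi (μ := fun _ : Fin n => (gaussianReal 0 s).prod (gaussianReal 0 v))
    (f := fun _ p => p.1 + p.2) (fun _ => by fun_prop)
  rw [h3] at h4
  exact h4

/-- Averaging the centre of a normal vector over a normal law adds the variances. -/
lemma lintegral_gaussianVec_add (s v : ℝ≥0) (y : Fin n → ℝ) {E : Set (Fin n → ℝ)}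
    (hE : MeasurableSet E) :
    ∫⁻ x, gaussianVec (x + y) v E ∂(gaussianVec 0 s) = gaussianVec y (s + v) E := by
  have h1 : ∀ c : Fin n → ℝ, ∀ u : ℝ≥0, gaussianVec c u E =
      ∫⁻ z, E.indicator 1 (z + c) ∂(gaussianVec 0 u) := fun c u => by
    rw [← lintegral_gaussianVec c u (measurable_one.indicator hE), lintegral_indicator_one hE]
  simp_rw [h1]
  have m : Measurable (E.indicator (1 : (Fin n → ℝ) → ℝ≥0∞)) := measurable_one.indicator hE
  have m2 : Measurable fun z : Fin n → ℝ => E.indicator (1 : (Fin n → ℝ) → ℝ≥0∞) (z + y) :=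
    m.comp (by fun_prop)
  have m3 : Measurable fun p : (Fin n → ℝ) × (Fin n → ℝ) =>
      E.indicator (1 : (Fin n → ℝ) → ℝ≥0∞) (p.1 + p.2 + y) := m2.comp (by fun_prop)
  rw [← gaussianVec_conv, lintegral_map m2 (by fun_prop), lintegral_prod _ m3.aemeasurable]
  refine lintegral_congr fun x => lintegral_congr fun z => ?_
  congr 1
  abel

lemma gaussianVec_sqDist (c : Fin n → ℝ) (v : ℝ≥0) {p : ℝ → Prop} (hp : MeasurableSet {r | p r}) :
    gaussianVec c v {z | p (sqDist z c)} = gaussianVec (n := n) 0 v {z | p (sqDist z 0)} := by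
  have hm : MeasurableSet {z | p (sqDist z c)} := measurable_sqDist_left c hp
  rw [gaussianVec_eq_map, Measure.map_apply (by fun_prop) hm]
  congr 1
  ext z
  simp [sqDist]

/-- Concentration of the squared norm of a normal vector. -/
lemma gaussianVec_abs_sqDist_sub_le (hn : 0 < n) (c : Fin n → ℝ) (v : ℝ≥0) {θ : ℝ} (hθ : 0 < θ) :
    gaussianVec c v {z | n * θ ≤ |sqDist z c - n * v|} ≤
      ENNReal.ofReal ((∫ x, x ^ 4 ∂(gaussianReal 0 v)) / θ ^ 2 / n) := by
  have hnR : (0 : ℝ) < n := by exact_mod_cast hn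
  rw [gaussianVec_sqDist c v (p := fun r => n * θ ≤ |r - n * v|)
    (measurableSet_le measurable_const (by fun_prop))]
  have hX : MemLp (fun x : ℝ => x ^ 2) 2 (gaussianReal 0 v) := by
    simpa using memLp_quadratic_gaussianReal 0 1 0 v
  have h := pi_abs_sum_sub_le (fun _ : Fin n => gaussianReal 0 v) (X := fun _ x => x ^ 2)
    (m := fun _ => (v : ℝ)) (v := fun _ => ∫ x, x ^ 4 ∂(gaussianReal 0 v)) (fun _ => hX)
    (fun _ => by simpa using integral_sub_sq_gaussianReal 0 0 v)
    (fun _ => by simp only [← pow_mul]; exact le_rfl) (s := n * θ) (by positivity)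
  have e : {z : Fin n → ℝ | n * θ ≤ |sqDist z 0 - n * v|} =
      {z | n * θ ≤ |∑ t, z t ^ 2 - ∑ _t : Fin n, (v : ℝ)|} := by
    ext z; simp [sqDist]
  rw [e]
  refine h.trans (ENNReal.ofReal_le_ofReal (le_of_eq ?_))
  simp only [Finset.sum_const, Finset.card_univ, Fintype.card_fin, nsmul_eq_mul]
  field_simp

lemma gaussianVec_lt_sqDist_le (hn : 0 < n) (c : Fin n → ℝ) {v : ℝ≥0} {b : ℝ} (hb : v < b) :
    gaussianVec c v {z | n * b < sqDist z c} ≤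
      ENNReal.ofReal ((∫ x, x ^ 4 ∂(gaussianReal 0 v)) / (b - v) ^ 2 / n) := by
  refine (measure_mono fun z hz => ?_).trans
    (gaussianVec_abs_sqDist_sub_le hn c v (sub_pos.2 hb))
  have hz' : n * b < sqDist z c := hz
  refine le_trans ?_ (le_abs_self (sqDist z c - n * v))
  linarith

lemma gaussianVec_sqDist_lt_le (hn : 0 < n) (c : Fin n → ℝ) {v : ℝ≥0} {b : ℝ} (hb : b < v) :
    gaussianVec c v {z | sqDist z c < n * b} ≤
      ENNReal.ofReal ((∫ x, x ^ 4 ∂(gaussianReal 0 v)) / (v - b) ^ 2 / n) := by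
  refine (measure_mono fun z hz => ?_).trans
    (gaussianVec_abs_sqDist_sub_le hn c v (sub_pos.2 hb))
  have hz' : sqDist z c < n * b := hz
  refine le_trans ?_ (neg_le_abs (sqDist z c - n * v))
  linarith

/-- The law is a point mass. This serves the case of power zero, where a reduced power leaves no
room below the constraint. -/
lemma gaussianVec_zero_var_lt_sqDist (c : Fin n → ℝ) : gaussianVec c 0 {z | 0 < sqDist z c} = 0 := by
  have h : ∀ᵐ z ∂(gaussianVec c 0), ∀ t, z t = c t := ae_all_iff.2 fun t =>
    ae_pi_eval (fun t => gaussianReal (c t) 0) t (p := fun x => x = c t) (by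
      rw [gaussianReal_zero_var]; exact (ae_dirac_iff (measurableSet_singleton _)).2 rfl)
  have h2 : ∀ᵐ z ∂(gaussianVec c 0), ¬ 0 < sqDist z c := h.mono fun z hz => by
    simp [sqDist, hz]
  simpa [ae_iff] using h2

/-- A normal vector of power `(1 - η) S` exceeds the power `S` with vanishing probability. -/
lemma exists_power_violation_le {S η : ℝ} (hS : 0 ≤ S) (hη : 0 < η) (hη1 : η < 1) :
    ∃ D : ℝ, 0 ≤ D ∧ ∀ (n : ℕ) (_ : 0 < n),
      gaussianVec (n := n) 0 ((1 - η) * S).toNNReal {z | n * S < sqDist z 0} ≤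
        ENNReal.ofReal (D / n) := by
  rcases hS.eq_or_lt with rfl | hS
  · refine ⟨0, le_rfl, fun n _ => ?_⟩
    simp [gaussianVec_zero_var_lt_sqDist]
  · have hv : (((1 - η) * S).toNNReal : ℝ) = (1 - η) * S :=
      Real.coe_toNNReal _ (mul_nonneg (by linarith) hS.le)
    refine ⟨_, ?_, fun n hn => gaussianVec_lt_sqDist_le hn 0 (by rw [hv]; nlinarith)⟩
    exact div_nonneg (integral_nonneg fun _ => by positivity) (sq_nonneg _)

/-- Outputs typical for `v` are rarely produced by the broader law around `c`. -/
lemma gaussianVec_le_exp {s η : ℝ} (hs : 0 ≤ s) (c v : Fin n → ℝ) {E : Set (Fin n → ℝ)}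
    (hE : MeasurableSet E) (h1 : ∀ z ∈ E, sqDist z v ≤ n * (1 + η))
    (h2 : ∀ z ∈ E, n * ((1 + s) * (1 - η)) ≤ sqDist z c) :
    gaussianVec c (1 + s).toNNReal E ≤
      ENNReal.ofReal (Real.exp (-(n * (Real.log (1 + s) / 2 - η)))) := by
  -- On E the likelihood ratio of the broad law against the unit-variance law around v is at most
  -- e^l, and the latter gives E mass at most one.
  have h := setLIntegral_gaussianVec_le c v (σ := 1 + s) (τ := 1)
    (l := -(n * (Real.log (1 + s) / 2 - η))) (by linarith) one_pos hE ?_ (g := 1) measurable_one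
  · simp only [Pi.one_apply, setLIntegral_one] at h
    exact h.trans (mul_le_of_le_one_right zero_le prob_le_one)
  intro z hz
  have a1 := h1 z hz
  have a2 := h2 z hz
  have a3 : n * (1 - η) / 2 ≤ sqDist z c / (2 * (1 + s)) := by
    rw [div_le_div_iff₀ (by norm_num) (by linarith)]
    nlinarith
  rw [Real.log_div one_ne_zero (by linarith), Real.log_one]
  linarith

end GaussianSums

/-! ### The typical set and its probabilities. -/

section TypicalSet

/-- The additive Gaussian channel on vectors. -/
def gaussianVecKernel (n : ℕ) : Kernel ((Fin n → ℝ) × (Fin n → ℝ)) (Fin n → ℝ) where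
  toFun p := gaussianVec (p.1 + p.2) 1
  measurable' := by
    refine Measure.measurable_of_measurable_coe _ fun E hE => ?_
    have := measurable_lintegral_gaussianVec (n := n) 1
      (c := fun p : (Fin n → ℝ) × (Fin n → ℝ) => p.1 + p.2) (by fun_prop)
      (measurable_one.indicator hE)
    simpa only [lintegral_indicator_one hE] using this

instance (n : ℕ) : IsMarkovKernel (gaussianVecKernel n) :=
  ⟨fun p => (inferInstance : IsProbabilityMeasure (gaussianVec (p.1 + p.2) 1))⟩

lemma gaussianVecKernel_apply {n : ℕ} (x y : Fin n → ℝ) :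
    gaussianVecKernel n (x, y) = gaussianVec (x + y) 1 := rfl

/-- Inputs within the power constraints and an output at the typical distances from them. -/
def typicalSet (n : ℕ) (S₁ S₂ η : ℝ) : Set ((Fin n → ℝ) × (Fin n → ℝ) × (Fin n → ℝ)) :=
  {q | sqDist q.2.2 (q.1 + q.2.1) ≤ n * (1 + η) ∧
    n * ((1 + (1 - η) * S₁) * (1 - η)) ≤ sqDist q.2.2 q.2.1 ∧
    n * ((1 + (1 - η) * S₂) * (1 - η)) ≤ sqDist q.2.2 q.1 ∧
    n * ((1 + ((1 - η) * S₁ + (1 - η) * S₂)) * (1 - η)) ≤ sqDist q.2.2 0 ∧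
    sqDist q.1 0 ≤ n * S₁ ∧ sqDist q.2.1 0 ≤ n * S₂}

lemma measurable_sqDist {n : ℕ} {α : Type*} [MeasurableSpace α] {f g : α → Fin n → ℝ}
    (hf : Measurable f) (hg : Measurable g) : Measurable fun a => sqDist (f a) (g a) := by
  unfold sqDist; fun_prop

lemma measurableSet_typicalSet (n : ℕ) (S₁ S₂ η : ℝ) : MeasurableSet (typicalSet n S₁ S₂ η) := by
  unfold typicalSet
  refine (measurableSet_le (measurable_sqDist ?_ ?_) measurable_const).inter <|
    (measurableSet_le measurable_const (measurable_sqDist ?_ ?_)).inter <|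
    (measurableSet_le measurable_const (measurable_sqDist ?_ ?_)).inter <|
    (measurableSet_le measurable_const (measurable_sqDist ?_ ?_)).inter <|
    (measurableSet_le (measurable_sqDist ?_ ?_) measurable_const).inter
    (measurableSet_le (measurable_sqDist ?_ ?_) measurable_const) <;> fun_prop

lemma measurableSet_section {α β γ : Type*} [MeasurableSpace α] [MeasurableSpace β]
    [MeasurableSpace γ] {T : Set (α × β × γ)} (hT : MeasurableSet T) (x : α) (y : β) :
    MeasurableSet {z | (x, y, z) ∈ T} :=
  (by fun_prop : Measurable fun z : γ => (x, y, z)) hT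

/-- Subadditivity of the averaged probability of a joint event. -/
lemma lintegral_hitProb_union_le {α β γ : Type*} [MeasurableSpace α] [MeasurableSpace β]
    [MeasurableSpace γ] (W : Kernel (α × β) γ) [IsMarkovKernel W] (P : Measure α) (Q : Measure β)
    [IsProbabilityMeasure P] [IsProbabilityMeasure Q] {E F : Set (α × β × γ)}
    (hE : MeasurableSet E) :
    ∫⁻ x, ∫⁻ y, hitProb W (E ∪ F) x y x y ∂Q ∂P ≤
      ∫⁻ x, ∫⁻ y, hitProb W E x y x y ∂Q ∂P + ∫⁻ x, ∫⁻ y, hitProb W F x y x y ∂Q ∂P := by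
  have m : Measurable fun p : α × β => hitProb W E p.1 p.2 p.1 p.2 :=
    (measurable_hitProb W hE).comp (by fun_prop : Measurable fun p : α × β => (p.1, p.2, p.1, p.2))
  have m2 : Measurable fun x => ∫⁻ y, hitProb W E x y x y ∂Q := m.lintegral_prod_right'
  rw [← lintegral_add_left m2]
  refine lintegral_mono fun x => ?_
  have m3 : Measurable fun y => hitProb W E x y x y := m.comp measurable_prodMk_left
  rw [← lintegral_add_left m3]
  exact lintegral_mono fun y => measure_union_le _ _

lemma lintegral_hitProb_swap {α β γ : Type*} [MeasurableSpace α] [MeasurableSpace β]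
    [MeasurableSpace γ] (W : Kernel (α × β) γ) [IsMarkovKernel W] {T : Set (α × β × γ)}
    (hT : MeasurableSet T) (P : Measure α) (Q : Measure β) [IsProbabilityMeasure P]
    [IsProbabilityMeasure Q] (x' : α) :
    ∫⁻ x, ∫⁻ y', ∫⁻ y, hitProb W T x y x' y' ∂Q ∂Q ∂P =
      ∫⁻ y', ∫⁻ x, ∫⁻ y, hitProb W T x y x' y' ∂Q ∂P ∂Q := by
  have m3 : Measurable fun p : (α × β) × β => hitProb W T p.1.1 p.2 x' p.1.2 :=
    (measurable_hitProb W hT).comp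
      (by fun_prop : Measurable fun p : (α × β) × β => (p.1.1, p.2, x', p.1.2))
  have m2 : Measurable fun p : α × β => ∫⁻ y, hitProb W T p.1 y x' p.2 ∂Q :=
    m3.lintegral_prod_right'
  exact lintegral_lintegral_swap m2.aemeasurable

variable {n : ℕ} {S₁ S₂ η : ℝ}

lemma toNNReal_add_one {s : ℝ} (hs : 0 ≤ s) : s.toNNReal + 1 = (1 + s).toNNReal := by
  rw [Real.toNNReal_add zero_le_one hs, Real.toNNReal_one, add_comm]

lemma lintegral_const_le {α : Type*} [MeasurableSpace α] (P : Measure α) [IsProbabilityMeasure P]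
    {f : α → ℝ≥0∞} {a : ℝ≥0∞} (h : ∀ x, f x ≤ a) : ∫⁻ x, f x ∂P ≤ a :=
  (lintegral_mono h).trans (by simp)

/-- For a fixed competitor x' and fixed y, averaging over the sent x spreads the output to variance
1 + (1-η)S₁ around y. A typical output is instead within unit noise of x' + y, so
`gaussianVec_le_exp` applies. -/
lemma lintegral_hitProb_fst_le (hS₁ : 0 ≤ S₁) (hη1 : η < 1) :
    ∫⁻ y, ∫⁻ x', ∫⁻ x, hitProb (gaussianVecKernel n) (typicalSet n S₁ S₂ η) x y x' y
      ∂(gaussianVec 0 ((1 - η) * S₁).toNNReal) ∂(gaussianVec 0 ((1 - η) * S₁).toNNReal)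
      ∂(gaussianVec 0 ((1 - η) * S₂).toNNReal) ≤
    ENNReal.ofReal (Real.exp (-(n * (Real.log (1 + (1 - η) * S₁) / 2 - η)))) := by
  have hs : 0 ≤ (1 - η) * S₁ := mul_nonneg (by linarith) hS₁
  refine lintegral_const_le _ fun y => lintegral_const_le _ fun x' => ?_
  have hE := measurableSet_section (measurableSet_typicalSet n S₁ S₂ η) x' y
  unfold hitProb
  simp_rw [gaussianVecKernel_apply]
  rw [lintegral_gaussianVec_add _ _ _ hE, toNNReal_add_one hs]
  exact gaussianVec_le_exp hs y (x' + y) hE (fun z hz => hz.1) (fun z hz => hz.2.1)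

lemma lintegral_hitProb_snd_le (hS₂ : 0 ≤ S₂) (hη1 : η < 1) :
    ∫⁻ x, ∫⁻ y', ∫⁻ y, hitProb (gaussianVecKernel n) (typicalSet n S₁ S₂ η) x y x y'
      ∂(gaussianVec 0 ((1 - η) * S₂).toNNReal) ∂(gaussianVec 0 ((1 - η) * S₂).toNNReal)
      ∂(gaussianVec 0 ((1 - η) * S₁).toNNReal) ≤
    ENNReal.ofReal (Real.exp (-(n * (Real.log (1 + (1 - η) * S₂) / 2 - η)))) := by
  have hs : 0 ≤ (1 - η) * S₂ := mul_nonneg (by linarith) hS₂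
  refine lintegral_const_le _ fun x => lintegral_const_le _ fun y' => ?_
  have hE := measurableSet_section (measurableSet_typicalSet n S₁ S₂ η) x y'
  unfold hitProb
  simp_rw [gaussianVecKernel_apply, add_comm x]
  rw [lintegral_gaussianVec_add _ _ _ hE, toNNReal_add_one hs]
  exact gaussianVec_le_exp hs x (x + y') hE (fun z hz => hz.1) (fun z hz => hz.2.2.1)

/-- With both competitors fixed, averaging over both sent words makes the output centred normal with
variance one plus the sum of the two powers. -/
lemma lintegral_hitProb_both_le (hS₁ : 0 ≤ S₁) (hS₂ : 0 ≤ S₂) (hη1 : η < 1) :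
    ∫⁻ x', ∫⁻ x, ∫⁻ y', ∫⁻ y, hitProb (gaussianVecKernel n) (typicalSet n S₁ S₂ η) x y x' y'
      ∂(gaussianVec 0 ((1 - η) * S₂).toNNReal) ∂(gaussianVec 0 ((1 - η) * S₂).toNNReal)
      ∂(gaussianVec 0 ((1 - η) * S₁).toNNReal) ∂(gaussianVec 0 ((1 - η) * S₁).toNNReal) ≤
    ENNReal.ofReal
      (Real.exp (-(n * (Real.log (1 + ((1 - η) * S₁ + (1 - η) * S₂)) / 2 - η)))) := by
  have hs₁ : 0 ≤ (1 - η) * S₁ := mul_nonneg (by linarith) hS₁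
  have hs₂ : 0 ≤ (1 - η) * S₂ := mul_nonneg (by linarith) hS₂
  refine lintegral_const_le _ fun x' => ?_
  rw [lintegral_hitProb_swap _ (measurableSet_typicalSet n S₁ S₂ η)]
  refine lintegral_const_le _ fun y' => ?_
  have hE := measurableSet_section (measurableSet_typicalSet n S₁ S₂ η) x' y'
  unfold hitProb
  simp_rw [gaussianVecKernel_apply]
  have h1 : ∀ x : Fin n → ℝ, ∫⁻ y, gaussianVec (x + y) 1 {z | (x', y', z) ∈ typicalSet n S₁ S₂ η}
      ∂(gaussianVec 0 ((1 - η) * S₂).toNNReal) =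
      gaussianVec (x + 0) (((1 - η) * S₂).toNNReal + 1) {z | (x', y', z) ∈ typicalSet n S₁ S₂ η} :=
    fun x => by
      simp_rw [add_comm x]
      rw [lintegral_gaussianVec_add _ _ _ hE, zero_add]
  simp_rw [h1]
  rw [lintegral_gaussianVec_add _ _ _ hE, ← add_assoc, ← Real.toNNReal_add hs₁ hs₂,
    toNNReal_add_one (add_nonneg hs₁ hs₂)]
  exact gaussianVec_le_exp (add_nonneg hs₁ hs₂) 0 (x' + y') hE (fun z hz => hz.1)
    (fun z hz => hz.2.2.2.1)

/-- Atypical events have vanishing probability. -/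
lemma exists_atypical_le (hS₁ : 0 ≤ S₁) (hS₂ : 0 ≤ S₂) (hη : 0 < η) (hη1 : η < 1) :
    ∃ D : ℝ, 0 ≤ D ∧ ∀ (n : ℕ) (_ : 0 < n),
      ∫⁻ x, ∫⁻ y, hitProb (gaussianVecKernel n) (typicalSet n S₁ S₂ η)ᶜ x y x y
        ∂(gaussianVec 0 ((1 - η) * S₂).toNNReal) ∂(gaussianVec 0 ((1 - η) * S₁).toNNReal) ≤
      ENNReal.ofReal (D / n) := by
  set s₁ := (1 - η) * S₁ with hs₁
  set s₂ := (1 - η) * S₂ with hs₂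
  have hs₁0 : 0 ≤ s₁ := mul_nonneg (by linarith) hS₁
  have hs₂0 : 0 ≤ s₂ := mul_nonneg (by linarith) hS₂
  obtain ⟨D₅, hD₅, H₅⟩ := exists_power_violation_le hS₁ hη hη1
  obtain ⟨D₆, hD₆, H₆⟩ := exists_power_violation_le hS₂ hη hη1
  have lowc : ∀ {s : ℝ}, 0 ≤ s → (1 + s) * (1 - η) < ((1 + s).toNNReal : ℝ) := fun {s} hs => by
    rw [Real.coe_toNNReal _ (by linarith)]; nlinarith
  set Dl : ℝ → ℝ := fun s => (∫ x, x ^ 4 ∂(gaussianReal 0 (1 + s).toNNReal)) /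
    (((1 + s).toNNReal : ℝ) - (1 + s) * (1 - η)) ^ 2 with hDl
  have hDl0 : ∀ s, 0 ≤ Dl s := fun s =>
    div_nonneg (integral_nonneg fun _ => by positivity) (sq_nonneg _)
  set D₁ : ℝ := (∫ x, x ^ 4 ∂(gaussianReal 0 1)) / (1 + η - ((1 : ℝ≥0) : ℝ)) ^ 2 with hD₁
  have hD₁0 : 0 ≤ D₁ := div_nonneg (integral_nonneg fun _ => by positivity) (sq_nonneg _)
  refine ⟨D₁ + (Dl s₁ + (Dl s₂ + (Dl (s₁ + s₂) + (D₅ + D₆)))),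
    add_nonneg hD₁0 (add_nonneg (hDl0 _) (add_nonneg (hDl0 _) (add_nonneg (hDl0 _)
      (add_nonneg hD₅ hD₆)))), fun n hn => ?_⟩
  set P := gaussianVec (n := n) 0 s₁.toNNReal
  set Q := gaussianVec (n := n) 0 s₂.toNNReal
  set E₁ : Set ((Fin n → ℝ) × (Fin n → ℝ) × (Fin n → ℝ)) := {q | n * (1 + η) < sqDist q.2.2 (q.1 + q.2.1)} with hE₁
  set E₂ : Set ((Fin n → ℝ) × (Fin n → ℝ) × (Fin n → ℝ)) := {q | sqDist q.2.2 q.2.1 < n * ((1 + s₁) * (1 - η))} with hE₂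
  set E₃ : Set ((Fin n → ℝ) × (Fin n → ℝ) × (Fin n → ℝ)) := {q | sqDist q.2.2 q.1 < n * ((1 + s₂) * (1 - η))} with hE₃
  set E₄ : Set ((Fin n → ℝ) × (Fin n → ℝ) × (Fin n → ℝ)) := {q | sqDist q.2.2 0 < n * ((1 + (s₁ + s₂)) * (1 - η))} with hE₄
  set E₅ : Set ((Fin n → ℝ) × (Fin n → ℝ) × (Fin n → ℝ)) := {q | n * S₁ < sqDist q.1 0} with hE₅
  set E₆ : Set ((Fin n → ℝ) × (Fin n → ℝ) × (Fin n → ℝ)) := {q | n * S₂ < sqDist q.2.1 0} with hE₆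
  have hT : (typicalSet n S₁ S₂ η)ᶜ = E₁ ∪ (E₂ ∪ (E₃ ∪ (E₄ ∪ (E₅ ∪ E₆)))) := by
    ext q
    simp only [typicalSet, hE₁, hE₂, hE₃, hE₄, hE₅, hE₆, Set.mem_compl_iff, Set.mem_ofPred_eq,
      Set.mem_union, not_and_or, not_le, hs₁, hs₂]
  have m₁ : MeasurableSet E₁ :=
    measurableSet_lt measurable_const (measurable_sqDist (by fun_prop) (by fun_prop))
  have m₂ : MeasurableSet E₂ :=
    measurableSet_lt (measurable_sqDist (by fun_prop) (by fun_prop)) measurable_const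
  have m₃ : MeasurableSet E₃ :=
    measurableSet_lt (measurable_sqDist (by fun_prop) (by fun_prop)) measurable_const
  have m₄ : MeasurableSet E₄ :=
    measurableSet_lt (measurable_sqDist (by fun_prop) (by fun_prop)) measurable_const
  have m₅ : MeasurableSet E₅ :=
    measurableSet_lt measurable_const (measurable_sqDist (by fun_prop) (by fun_prop))
  have mz : ∀ b (y : (Fin n → ℝ)), MeasurableSet {z : (Fin n → ℝ) | sqDist z y < b} := fun b y =>
    measurableSet_lt (measurable_sqDist_left y) measurable_const
  have b₁ : ∫⁻ x, ∫⁻ y, hitProb (gaussianVecKernel n) E₁ x y x y ∂Q ∂P ≤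
      ENNReal.ofReal (D₁ / n) :=
    lintegral_const_le _ fun x => lintegral_const_le _ fun y =>
      gaussianVec_lt_sqDist_le hn (x + y) (by simpa using hη)
  have b₂ : ∫⁻ x, ∫⁻ y, hitProb (gaussianVecKernel n) E₂ x y x y ∂Q ∂P ≤
      ENNReal.ofReal (Dl s₁ / n) := by
    have m : Measurable fun p : (Fin n → ℝ) × (Fin n → ℝ) => hitProb (gaussianVecKernel n) E₂ p.1 p.2 p.1 p.2 :=
      (measurable_hitProb _ m₂).comp (by fun_prop : Measurable fun p : (Fin n → ℝ) × (Fin n → ℝ) =>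
        (p.1, p.2, p.1, p.2))
    rw [lintegral_lintegral_swap m.aemeasurable]
    refine lintegral_const_le _ fun y => ?_
    change ∫⁻ x, gaussianVec (x + y) 1 {z | sqDist z y < n * ((1 + s₁) * (1 - η))} ∂P ≤ _
    rw [lintegral_gaussianVec_add _ _ _ (mz _ y), toNNReal_add_one hs₁0]
    exact gaussianVec_sqDist_lt_le hn y (lowc hs₁0)
  have b₃ : ∫⁻ x, ∫⁻ y, hitProb (gaussianVecKernel n) E₃ x y x y ∂Q ∂P ≤
      ENNReal.ofReal (Dl s₂ / n) := by
    refine lintegral_const_le _ fun x => ?_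
    change ∫⁻ y, gaussianVec (x + y) 1 {z | sqDist z x < n * ((1 + s₂) * (1 - η))} ∂Q ≤ _
    simp_rw [add_comm x]
    rw [lintegral_gaussianVec_add _ _ _ (mz _ x), toNNReal_add_one hs₂0]
    exact gaussianVec_sqDist_lt_le hn x (lowc hs₂0)
  have b₄ : ∫⁻ x, ∫⁻ y, hitProb (gaussianVecKernel n) E₄ x y x y ∂Q ∂P ≤
      ENNReal.ofReal (Dl (s₁ + s₂) / n) := by
    change ∫⁻ x, ∫⁻ y, gaussianVec (x + y) 1
      {z | sqDist z 0 < n * ((1 + (s₁ + s₂)) * (1 - η))} ∂Q ∂P ≤ _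
    have h1 : ∀ x : (Fin n → ℝ), ∫⁻ y, gaussianVec (x + y) 1
        {z | sqDist z 0 < n * ((1 + (s₁ + s₂)) * (1 - η))} ∂Q =
        gaussianVec (x + 0) (s₂.toNNReal + 1)
          {z | sqDist z 0 < n * ((1 + (s₁ + s₂)) * (1 - η))} := fun x => by
      simp_rw [add_comm x]
      rw [lintegral_gaussianVec_add _ _ _ (mz _ 0), zero_add]
    simp_rw [h1]
    rw [lintegral_gaussianVec_add _ _ _ (mz _ 0), ← add_assoc, ← Real.toNNReal_add hs₁0 hs₂0,
      toNNReal_add_one (add_nonneg hs₁0 hs₂0)]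
    exact gaussianVec_sqDist_lt_le hn 0 (lowc (add_nonneg hs₁0 hs₂0))
  have mc : MeasurableSet {x : (Fin n → ℝ) | n * S₁ < sqDist x 0} :=
    measurableSet_lt measurable_const (measurable_sqDist_left 0)
  have mc' : MeasurableSet {x : (Fin n → ℝ) | n * S₂ < sqDist x 0} :=
    measurableSet_lt measurable_const (measurable_sqDist_left 0)
  -- The power events do not involve the output, so they reduce to the law of a single codeword.
  have b₅ : ∫⁻ x, ∫⁻ y, hitProb (gaussianVecKernel n) E₅ x y x y ∂Q ∂P ≤
      ENNReal.ofReal (D₅ / n) := by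
    refine le_trans ?_ (H₅ n hn)
    rw [← lintegral_indicator_one mc]
    refine lintegral_mono fun x => lintegral_const_le _ fun y => ?_
    by_cases hx : n * S₁ < sqDist x 0
    · rw [Set.indicator_of_mem (show x ∈ {x : (Fin n → ℝ) | n * S₁ < sqDist x 0} from hx)]
      exact prob_le_one
    · have : {z : (Fin n → ℝ) | (x, y, z) ∈ E₅} = ∅ := by ext z; simp [hE₅, not_lt.1 hx]
      simp [hitProb, this]
  have b₆ : ∫⁻ x, ∫⁻ y, hitProb (gaussianVecKernel n) E₆ x y x y ∂Q ∂P ≤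
      ENNReal.ofReal (D₆ / n) := by
    refine lintegral_const_le _ fun x => le_trans ?_ (H₆ n hn)
    rw [← lintegral_indicator_one mc']
    refine lintegral_mono fun y => ?_
    by_cases hy : n * S₂ < sqDist y 0
    · rw [Set.indicator_of_mem (show y ∈ {x : (Fin n → ℝ) | n * S₂ < sqDist x 0} from hy)]
      exact prob_le_one
    · have : {z : (Fin n → ℝ) | (x, y, z) ∈ E₆} = ∅ := by ext z; simp [hE₆, not_lt.1 hy]
      simp [hitProb, this]
  have hd : ∀ a b : ℝ, 0 ≤ a → 0 ≤ b → ENNReal.ofReal ((a + b) / n) =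
      ENNReal.ofReal (a / n) + ENNReal.ofReal (b / n) := fun a b ha hb => by
    rw [add_div, ENNReal.ofReal_add (by positivity) (by positivity)]
  rw [hT, hd _ _ hD₁0 (add_nonneg (hDl0 _) (add_nonneg (hDl0 _) (add_nonneg (hDl0 _)
      (add_nonneg hD₅ hD₆)))), hd _ _ (hDl0 _) (add_nonneg (hDl0 _) (add_nonneg (hDl0 _)
      (add_nonneg hD₅ hD₆))), hd _ _ (hDl0 _) (add_nonneg (hDl0 _) (add_nonneg hD₅ hD₆)),
    hd _ _ (hDl0 _) (add_nonneg hD₅ hD₆), hd _ _ hD₅ hD₆]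
  refine (lintegral_hitProb_union_le _ P Q m₁).trans (add_le_add b₁ ?_)
  refine (lintegral_hitProb_union_le _ P Q m₂).trans (add_le_add b₂ ?_)
  refine (lintegral_hitProb_union_le _ P Q m₃).trans (add_le_add b₃ ?_)
  refine (lintegral_hitProb_union_le _ P Q m₄).trans (add_le_add b₄ ?_)
  exact (lintegral_hitProb_union_le _ P Q m₅).trans (add_le_add b₅ b₆)

end TypicalSet

end

noncomputable section

/-! ### Achievability of the open pentagon. -/

section Achievability

variable {S₁ S₂ : ℝ} {n M₁ M₂ : ℕ}

/-- The code with given codebooks and deterministic decoder. -/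
def deterministicCode (hn : 0 < n) (x : Fin M₁ → Fin n → ℝ) (y : Fin M₂ → Fin n → ℝ)
    {φ : (Fin n → ℝ) → Fin M₁ × Fin M₂} (hφ : Measurable φ) (hx : ∀ i, sqDist (x i) 0 ≤ n * S₁)
    (hy : ∀ j, sqDist (y j) 0 ≤ n * S₂) : (gaussianMAC S₁ S₂).Code n M₁ M₂ where
  enc₁ := Kernel.deterministic x (measurable_of_finite x)
  enc₂ := Kernel.deterministic y (measurable_of_finite y)
  dec := Kernel.deterministic φ hφ
  enc₁_markov := inferInstance
  enc₂_markov := inferInstance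
  dec_markov := inferInstance
  cost₁ i := by
    have hnR : (0 : ℝ) < n := by exact_mod_cast hn
    rw [Kernel.deterministic_apply, ae_dirac_eq]
    change (1 / (n : ℝ)) * ∑ t, x i t ^ 2 ≤ S₁
    rw [one_div, inv_mul_le_iff₀ hnR]
    simpa [sqDist] using hx i
  cost₂ j := by
    have hnR : (0 : ℝ) < n := by exact_mod_cast hn
    rw [Kernel.deterministic_apply, ae_dirac_eq]
    change (1 / (n : ℝ)) * ∑ t, y j t ^ 2 ≤ S₂
    rw [one_div, inv_mul_le_iff₀ hnR]
    simpa [sqDist] using hy j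

lemma errorProb_deterministicCode (hn : 0 < n) (x : Fin M₁ → Fin n → ℝ) (y : Fin M₂ → Fin n → ℝ)
    {φ : (Fin n → ℝ) → Fin M₁ × Fin M₂} (hφ : Measurable φ) (hx : ∀ i, sqDist (x i) 0 ≤ n * S₁)
    (hy : ∀ j, sqDist (y j) 0 ≤ n * S₂) :
    (deterministicCode hn x y hφ hx hy).errorProb =
      (∑ i, ∑ j, gaussianVec (x i + y j) 1 {z | φ z ≠ (i, j)}) / ((M₁ * M₂ : ℕ) : ℝ≥0∞) := by
  unfold MAC.Code.errorProb
  congr 1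
  refine Finset.sum_congr rfl fun i _ => Finset.sum_congr rfl fun j _ => ?_
  have hm : MeasurableSet {z | φ z ≠ (i, j)} := hφ (Set.toFinite {(i, j)}ᶜ).measurableSet
  change ∫⁻ x, ∫⁻ y, ∫⁻ z, Kernel.deterministic φ hφ z {(i, j)}ᶜ
    ∂(Measure.pi fun t => (gaussianMAC S₁ S₂).W (x t, y t))
    ∂(Kernel.deterministic y (measurable_of_finite y) j)
    ∂(Kernel.deterministic x (measurable_of_finite x) i) = _
  rw [Kernel.lintegral_deterministic, Kernel.lintegral_deterministic, pi_gaussianMAC_W,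
    ← lintegral_indicator_one hm]
  refine lintegral_congr fun z => ?_
  rw [Kernel.deterministic_apply, Measure.dirac_apply' _ (Set.toFinite {(i, j)}ᶜ).measurableSet]
  rfl

/-- Random coding for the Gaussian channel at a fixed blocklength. -/
lemma exists_code_le (hS₁ : 0 ≤ S₁) (hS₂ : 0 ≤ S₂) {η : ℝ} (hη1 : η < 1) (hn : 0 < n)
    (hM₁ : 0 < M₁) (hM₂ : 0 < M₂) {a : ℝ≥0∞}
    (ha : ∫⁻ x, ∫⁻ y, hitProb (gaussianVecKernel n) (typicalSet n S₁ S₂ η)ᶜ x y x y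
        ∂(gaussianVec 0 ((1 - η) * S₂).toNNReal) ∂(gaussianVec 0 ((1 - η) * S₁).toNNReal) ≤ a) :
    ∃ c : (gaussianMAC S₁ S₂).Code n M₁ M₂, c.errorProb ≤ a +
      (M₁ - 1 : ℕ) * ENNReal.ofReal (Real.exp (-(n * (Real.log (1 + (1 - η) * S₁) / 2 - η)))) +
      (M₂ - 1 : ℕ) * ENNReal.ofReal (Real.exp (-(n * (Real.log (1 + (1 - η) * S₂) / 2 - η)))) +
      (M₁ - 1 : ℕ) * ((M₂ - 1 : ℕ) * ENNReal.ofReal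
        (Real.exp (-(n * (Real.log (1 + ((1 - η) * S₁ + (1 - η) * S₂)) / 2 - η))))) := by
  classical
  have hT := measurableSet_typicalSet n S₁ S₂ η
  obtain ⟨X, Y, hXY⟩ := exists_codebook_unionBound_le (M₁ := M₁) (M₂ := M₂) (gaussianVecKernel n) hT
    (gaussianVec 0 ((1 - η) * S₁).toNNReal) (gaussianVec 0 ((1 - η) * S₂).toNNReal) ha
    (lintegral_hitProb_fst_le hS₁ hη1) (lintegral_hitProb_snd_le hS₂ hη1)
    (lintegral_hitProb_both_le hS₁ hS₂ hη1)
  have : Nonempty (Fin M₁ × Fin M₂) := ⟨(⟨0, hM₁⟩, ⟨0, hM₂⟩)⟩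
  obtain ⟨φ, hφ, hφT⟩ := exists_decoder hT X Y
  have hz : ∀ {S : ℝ}, 0 ≤ S → sqDist (0 : Fin n → ℝ) 0 ≤ n * S := fun hS => by
    simp only [sqDist, sub_self]; simp; positivity
  -- Codewords that violate the power constraint are replaced by zero, so that the cost holds for
  -- every message.
  set x : Fin M₁ → Fin n → ℝ := fun i => if sqDist (X i) 0 ≤ n * S₁ then X i else 0 with hx
  set y : Fin M₂ → Fin n → ℝ := fun j => if sqDist (Y j) 0 ≤ n * S₂ then Y j else 0 with hy
  have hxc : ∀ i, sqDist (x i) 0 ≤ n * S₁ := fun i => by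
    simp only [hx]; split_ifs with h
    exacts [h, hz hS₁]
  have hyc : ∀ j, sqDist (y j) 0 ≤ n * S₂ := fun j => by
    simp only [hy]; split_ifs with h
    exacts [h, hz hS₂]
  refine ⟨deterministicCode hn x y hφ hxc hyc, ?_⟩
  rw [errorProb_deterministicCode]
  refine ENNReal.div_le_of_le_mul ?_
  rw [mul_comm]
  refine le_trans (Finset.sum_le_sum fun i _ => Finset.sum_le_sum fun j _ => ?_) hXY
  -- For a replaced codeword nothing is known of the error. But `typicalSet` includes the power
  -- constraints, so the atypical term of the union bound is already one.
  by_cases hok : sqDist (X i) 0 ≤ n * S₁ ∧ sqDist (Y j) 0 ≤ n * S₂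
  · have ex : x i = X i := by simp only [hx, if_pos hok.1]
    have ey : y j = Y j := by simp only [hy, if_pos hok.2]
    rw [ex, ey]
    exact measure_decoder_ne_le (gaussianVecKernel n) X Y hφT i j
  · have h1 : hitProb (gaussianVecKernel n) (typicalSet n S₁ S₂ η)ᶜ (X i) (Y j) (X i) (Y j) = 1 := by
      have : {z | (X i, Y j, z) ∈ (typicalSet n S₁ S₂ η)ᶜ} = Set.univ := by
        ext z
        simp only [Set.mem_ofPred_eq, Set.mem_compl_iff, Set.mem_univ, iff_true]
        exact fun hz => hok hz.2.2.2.2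
      rw [hitProb, this, measure_univ]
    refine prob_le_one.trans ?_
    rw [← h1]
    unfold unionBound
    rw [add_assoc, add_assoc]
    exact le_self_add

lemma eventually_ofReal_exp_neg_le {d ε : ℝ} (hd : 0 < d) (hε : 0 < ε) :
    ∀ᶠ n : ℕ in atTop, ENNReal.ofReal (Real.exp (-(n * d))) ≤ ENNReal.ofReal ε := by
  have h := Real.tendsto_exp_neg_atTop_nhds_zero.comp
    (tendsto_natCast_atTop_atTop.atTop_mul_const hd)
  filter_upwards [h.eventually (Iic_mem_nhds hε)] with n hn
  exact ENNReal.ofReal_le_ofReal hn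

/-- The number of competing messages is one less than the rounded-up size, which undoes the
rounding. -/
lemma cast_ceil_exp_sub_one_le (a : ℝ) :
    ((⌈Real.exp a⌉₊ - 1 : ℕ) : ℝ≥0∞) ≤ ENNReal.ofReal (Real.exp a) := by
  rw [← ENNReal.ofReal_natCast]
  refine ENNReal.ofReal_le_ofReal ?_
  have h := Nat.ceil_lt_add_one (Real.exp_pos a).le
  have h1 : 1 ≤ ⌈Real.exp a⌉₊ := Nat.ceil_pos.2 (Real.exp_pos a)
  rw [Nat.cast_sub h1]
  push_cast
  linarith

/-- At rate zero there is one message and no competitor, so the term vanishes whatever the exponent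
g is. This is how a zero rate lifts its constraint. -/
lemma eventually_single_le {c g ε : ℝ} (h : c = 0 ∨ c < g) (hε : 0 < ε) :
    ∀ᶠ n : ℕ in atTop, ((⌈Real.exp (n * c)⌉₊ - 1 : ℕ) : ℝ≥0∞) *
      ENNReal.ofReal (Real.exp (-(n * g))) ≤ ENNReal.ofReal ε := by
  rcases h with rfl | h
  · simp
  · filter_upwards [eventually_ofReal_exp_neg_le (sub_pos.2 h) hε] with n hn
    refine le_trans (mul_le_mul_left (cast_ceil_exp_sub_one_le _) _) ?_
    rw [← ENNReal.ofReal_mul (Real.exp_pos _).le, ← Real.exp_add]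
    rwa [show (n : ℝ) * c + -(n * g) = -(n * (g - c)) by ring]

lemma eventually_pair_le {c₁ c₂ g ε : ℝ} (h : c₁ = 0 ∨ c₂ = 0 ∨ c₁ + c₂ < g) (hε : 0 < ε) :
    ∀ᶠ n : ℕ in atTop, ((⌈Real.exp (n * c₁)⌉₊ - 1 : ℕ) : ℝ≥0∞) *
      (((⌈Real.exp (n * c₂)⌉₊ - 1 : ℕ) : ℝ≥0∞) * ENNReal.ofReal (Real.exp (-(n * g)))) ≤
        ENNReal.ofReal ε := by
  rcases h with rfl | rfl | h
  · simp
  · simp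
  · filter_upwards [eventually_ofReal_exp_neg_le (sub_pos.2 h) hε] with n hn
    refine le_trans (mul_le_mul' (cast_ceil_exp_sub_one_le _)
      (mul_le_mul_left (cast_ceil_exp_sub_one_le _) _)) ?_
    rw [← ENNReal.ofReal_mul (Real.exp_pos _).le, ← Real.exp_add,
      ← ENNReal.ofReal_mul (Real.exp_pos _).le, ← Real.exp_add]
    rwa [show (n : ℝ) * c₁ + (n * c₂ + -(n * g)) = -(n * (g - (c₁ + c₂))) by ring]

lemma eventually_lt_log_sub {c S : ℝ} (hS : 0 ≤ S) (h : c < Real.log (1 + S) / 2) :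
    ∀ᶠ η : ℝ in 𝓝[>] 0, c < Real.log (1 + (1 - η) * S) / 2 - η := by
  have hc : ContinuousAt (fun η : ℝ => Real.log (1 + (1 - η) * S) / 2 - η) 0 := by
    refine ContinuousAt.sub (ContinuousAt.div_const (ContinuousAt.log (by fun_prop) ?_) 2)
      continuousAt_id
    simp only [sub_zero, one_mul]; positivity
  refine nhdsWithin_le_nhds (hc.eventually (Ioi_mem_nhds ?_))
  simpa using h

/-- Rate pairs strictly inside the pentagon are achievable; a zero rate lifts its constraints. -/
theorem mem_capacityRegion (hS₁ : 0 ≤ S₁) (hS₂ : 0 ≤ S₂) {c : ℝ × ℝ} (h₁ : 0 ≤ c.1) (h₂ : 0 ≤ c.2)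
    (hc₁ : c.1 = 0 ∨ c.1 < Real.log (1 + S₁) / 2) (hc₂ : c.2 = 0 ∨ c.2 < Real.log (1 + S₂) / 2)
    (hc : c.1 = 0 ∨ c.2 = 0 ∨ c.1 + c.2 < Real.log (1 + (S₁ + S₂)) / 2) :
    c ∈ (gaussianMAC S₁ S₂).capacityRegion := by
  refine ⟨⟨h₁, h₂⟩, fun ε hε => ?_⟩
  -- The rate constraints are strict and the exponents are continuous in η at zero, so a small
  -- positive loss η keeps all of them.
  have hex : ∃ η : ℝ, 0 < η ∧ η < 1 ∧ (c.1 = 0 ∨ c.1 < Real.log (1 + (1 - η) * S₁) / 2 - η) ∧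
      (c.2 = 0 ∨ c.2 < Real.log (1 + (1 - η) * S₂) / 2 - η) ∧
      (c.1 = 0 ∨ c.2 = 0 ∨
        c.1 + c.2 < Real.log (1 + ((1 - η) * S₁ + (1 - η) * S₂)) / 2 - η) := by
    have e0 : ∀ᶠ η : ℝ in 𝓝[>] 0, 0 < η := self_mem_nhdsWithin
    have e1 : ∀ᶠ η : ℝ in 𝓝[>] 0, η < 1 := nhdsWithin_le_nhds (Iio_mem_nhds one_pos)
    have e2 : ∀ᶠ η : ℝ in 𝓝[>] 0, c.1 = 0 ∨ c.1 < Real.log (1 + (1 - η) * S₁) / 2 - η := by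
      rcases hc₁ with h | h
      · exact Eventually.of_forall fun _ => Or.inl h
      · exact (eventually_lt_log_sub hS₁ h).mono fun _ => Or.inr
    have e3 : ∀ᶠ η : ℝ in 𝓝[>] 0, c.2 = 0 ∨ c.2 < Real.log (1 + (1 - η) * S₂) / 2 - η := by
      rcases hc₂ with h | h
      · exact Eventually.of_forall fun _ => Or.inl h
      · exact (eventually_lt_log_sub hS₂ h).mono fun _ => Or.inr
    have e4 : ∀ᶠ η : ℝ in 𝓝[>] 0, c.1 = 0 ∨ c.2 = 0 ∨
        c.1 + c.2 < Real.log (1 + ((1 - η) * S₁ + (1 - η) * S₂)) / 2 - η := by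
      rcases hc with h | h | h
      · exact Eventually.of_forall fun _ => Or.inl h
      · exact Eventually.of_forall fun _ => Or.inr (Or.inl h)
      · refine (eventually_lt_log_sub (add_nonneg hS₁ hS₂) h).mono fun η hη => Or.inr (Or.inr ?_)
        rwa [mul_add] at hη
    exact (e0.and (e1.and (e2.and (e3.and e4)))).exists
  obtain ⟨η, hη, hη1, g₁, g₂, g₃⟩ := hex
  obtain ⟨D, hD, HD⟩ := exists_atypical_le hS₁ hS₂ hη hη1
  have hε4 : 0 < ε / 4 := by positivity
  have hDn : ∀ᶠ n : ℕ in atTop, ENNReal.ofReal (D / n) ≤ ENNReal.ofReal (ε / 4) := by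
    filter_upwards [(tendsto_const_div_atTop_nhds_zero_nat D).eventually (Iic_mem_nhds hε4)]
      with n hn
    exact ENNReal.ofReal_le_ofReal hn
  filter_upwards [hDn, eventually_single_le g₁ hε4, eventually_single_le g₂ hε4,
    eventually_pair_le g₃ hε4, eventually_gt_atTop 0] with n k₀ k₁ k₂ k₃ hn
  set M₁ := ⌈Real.exp (n * c.1)⌉₊ with hM₁
  set M₂ := ⌈Real.exp (n * c.2)⌉₊ with hM₂
  have hM₁0 : 0 < M₁ := Nat.ceil_pos.2 (Real.exp_pos _)
  have hM₂0 : 0 < M₂ := Nat.ceil_pos.2 (Real.exp_pos _)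
  have hnR : (0 : ℝ) < n := by exact_mod_cast hn
  have hlog : ∀ {a : ℝ} {M : ℕ}, M = ⌈Real.exp (n * a)⌉₊ → a ≤ Real.log M / n := by
    intro a M hM
    rw [le_div_iff₀ hnR, mul_comm, ← Real.log_exp (n * a), hM]
    exact Real.log_le_log (Real.exp_pos _) (Nat.le_ceil _)
  obtain ⟨code, hcode⟩ := exists_code_le hS₁ hS₂ hη1 hn hM₁0 hM₂0 (HD n hn)
  refine ⟨(Real.log M₁ / n, Real.log M₂ / n), ⟨M₁, M₂, hM₁0, hM₂0, ⟨code, hcode.trans ?_⟩, rfl⟩,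
    hlog hM₁, hlog hM₂⟩
  calc _ ≤ ENNReal.ofReal (ε / 4) + ENNReal.ofReal (ε / 4) + ENNReal.ofReal (ε / 4) +
        ENNReal.ofReal (ε / 4) := add_le_add (add_le_add (add_le_add k₀ k₁) k₂) k₃
    _ = ENNReal.ofReal ε := by
        rw [← ENNReal.ofReal_add hε4.le hε4.le, ← ENNReal.ofReal_add (by positivity) hε4.le,
          ← ENNReal.ofReal_add (by positivity) hε4.le]
        congr 1; ring

end Achievability

/-! ### Distance of finite-blocklength rates from the capacity region. -/

section SecondOrder

/-- Every rate pair at blocklength `n` is within `O(1/√n)` of the capacity region. -/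
theorem exists_rateRegion_near_capacityRegion {S₁ S₂ ε : ℝ} (hS₁ : 0 ≤ S₁) (hS₂ : 0 ≤ S₂)
    (hε : 0 < ε) (hε1 : ε < 1) : ∃ K : ℝ, ∀ᶠ n : ℕ in atTop,
      ∀ r ∈ (gaussianMAC S₁ S₂).rateRegion n ε, ∃ c ∈ (gaussianMAC S₁ S₂).capacityRegion,
        |r.1 - c.1| ≤ K / √n ∧ |r.2 - c.2| ≤ K / √n := by
  obtain ⟨K, hK, H⟩ := exists_converse hS₁ hS₂ hε hε1
  -- The additional 1/√n turns the weak inequalities of the converse into the strict ones that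
  -- achievability asks for.
  refine ⟨K + 1, ?_⟩
  filter_upwards [eventually_ge_atTop 225] with n hn
  rintro r ⟨M₁, M₂, hM₁, hM₂, ⟨code, hcode⟩, rfl⟩
  have hnR : (0 : ℝ) < n := by exact_mod_cast (by omega : 0 < n)
  have hsq : 0 < √(n : ℝ) := Real.sqrt_pos.2 hnR
  obtain ⟨b₁, b₂, b₃⟩ := H n hn M₁ M₂ hM₁ hM₂ code hcode
  have hdiv : ∀ {a L : ℝ}, a ≤ n * L + K * √n → a / n ≤ L + K / √n := by
    intro a L h
    rw [div_le_iff₀ hnR]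
    have : (L + K / √n) * n = n * L + K * √n := by
      rw [add_mul, div_mul_eq_mul_div, mul_div_assoc, Real.div_sqrt]; ring
    rw [this]; exact h
  have c₁ := hdiv b₁
  have c₂ := hdiv b₂
  have c₃ := hdiv b₃
  rw [add_div] at c₃
  set r₁ := Real.log M₁ / n with hr₁
  set r₂ := Real.log M₂ / n with hr₂
  have r₁0 : 0 ≤ r₁ := div_nonneg (Real.log_natCast_nonneg _) hnR.le
  have r₂0 : 0 ≤ r₂ := div_nonneg (Real.log_natCast_nonneg _) hnR.le
  set k := (K + 1) / √n with hk
  have hk1 : k = K / √n + 1 / √n := by rw [hk, add_div]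
  have h1s : 0 < 1 / √(n : ℝ) := by positivity
  have hKs : 0 ≤ K / √(n : ℝ) := by positivity
  have habs : ∀ {a : ℝ}, 0 ≤ a → |a - max 0 (a - k)| ≤ k := by
    intro a ha
    rcases le_total 0 (a - k) with h | h
    · rw [max_eq_right h, sub_sub_cancel, abs_of_nonneg (by linarith)]
    · rw [max_eq_left h, sub_zero, abs_of_nonneg ha]; linarith
  have hmax : ∀ a : ℝ, max 0 (a - k) = 0 ∨ max 0 (a - k) = a - k := fun a => max_choice 0 (a - k)
  -- Clipping at zero keeps the point in the quadrant. A clipped coordinate is zero and thereby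
  -- lifts both its own constraint and that on the sum.
  refine ⟨(max 0 (r₁ - k), max 0 (r₂ - k)), mem_capacityRegion hS₁ hS₂ (le_max_left _ _)
    (le_max_left _ _) ?_ ?_ ?_, habs r₁0, habs r₂0⟩
  · rcases hmax r₁ with h | h
    · exact Or.inl h
    · refine Or.inr ?_
      simp only [h]; linarith
  · rcases hmax r₂ with h | h
    · exact Or.inl h
    · refine Or.inr ?_
      simp only [h]; linarith
  · rcases hmax r₁ with h | h
    · exact Or.inl h
    · rcases hmax r₂ with h' | h'
      · exact Or.inr (Or.inl h')
      · refine Or.inr (Or.inr ?_)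
        simp only [h, h']; linarith

end SecondOrder

end

theorem mainTheorem4 (S₁ S₂ : ℝ) (hS₁ : 0 ≤ S₁) (hS₂ : 0 ≤ S₂) :
    (∃ K : ℝ≥0, ∀ α₁ α₂ : ℝ, 0 ≤ α₁ → 0 ≤ α₂ → max α₁ α₂ = 1 →
      (gaussianMAC S₁ S₂).weightedCapacity α₁ α₂ 0 < ∞ ∧
      (gaussianMAC S₁ S₂).weightedCapacityDeriv α₁ α₂ ≤ K) ∧
    (gaussianMAC S₁ S₂).Vmax < ∞ ∧
    (∀ ε : ℝ, 0 < ε → ε < 1 → ∃ K : ℝ, ∀ᶠ n : ℕ in atTop,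
      ∀ r ∈ (gaussianMAC S₁ S₂).rateRegion n ε,
        ∃ c ∈ (gaussianMAC S₁ S₂).capacityRegion,
          |r.1 - c.1| ≤ K / Real.sqrt n ∧ |r.2 - c.2| ≤ K / Real.sqrt n) := by
  exact ⟨weightedCapacity_gaussianMAC hS₁ hS₂, Vmax_gaussianMAC_lt_top S₁ S₂,
    fun _ hε hε1 => exists_rateRegion_near_capacityRegion hS₁ hS₂ hε hε1⟩
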